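/- Let $\mathbb R^\infty$ be a real inner product space of countably infinite dimension and $k$ a commutative ring; $V,W$ denote finite-dimensional subspaces of $\mathbb R^\infty$, and $V\times W$, $P\times Q$ denote the orthogonal sums $V+W$, $P+Q$ when $V\perp W$, $P\subset V$, $Q\subset W$. A polytope is a finite union of convex hulls of nonempty finite sets (convex polytopes); a cone is a finite union of convex cones, a convex cone being the set of nonnegative combinations of finitely many vectors. A valuation is a function $F$ with $F(\emptyset)=0$ and $F(P\cup Q)=F(P)+F(Q)-F(P\cap Q)$. Let $\mathcal P(V)$, resp. $\Sigma(V)$, be the target of the universal valuation $P\mapsto(P)$ of polytopes, resp. cones, in $V$; valuations are identified with homomorphisms out of these groups. For a convex polytope or cone $P$ put $(\mathrm{int}\,P)=(P)-(\partial P)$, with $\partial P$ the relative boundary. There are unique endomorphisms $I$ of $\mathcal P(V)$ and $I$, $D$ of $\Sigma(V)$ such that $I(P)=(-1)^{\dim P}(\mathrm{int}\,P)$ for every nonempty convex polytope, resp. convex cone, $P\subset V$, and $D(P)=(DP)$ for every convex cone $P\subset V$, where $DP=\{w\in V:\langle w,v\rangle\le 0\ \ \forall v\in P\}$. There is a unique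 homomorphism $e_V:\Sigma(V)\to\mathbb Z$ (the local Euler invariant) with $e_V(P)=\chi(P,P-0)=1-\chi(P\cap S(V))$ for every nonempty cone $P\subset V$, where $S(V)$ is the unit sphere; $\chi(P\cap S(V))$ is computed as the alternating number of cells of any cell decomposition of $P\cap S(V)$ induced by a conical cell structure (defined below) of $P$ whose cells contain no line. Let $\Delta(-1):\Sigma(V)\to\Sigma(V)$ be $(P)\mapsto(-P)$. A $k$-valued morphism is a family $F=\{F_V\}$ of valuations of cones in $V$ with values in $k$ such that $F_{V\times W}(P\times Q)=F_V(P)F_W(Q)$ when $V\perp W$, and $F_0(0)=1$. A $k$-valued multiplicative polytope invariant is a family $G=\{G_V\}$ of translation-invariant valuations of polytopes with the same two properties. Put $s(F)_V=F_V(V)$, $t(F)_V=F_V(\{0\})$, $p(G)_V=G_V(\text{point})$. For a function $O:V\mapsto O_V\in k$ put $(O\bullet F)_V=O_VF_V$, $(-O)_V=(-1)^{\dim V}O_V$ and $(-\bullet F)_V=(-1)^{\dim V}F_V$; similarly for $G$. The expressions $GI$, $FI$, $F\Delta(-1)I$ denote composition in each $V$, and $e$ is regarded as $k$-valued via $\mathbb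 Z\to k$. A (conical) cell structure of a polytope (cone) $P$ is a finite set of nonempty convex polytopes (convex cones), called cells, with union $P$, such that every face of every cell is a union of cells and no point is in the relative interior of two cells; a face is a nonempty set of points where some linear function is maximized. For a cell $\sigma$ of $P\subset V$, let $V_\sigma\subset V$ be the linear subspace parallel to the affine span of $\sigma$, $\sigma^\perp$ its orthogonal complement in $V$, and $\nu(\sigma,P)\subset\sigma^\perp$ the cone of all $w\in\sigma^\perp$ with $v+tw\in P$ for all sufficiently small $t>0$, where $v$ is a relative interior point of $\sigma$. If $s(F)=t(G)$ (for $G$ a morphism) or $s(F)=p(G)$ (for $G$ a multiplicative polytope invariant), then $$(F\star G)_V(P)=\sum_\sigma F_{\sigma^\perp}(\nu(\sigma,P))\cdot G_{V_\sigma}(\mathrm{int}\,\sigma),$$ the sum being over the cells of any (conical) cell structure of the cone or polytope $P$; in the polytope case $\sigma$ is translated into $V_\sigma$ to evaluate $G_{V_\sigma}$. **Theorem.** 1. On $\Sigma(V)$, with $d=\dim V$: $D\circ I=(-1)^d\,\Delta(-1)\circ I\circ D$. 2. For every $k$-valued multiplicative polytope invariant $G$, $$(-p(G)\bullet e)\star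 G=-\bullet GI,\qquad GI=(p(G)\bullet e)\star(-\bullet G).$$ 3. For every $k$-valued morphism $F$, $$(-t(F)\bullet e)\star F=-\bullet FI,\qquad FI=(t(F)\bullet e)\star(-\bullet F).$$ 4. For every $k$-valued morphism $F$, $$F\star(s(F)\bullet e)=F\Delta(-1)I.$$ In 2--4 all the $\star$-products are defined, every polytope and every cone has a (conical) cell structure, the formula for $\star$ holds for every such structure, and both sides of each identity are multiplicative polytope invariants (in 2), respectively morphisms (in 3 and 4). -/

import Mathlib

open scoped Pointwise

noncomputable section

namespace Scissors

/-! ## The universal valuation group of a class of sets -/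

section ValuationGroup

variable {E : Type*}

/-- `f` is a valuation on the class `A` of sets: `f ∅ = 0` and
`f (P ∪ Q) = f P + f Q - f (P ∩ Q)`. -/
structure IsValuation {M : Type*} [AddCommGroup M] (A : Set E → Prop) (f : {S // A S} → M) :
    Prop where
  empty : ∀ P, P.1 = ∅ → f P = 0
  union : ∀ P Q R S, R.1 = P.1 ∪ Q.1 → S.1 = P.1 ∩ Q.1 → f R = f P + f Q - f S

/-- The defining relations of the universal valuation group. -/
def valRel (A : Set E → Prop) : AddSubgroup (FreeAbelianGroup {S // A S}) :=
  AddSubgroup.closure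
    ({x | ∃ P : {S // A S}, P.1 = ∅ ∧ x = FreeAbelianGroup.of P} ∪
     {x | ∃ P Q R S : {S // A S}, R.1 = P.1 ∪ Q.1 ∧ S.1 = P.1 ∩ Q.1 ∧
        x = FreeAbelianGroup.of R -
          (FreeAbelianGroup.of P + FreeAbelianGroup.of Q - FreeAbelianGroup.of S)})

/-- The universal valuation group of the class `A`: one generator for each set in `A`, and the
valuation relations. Homomorphisms out of it are the valuations on `A` (see `ValGroup.lift`). -/
abbrev ValGroup (A : Set E → Prop) : Type _ := FreeAbelianGroup {S // A S} ⧸ valRel A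

/-- The universal valuation. -/
def ValGroup.mk {A : Set E → Prop} (P : {S // A S}) : ValGroup A :=
  QuotientAddGroup.mk (FreeAbelianGroup.of P)

/-- The homomorphism determined by a valuation. -/
def ValGroup.lift {M : Type*} [AddCommGroup M] {A : Set E → Prop} (f : {S // A S} → M)
    (hf : IsValuation A f) : ValGroup A →+ M :=
  QuotientAddGroup.lift (valRel A) (FreeAbelianGroup.lift f) (by
    unfold valRel
    rw [AddSubgroup.closure_le]
    rintro x (⟨P, hP, rfl⟩ | ⟨P, Q, R, S, hR, hS, rfl⟩)
    · simp [hf.empty P hP]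
    · simp [hf.union P Q R S hR hS])

theorem ValGroup.isValuation_mk (A : Set E → Prop) :
    IsValuation A (ValGroup.mk : {S // A S} → ValGroup A) where
  empty P hP := (QuotientAddGroup.eq_zero_iff _).2
    (AddSubgroup.subset_closure (Or.inl ⟨P, hP, rfl⟩))
  union P Q R S hR hS := by
    rw [← sub_eq_zero]
    exact (QuotientAddGroup.eq_zero_iff _).2
      (AddSubgroup.subset_closure (Or.inr ⟨P, Q, R, S, hR, hS, rfl⟩))

open Classical in
/-- The class `(P)` of a set `P` in the universal valuation group of `A` (by convention `0` if `P`
does not belong to `A`; the class is only used for sets in `A`). -/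
def cls (A : Set E → Prop) (P : Set E) : ValGroup A :=
  if h : A P then ValGroup.mk ⟨P, h⟩ else 0

end ValuationGroup

variable {E : Type*} [NormedAddCommGroup E] [InnerProductSpace ℝ E]

/-! ## Finite-dimensional subspaces -/

/-- The finite-dimensional vector subspaces of `E`. -/
abbrev FinSub (E : Type*) [NormedAddCommGroup E] [InnerProductSpace ℝ E] : Type _ :=
  {V : Submodule ℝ E // FiniteDimensional ℝ V}

instance (V : FinSub E) : FiniteDimensional ℝ V.1 := V.2

/-- The dimension of `V`. -/
def FinSub.dim (V : FinSub E) : ℕ := Module.finrank ℝ V.1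

/-- The trivial subspace. -/
def FinSub.zero : FinSub E := ⟨⊥, inferInstance⟩

/-- The subspace spanned by `V` and `W`, denoted `V × W` when `V` and `W` are orthogonal. -/
def FinSub.prod (V W : FinSub E) : FinSub E := ⟨V.1 ⊔ W.1, inferInstance⟩

/-- For `σ ⊆ V`, the linear subspace of `V` parallel to the affine span of `σ` (the span of `σ` if
`0 ∈ σ`). -/
def FinSub.along (V : FinSub E) (σ : Set E) : FinSub E :=
  ⟨V.1 ⊓ vectorSpan ℝ σ, inferInstance⟩

/-- For `σ ⊆ V`, the orthogonal complement `σ^⊥` in `V` of the linear subspace parallel to the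
affine span of `σ`. -/
def FinSub.perp (V : FinSub E) (σ : Set E) : FinSub E :=
  ⟨V.1 ⊓ (vectorSpan ℝ σ)ᗮ, inferInstance⟩

/-- The dimension of a convex set. -/
def dim (σ : Set E) : ℕ := Module.finrank ℝ (vectorSpan ℝ σ)

/-! ## Polytopes and cones -/

/-- A nonempty convex polytope: the convex hull of a nonempty finite set. -/
def IsConvexPolytope (P : Set E) : Prop :=
  ∃ s : Finset E, s.Nonempty ∧ P = convexHull ℝ (s : Set E)

/-- A polytope (compact PL subspace): a finite union of convex polytopes. -/
def IsPolytope (P : Set E) : Prop :=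
  ∃ C : Finset (Set E), (∀ c ∈ C, IsConvexPolytope c) ∧ P = ⋃ c ∈ C, c

/-- A convex cone: the set of nonnegative linear combinations of finitely many vectors. -/
def IsConvexCone (P : Set E) : Prop :=
  ∃ s : Finset E, P = (PointedCone.hull ℝ (s : Set E) : Set E)

/-- A cone: a finite union of convex cones (possibly empty). -/
def IsCone (P : Set E) : Prop :=
  ∃ C : Finset (Set E), (∀ c ∈ C, IsConvexCone c) ∧ P = ⋃ c ∈ C, c

/-- `P` is a polytope in `V`. -/
def IsPolytopeIn (V : FinSub E) (P : Set E) : Prop := IsPolytope P ∧ P ⊆ V.1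

/-- `P` is a cone in `V`. -/
def IsConeIn (V : FinSub E) (P : Set E) : Prop := IsCone P ∧ P ⊆ V.1

/-- The polytope group `𝒫(V)`. -/
abbrev PolyGroup (V : FinSub E) : Type _ := ValGroup (IsPolytopeIn V)

/-- The cone group `Σ(V)`. -/
abbrev ConeGroup (V : FinSub E) : Type _ := ValGroup (IsConeIn V)

/-- The class `(P)` in `𝒫(V)` of a polytope `P ⊆ V`. -/
def polyCls (V : FinSub E) (P : Set E) : PolyGroup V := cls (IsPolytopeIn V) P

/-- The class `(P)` in `Σ(V)` of a cone `P ⊆ V`. -/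
def coneCls (V : FinSub E) (P : Set E) : ConeGroup V := cls (IsConeIn V) P

/-- The class `(int P) = (P) - (∂P)` in `𝒫(V)` for a convex polytope `P ⊆ V`. -/
def polyIntCls (V : FinSub E) (P : Set E) : PolyGroup V :=
  polyCls V P - polyCls V (intrinsicFrontier ℝ P)

/-- The class `(int P) = (P) - (∂P)` in `Σ(V)` for a convex cone `P ⊆ V`. -/
def coneIntCls (V : FinSub E) (P : Set E) : ConeGroup V :=
  coneCls V P - coneCls V (intrinsicFrontier ℝ P)

/-! ## Cell structures and normal cones -/

/-- `F` is a face of the convex polytope or convex cone `P`: the (nonempty) subset on which some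
linear function is maximized. -/
def IsFace (F P : Set E) : Prop :=
  F.Nonempty ∧ ∃ l : E →ₗ[ℝ] ℝ, F = {x | x ∈ P ∧ ∀ y ∈ P, l y ≤ l x}

/-- `K` is a complex with cells in the class `cell` (convex polytopes, or convex cones) with union
`P`. -/
structure IsCellStructure (cell : Set E → Prop) (K : Finset (Set E)) (P : Set E) : Prop where
  cells : ∀ σ ∈ K, cell σ
  faces : ∀ σ ∈ K, ∀ F, IsFace F σ → ∃ L ⊆ K, F = ⋃ τ ∈ L, τ
  interiors : ∀ σ ∈ K, ∀ τ ∈ K, ∀ x,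
    x ∈ intrinsicInterior ℝ σ → x ∈ intrinsicInterior ℝ τ → σ = τ
  union : P = ⋃ σ ∈ K, σ

/-- A cell structure on a polytope. -/
abbrev IsPolyCellStructure (K : Finset (Set E)) (P : Set E) : Prop :=
  IsCellStructure IsConvexPolytope K P

/-- A conical cell structure on a cone. -/
abbrev IsConeCellStructure (K : Finset (Set E)) (P : Set E) : Prop :=
  IsCellStructure IsConvexCone K P

/-- The normal cone `ν(σ, P)`: the vectors `w` orthogonal to `σ` that point from an interior point
`v` of `σ` into `P`, that is, the cone with the same germ at `0` as the translate by `-v` of the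
intersection of `P` with the affine space through `v` orthogonal to `σ`. For a cell `σ` of a cell
structure of `P` it does not depend on `v`. -/
def normalCone (σ P : Set E) : Set E :=
  {w | w ∈ (vectorSpan ℝ σ)ᗮ ∧
    ∃ v ∈ intrinsicInterior ℝ σ, ∀ᶠ t in nhdsWithin (0 : ℝ) (Set.Ioi 0), v + t • w ∈ P}

open Classical in
/-- A translate of the nonempty set `σ` by minus one of its points. -/
def toOrigin (σ : Set E) : Set E :=
  if h : σ.Nonempty then (fun x => x - h.some) '' σ else ∅

/-! ## The operators `I`, `D`, `Δ(-1)` and the local Euler invariant -/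

/-- `I` is the interior involution of `𝒫(V)`: it takes the class of each nonempty convex polytope
`P` of dimension `m` to `(-1)^m (int P)`. -/
def IsPolyInterior (V : FinSub E) (I : PolyGroup V →+ PolyGroup V) : Prop :=
  ∀ P, IsConvexPolytope P → P ⊆ V.1 → I (polyCls V P) = (-1 : ℤ) ^ dim P • polyIntCls V P

/-- The interior involution of `𝒫(V)`. -/
def polyInterior (V : FinSub E) : PolyGroup V →+ PolyGroup V :=
  Classical.epsilon (IsPolyInterior V)

/-- `I` is the interior involution of `Σ(V)`: it takes the class of each convex cone `P` of
dimension `m` to `(-1)^m (int P)`. -/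
def IsConeInterior (V : FinSub E) (I : ConeGroup V →+ ConeGroup V) : Prop :=
  ∀ P, IsConvexCone P → P ⊆ V.1 → I (coneCls V P) = (-1 : ℤ) ^ dim P • coneIntCls V P

/-- The interior involution of `Σ(V)`. -/
def coneInterior (V : FinSub E) : ConeGroup V →+ ConeGroup V :=
  Classical.epsilon (IsConeInterior V)

/-- The dual in `V` of a subset of `V`. -/
def dualCone (V : FinSub E) (P : Set E) : Set E :=
  {w | w ∈ V.1 ∧ ∀ v ∈ P, inner ℝ w v ≤ 0}

/-- `D` is the duality involution of `Σ(V)`: it takes the class of each convex cone to the class of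
its dual. -/
def IsDuality (V : FinSub E) (D : ConeGroup V →+ ConeGroup V) : Prop :=
  ∀ P, IsConvexCone P → P ⊆ V.1 → D (coneCls V P) = coneCls V (dualCone V P)

/-- The duality involution of `Σ(V)`. -/
def duality (V : FinSub E) : ConeGroup V →+ ConeGroup V :=
  Classical.epsilon (IsDuality V)

theorem IsConvexCone.neg {P : Set E} (h : IsConvexCone P) : IsConvexCone (-P) := by
  classical
  obtain ⟨s, rfl⟩ := h
  refine ⟨-s, ?_⟩
  ext x
  have key : ∀ (t : Set E) (y : E), y ∈ PointedCone.hull ℝ t → -y ∈ PointedCone.hull ℝ (-t) := by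
    intro t y hy
    induction hy using Submodule.span_induction with
    | mem z hz => exact Submodule.subset_span (by simpa using hz)
    | zero => simp
    | add a b _ _ ha hb => rw [neg_add]; exact add_mem ha hb
    | smul c a _ ha => rw [← smul_neg]; exact Submodule.smul_mem _ c ha
  simp only [Set.mem_neg, SetLike.mem_coe, Finset.coe_neg]
  constructor
  · intro hx
    simpa using key _ _ hx
  · intro hx
    simpa using key _ _ hx

theorem IsConeIn.neg {V : FinSub E} {P : Set E} (h : IsConeIn V P) : IsConeIn V (-P) := by
  classical
  obtain ⟨⟨C, hC, rfl⟩, hV⟩ := h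
  refine ⟨⟨C.image (fun c => -c), ?_, ?_⟩, ?_⟩
  · intro c hc
    obtain ⟨d, hd, rfl⟩ := Finset.mem_image.1 hc
    exact (hC d hd).neg
  · ext x
    simp
  · intro x hx
    have := hV hx
    simpa using this

/-- The action `Δ(-1)` on `Σ(V)` of the dilatation `v ↦ -v`. -/
def negDilatation (V : FinSub E) : ConeGroup V →+ ConeGroup V :=
  ValGroup.lift (fun P => ValGroup.mk ⟨-P.1, P.2.neg⟩)
    { empty := fun P hP => (ValGroup.isValuation_mk _).empty _ (by simp [hP])
      union := fun P Q R S hR hS => (ValGroup.isValuation_mk _).union _ _ _ _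
        (by simp [hR]) (by simp [hS, Set.inter_neg]) }

open Classical in
/-- The Euler characteristic of the intersection with the unit sphere of a cone with a conical cell
structure `K` all of whose cells are line-free: each cell `σ ≠ 0` contributes a cell
of dimension `dim σ - 1`. -/
def linkEuler (K : Finset (Set E)) : ℤ :=
  ∑ σ ∈ K with σ ≠ {0}, (-1 : ℤ) ^ (dim σ - 1)

/-- `e` is the local Euler invariant on `Σ(V)`: for a nonempty cone `P` it is `χ(P, P - 0)`, that
is, `1` minus the Euler characteristic of the intersection of `P` with the unit sphere, the latter
being computed from any conical cell structure of `P` with line-free cells. -/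
def IsLocalEuler (V : FinSub E) (e : ConeGroup V →+ ℤ) : Prop :=
  ∀ P, IsConeIn V P → P.Nonempty → ∀ K, IsConeCellStructure K P →
    (∀ σ ∈ K, ∀ x ∈ σ, -x ∈ σ → x = 0) → e (coneCls V P) = 1 - linkEuler K

/-- The local Euler invariant. -/
def localEuler (V : FinSub E) : ConeGroup V →+ ℤ :=
  Classical.epsilon (IsLocalEuler V)

/-! ## Morphisms, objects and multiplicative polytope invariants -/

variable (E) in
/-- Families of `k`-valued valuations of cones, one for each finite-dimensional subspace. -/
abbrev ConeFamily (k : Type*) [CommRing k] : Type _ := ∀ V : FinSub E, ConeGroup V →+ k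

variable (E) in
/-- Families of `k`-valued valuations of polytopes, one for each finite-dimensional subspace. -/
abbrev PolyFamily (k : Type*) [CommRing k] : Type _ := ∀ V : FinSub E, PolyGroup V →+ k

variable {k : Type*} [CommRing k]

/-- The `k`-valued morphisms: multiplicative families of valuations of cones. -/
structure IsMorphism (F : ConeFamily E k) : Prop where
  mul : ∀ V W : FinSub E, V.1 ⟂ W.1 → ∀ P Q, IsConeIn V P → IsConeIn W Q →
    F (V.prod W) (coneCls (V.prod W) (P + Q)) = F V (coneCls V P) * F W (coneCls W Q)
  one : F FinSub.zero (coneCls FinSub.zero {0}) = 1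

/-- The `k`-valued multiplicative polytope invariants: multiplicative families of
translation-invariant valuations of polytopes. -/
structure IsPolytopeInvariant (G : PolyFamily E k) : Prop where
  translation : ∀ V : FinSub E, ∀ P, IsPolytopeIn V P → ∀ v ∈ V.1,
    G V (polyCls V (v +ᵥ P)) = G V (polyCls V P)
  mul : ∀ V W : FinSub E, V.1 ⟂ W.1 → ∀ P Q, IsPolytopeIn V P → IsPolytopeIn W Q →
    G (V.prod W) (polyCls (V.prod W) (P + Q)) = G V (polyCls V P) * G W (polyCls W Q)
  one : G FinSub.zero (polyCls FinSub.zero {0}) = 1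

/-- The source `s(F)_V = F_V(V)`. -/
def source (F : ConeFamily E k) (V : FinSub E) : k := F V (coneCls V (V.1 : Set E))

/-- The target `t(F)_V = F_V(0)`. -/
def target (F : ConeFamily E k) (V : FinSub E) : k := F V (coneCls V {0})

/-- The location `p(G)_V = G_V(point)`. -/
def location (G : PolyFamily E k) (V : FinSub E) : k := G V (polyCls V {0})

/-- The scalar object `a_V = a ^ dim V`. -/
def scalarObj (a : k) (V : FinSub E) : k := a ^ V.dim

/-- The scaling `O • F` of a family of valuations of cones. -/
def scaleCone (O : FinSub E → k) (F : ConeFamily E k) : ConeFamily E k :=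
  fun V => (AddMonoidHom.mulLeft (O V)).comp (F V)

/-- The scaling `O • G` of a family of valuations of polytopes. -/
def scalePoly (O : FinSub E → k) (G : PolyFamily E k) : PolyFamily E k :=
  fun V => (AddMonoidHom.mulLeft (O V)).comp (G V)

/-- The object `-O`, the product of `O` with the scalar object `-1`. -/
def negObj (O : FinSub E → k) : FinSub E → k := fun V => scalarObj (-1) V * O V

variable (E k) in
/-- The local Euler invariant with values in `k`. -/
def eulerMorphism : ConeFamily E k := fun V => (Int.castAddHom k).comp (localEuler V)

/-- `GI`, that is, `(GI)_V = G_V ∘ I`. -/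
def polyCompI (G : PolyFamily E k) : PolyFamily E k := fun V => (G V).comp (polyInterior V)

/-- `FI`, that is, `(FI)_V = F_V ∘ I`. -/
def coneCompI (F : ConeFamily E k) : ConeFamily E k := fun V => (F V).comp (coneInterior V)

/-- `FΔ(-1)`, that is, `(FΔ(-1))_V = F_V ∘ Δ(-1)`. -/
def coneCompNeg (F : ConeFamily E k) : ConeFamily E k := fun V => (F V).comp (negDilatation V)

/-! ## The `⋆`-product -/

/-- `F ⋆ G` is defined and equal to `H` for the morphisms `F`, `G`, `H`: the source of `F` is the
target of `G`, and for each cone `P` in `V` the value `H_V(P)` is the sum, over the cells of any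
conical cell structure of `P`, of `F_{σ^⊥}(ν(σ, P)) · G_σ(int σ)`. -/
structure IsStar (F G H : ConeFamily E k) : Prop where
  left : IsMorphism F
  right : IsMorphism G
  result : IsMorphism H
  compat : source F = target G
  exists_cells : ∀ V : FinSub E, ∀ P, IsConeIn V P → ∃ K, IsConeCellStructure K P
  formula : ∀ V : FinSub E, ∀ P, IsConeIn V P → ∀ K, IsConeCellStructure K P →
    H V (coneCls V P) = ∑ σ ∈ K,
      F (V.perp σ) (coneCls (V.perp σ) (normalCone σ P)) *
        G (V.along σ) (coneIntCls (V.along σ) σ)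

/-- `F ⋆ G` is defined and equal to `H` for the morphism `F` and the multiplicative polytope
invariants `G`, `H`: the source of `F` is the location of `G`, and for each polytope `P` in `V` the
value `H_V(P)` is the sum, over the cells of any cell structure of `P`, of
`F_{σ^⊥}(ν(σ, P)) · G_σ(int σ)`. Here `G_σ(int σ)` is evaluated on a translate of `σ` in the vector
space parallel to it. -/
structure IsPolyStar (F : ConeFamily E k) (G H : PolyFamily E k) : Prop where
  left : IsMorphism F
  right : IsPolytopeInvariant G
  result : IsPolytopeInvariant H
  compat : source F = location G
  exists_cells : ∀ V : FinSub E, ∀ P, IsPolytopeIn V P → ∃ K, IsPolyCellStructure K P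
  formula : ∀ V : FinSub E, ∀ P, IsPolytopeIn V P → ∀ K, IsPolyCellStructure K P →
    H V (polyCls V P) = ∑ σ ∈ K,
      F (V.perp σ) (coneCls (V.perp σ) (normalCone σ P)) *
        G (V.along σ) (polyIntCls (V.along σ) (toOrigin σ))

end Scissors

end

open scoped Pointwise

noncomputable section

namespace Scissors

/-! ## Indicator functions and the universal valuation group of a lattice of sets -/

section Lattice

variable {E : Type*}

/-! The universal valuation group of a lattice of sets embeds, by indicator functions, into the
integer-valued functions on `E` (`ValGroup.toFun_injective`). Hence identities in the cone and
polytope groups may be checked point by point, and homomorphisms into these groups may be built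
point by point (`exists_lift_toFun`). Conversely, a function of convex cones that is additive merely
under cutting by a hyperplane extends to the whole cone group (`exists_hom_of_cutAdditive`). This
produces the Euler homomorphism `eulerHom`, which is `(-1)^dim` on linear subspaces and `0` on all
other convex cones and turns out to be the local Euler invariant `e`; it also produces `D`, whose
value at `u` tests whether `u` is nonpositive on the cone.

The involution `I` is local: its value at `x` is the Euler number of the tangent cone at `x`,
because the tangent cone of a convex polyhedron at one of its points is a linear subspace exactly
when that point is in the relative interior (`eulerHom_tangent`). For an arbitrary polytope or cone
`P` with a cell structure, the tangent cone is constant along the interior of a cell `σ` and is the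
orthogonal sum of `V_σ` and `ν(σ, P)` (`tangent_eq_add_normalCone`). As `e` is multiplicative,
`I(P)` is the sum of `(-1)^dim σ · e(ν(σ, P)) · (int σ)` over the cells. Applying `F` or `G` and
splitting off the factor `t(F)` or `p(G)` of `σ^⊥` gives statements 2 and 3.

Statement 4 exchanges the roles of the point and the direction. For fixed `w`, the function of `y`
that tells whether `w` lies in the tangent cone at `y` is again an element of the cone group, the
cone moved infinitesimally by `-w`, and its Euler number is `I(P)(-w)` (`exists_shift`). Expanding
it over the cells, with `e(int σ) = (-1)^dim σ`, shows that `Δ(-1)I(P)` is the sum of `(-1)^dim σ`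
times the class of `V_σ × ν(σ, P)`.

Statement 1 and the Euler number computations are verified on cones cut out by linearly independent
functionals, which generate the cone group (`closure_polyCone`). There the interior is an
alternating sum of cones with fewer inequalities, and duality turns it into an alternating sum over
the faces of the dual simplicial cone. -/

open Classical in
/-- The integer-valued indicator function of a set. -/
def ind (P : Set E) (x : E) : ℤ := if x ∈ P then 1 else 0

theorem ind_of_mem {P : Set E} {x : E} (h : x ∈ P) : ind P x = 1 := if_pos h

theorem ind_of_notMem {P : Set E} {x : E} (h : x ∉ P) : ind P x = 0 := if_neg h

theorem ind_empty : ind (∅ : Set E) = 0 := by ext x; simp [ind]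

theorem ind_union (P Q : Set E) : ind (P ∪ Q) = ind P + ind Q - ind (P ∩ Q) := by
  ext x
  by_cases h1 : x ∈ P <;> by_cases h2 : x ∈ Q <;> simp [ind, h1, h2]

theorem ind_inter (P Q : Set E) (x : E) : ind (P ∩ Q) x = ind P x * ind Q x := by
  by_cases h1 : x ∈ P <;> by_cases h2 : x ∈ Q <;> simp [ind, h1, h2]

theorem ind_congr {F : Type*} {P : Set E} {Q : Set F} {x : E} {y : F} (h : x ∈ P ↔ y ∈ Q) :
    ind P x = ind Q y := by
  by_cases hx : x ∈ P
  · rw [ind_of_mem hx, ind_of_mem (h.1 hx)]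
  · rw [ind_of_notMem hx, ind_of_notMem fun hy => hx (h.2 hy)]

/-- A class of sets containing `∅` and closed under finite unions and intersections. -/
structure IsSetLattice (A : Set E → Prop) : Prop where
  empty : A ∅
  union : ∀ P Q, A P → A Q → A (P ∪ Q)
  inter : ∀ P Q, A P → A Q → A (P ∩ Q)

variable {A : Set E → Prop}

theorem cls_eq {P : Set E} (h : A P) : cls A P = ValGroup.mk ⟨P, h⟩ := dif_pos h

theorem cls_empty (h : A ∅) : cls A ∅ = 0 := by
  rw [cls_eq h]; exact (ValGroup.isValuation_mk A).empty _ rfl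

theorem cls_union (hA : IsSetLattice A) {P Q : Set E} (hP : A P) (hQ : A Q) :
    cls A (P ∪ Q) = cls A P + cls A Q - cls A (P ∩ Q) := by
  rw [cls_eq hP, cls_eq hQ, cls_eq (hA.union _ _ hP hQ), cls_eq (hA.inter _ _ hP hQ)]
  exact (ValGroup.isValuation_mk A).union _ _ _ _ rfl rfl

theorem closure_range_mk : AddSubgroup.closure (Set.range (ValGroup.mk (A := A))) = ⊤ := by
  rw [eq_top_iff]
  rintro x -
  obtain ⟨z, rfl⟩ := QuotientAddGroup.mk_surjective x
  induction z using FreeAbelianGroup.induction_on with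
  | zero => exact zero_mem _
  | of P => exact AddSubgroup.subset_closure ⟨P, rfl⟩
  | neg P h => exact neg_mem h
  | add a b ha hb => exact add_mem ha hb

theorem ValGroup.hom_ext {M : Type*} [AddCommGroup M] {f g : ValGroup A →+ M}
    (h : ∀ P, A P → f (cls A P) = g (cls A P)) : f = g := by
  refine AddMonoidHom.eq_of_eqOn_dense closure_range_mk ?_
  rintro _ ⟨P, rfl⟩
  have := h P.1 P.2
  rwa [cls_eq P.2] at this

@[simp] theorem ValGroup.lift_mk {M : Type*} [AddCommGroup M] (f : {S // A S} → M)
    (hf : IsValuation A f) (P : {S // A S}) : ValGroup.lift f hf (ValGroup.mk P) = f P := by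
  simp [ValGroup.lift, ValGroup.mk]

/-- The indicator function of an element of the universal valuation group. -/
def ValGroup.toFun (A : Set E → Prop) : ValGroup A →+ (E → ℤ) :=
  ValGroup.lift (fun P => ind P.1)
    { empty := fun P hP => by rw [hP, ind_empty]
      union := fun P Q R S hR hS => by rw [hR, hS, ind_union] }

theorem ValGroup.toFun_cls {P : Set E} (h : A P) : ValGroup.toFun A (cls A P) = ind P := by
  rw [cls_eq h, ValGroup.toFun, ValGroup.lift_mk]

/-- Evaluation of a function at a formal combination of points with coefficients in `M`. -/
def evalSum {M : Type*} [AddCommGroup M] (l : List (E × M)) : (E → ℤ) →+ M where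
  toFun g := (l.map fun p => g p.1 • p.2).sum
  map_zero' := by simp
  map_add' g h := by
    induction l with
    | nil => simp
    | cons a l ih =>
      rw [List.map_cons, List.sum_cons, ih, Pi.add_apply, add_smul]
      simp only [List.map_cons, List.sum_cons]
      abel

theorem evalSum_append {M : Type*} [AddCommGroup M] (l m : List (E × M)) (g : E → ℤ) :
    evalSum (l ++ m) g = evalSum l g + evalSum m g := by
  simp [evalSum]

theorem evalSum_congr {M : Type*} [AddCommGroup M] {l : List (E × M)} {g h : E → ℤ}
    (H : ∀ p ∈ l, g p.1 = h p.1) : evalSum l g = evalSum l h := by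
  simp only [evalSum, AddMonoidHom.coe_mk, ZeroHom.coe_mk]
  congr 1
  exact List.map_congr_left fun p hp => by rw [H p hp]

/-- On finitely many sets a valuation is a finite combination of point evaluations. For the
induction it must be localized to a region `S`: each new set `B` splits the valuation into `f (· ∩
B)`, which only sees `S ∩ B`, and the difference `f - f (· ∩ B)`, which only sees `S \ B`. Once no
sets remain, a single point of `T ∩ S` can carry the weight `f T`. -/
theorem exists_evalSum_of_valuation {M : Type*} [AddCommGroup M] (hA : IsSetLattice A)
    {T : Set E} (hT : A T) (L : List (Set E)) :
    (∀ B ∈ L, A B ∧ B ⊆ T) → ∀ (f : Set E → M) (S : Set E), f ∅ = 0 →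
      (∀ P Q, A P → A Q → f (P ∪ Q) = f P + f Q - f (P ∩ Q)) →
      (∀ P Q, A P → A Q → P ∩ S = Q ∩ S → f P = f Q) →
      ∃ l : List (E × M), (∀ p ∈ l, p.1 ∈ S) ∧ ∀ P ∈ T :: L, f P = evalSum l (ind P) := by
  induction L with
  | nil =>
    intro _ f S h0 _ hS
    by_cases hTS : (T ∩ S).Nonempty
    · obtain ⟨x, hxT, hxS⟩ := hTS
      refine ⟨[(x, f T)], by simpa using hxS, ?_⟩
      simp [evalSum, ind_of_mem hxT]
    · refine ⟨[], by simp, ?_⟩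
      have : f T = 0 := by
        rw [← h0]
        exact hS _ _ hT hA.empty (by rw [Set.not_nonempty_iff_eq_empty.1 hTS, Set.empty_inter])
      simp [evalSum, this]
  | cons B L ih =>
    intro hL f S h0 hf hS
    obtain ⟨hB, hBT⟩ := hL B (by simp)
    have hL' : ∀ B ∈ L, A B ∧ B ⊆ T := fun C hC => hL C (by simp [hC])
    obtain ⟨l, hl, hl'⟩ := ih hL' (fun P => f (P ∩ B)) (S ∩ B) (by simpa using h0)
      (fun P Q hP hQ => by
        show f ((P ∪ Q) ∩ B) = f (P ∩ B) + f (Q ∩ B) - f (P ∩ Q ∩ B)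
        rw [Set.union_inter_distrib_right, hf _ _ (hA.inter _ _ hP hB) (hA.inter _ _ hQ hB),
          ← Set.inter_inter_distrib_right P Q B])
      (fun P Q hP hQ h => hS _ _ (hA.inter _ _ hP hB) (hA.inter _ _ hQ hB) (by
        ext x
        have := Set.ext_iff.1 h x
        simp only [Set.mem_inter_iff] at this ⊢
        tauto))
    -- The lattice is not closed under complements; this form shows that the difference depends on
    -- `P` only through `P ∪ B`, that is, only on the part of `P` outside `B`.
    have hsub : ∀ P, A P → f P - f (P ∩ B) = f (P ∪ B) - f B := fun P hP => by
      rw [hf _ _ hP hB]; abel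
    obtain ⟨m, hm, hm'⟩ := ih hL' (fun P => f P - f (P ∩ B)) (S \ B) (by simp [h0])
      (fun P Q hP hQ => by
        show f (P ∪ Q) - f ((P ∪ Q) ∩ B) = f P - f (P ∩ B) + (f Q - f (Q ∩ B)) -
          (f (P ∩ Q) - f (P ∩ Q ∩ B))
        rw [Set.union_inter_distrib_right, hf _ _ (hA.inter _ _ hP hB) (hA.inter _ _ hQ hB),
          hf _ _ hP hQ, ← Set.inter_inter_distrib_right P Q B]
        abel)
      (fun P Q hP hQ h => by
        show f P - f (P ∩ B) = f Q - f (Q ∩ B)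
        rw [hsub P hP, hsub Q hQ, hS _ _ (hA.union _ _ hP hB) (hA.union _ _ hQ hB)]
        ext x
        have := Set.ext_iff.1 h x
        simp only [Set.mem_inter_iff, Set.mem_sdiff, Set.mem_union] at this ⊢
        tauto)
    refine ⟨l ++ m, ?_, ?_⟩
    · intro p hp
      rcases List.mem_append.1 hp with h | h
      · exact (hl p h).1
      · exact (hm p h).1
    · have key : ∀ P ∈ T :: L, f P = evalSum (l ++ m) (ind P) := fun P hP => by
        rw [evalSum_append, ← hl' P hP, ← hm' P hP]; abel
      intro P hP
      rcases List.mem_cons.1 hP with rfl | hP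
      · exact key P (by simp)
      rcases List.mem_cons.1 hP with rfl | hP
      · have h1 : evalSum m (ind P) = 0 := by
          rw [← map_zero (evalSum m)]
          exact evalSum_congr fun p hp => ind_of_notMem (hm p hp).2
        have h2 : evalSum l (ind P) = evalSum l (ind T) :=
          evalSum_congr fun p hp => by
            rw [ind_of_mem (hl p hp).2, ind_of_mem (hBT (hl p hp).2)]
        rw [evalSum_append, h1, h2, ← hl' T (by simp), Set.inter_eq_self_of_subset_right hBT,
          add_zero]
      · exact key P (by simp [hP])

/-- Only finitely many generators occur in `z`, so a relation among classes can be tested by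
constructions that are available only for finite lists of sets. -/
theorem exists_list_determining {X M : Type*} [AddCommGroup M] (z : FreeAbelianGroup X) :
    ∃ L : List X, ∀ φ ψ : FreeAbelianGroup X →+ M,
      (∀ P ∈ L, φ (FreeAbelianGroup.of P) = ψ (FreeAbelianGroup.of P)) → φ z = ψ z := by
  induction z using FreeAbelianGroup.induction_on with
  | zero => exact ⟨[], by simp⟩
  | of P => exact ⟨[P], fun φ ψ h => h P (by simp)⟩
  | neg P h =>
    obtain ⟨L, hL⟩ := h
    exact ⟨L, fun φ ψ h => by rw [map_neg, map_neg, hL φ ψ h]⟩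
  | add a b ha hb =>
    obtain ⟨L, hL⟩ := ha
    obtain ⟨K, hK⟩ := hb
    exact ⟨L ++ K, fun φ ψ h => by
      rw [map_add, map_add, hL φ ψ fun P hP => h P (by simp [hP]),
        hK φ ψ fun P hP => h P (by simp [hP])]⟩

theorem IsSetLattice.foldr_union (hA : IsSetLattice A) {L : List (Set E)} (h : ∀ P ∈ L, A P) :
    A (L.foldr (· ∪ ·) ∅) := by
  induction L with
  | nil => exact hA.empty
  | cons B L ih => exact hA.union _ _ (h B (by simp)) (ih fun P hP => h P (by simp [hP]))

theorem subset_foldr_union {L : List (Set E)} {B : Set E} (h : B ∈ L) :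
    B ⊆ L.foldr (· ∪ ·) ∅ := by
  induction L with
  | nil => simp at h
  | cons C L ih =>
    rcases List.mem_cons.1 h with rfl | h
    · exact Set.subset_union_left
    · exact (ih h).trans Set.subset_union_right

/-- The universal valuation group of a lattice of sets is a group of functions. -/
theorem ValGroup.toFun_injective (hA : IsSetLattice A) :
    Function.Injective (ValGroup.toFun A) := by
  rw [injective_iff_map_eq_zero]
  intro x hx
  obtain ⟨z, rfl⟩ := QuotientAddGroup.mk_surjective x
  obtain ⟨L, hL⟩ := exists_list_determining (M := ValGroup A) z
  have hL1 : ∀ B ∈ L.map Subtype.val, A B := by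
    intro B hB
    obtain ⟨P, -, rfl⟩ := List.mem_map.1 hB
    exact P.2
  -- The valuation taken here is the universal one. On the generators occurring in `z` it factors
  -- through indicator functions, so the class of `z` vanishes together with its indicator function.
  obtain ⟨l, -, hl⟩ := exists_evalSum_of_valuation hA (hA.foldr_union hL1)
    (L.map Subtype.val) (fun B hB => ⟨hL1 B hB, subset_foldr_union hB⟩) (cls A) Set.univ
    (cls_empty hA.empty) (fun P Q hP hQ => cls_union hA hP hQ)
    (fun P Q _ _ h => by rw [Set.inter_univ, Set.inter_univ] at h; rw [h])
  have := hL (QuotientAddGroup.mk' _)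
    (((evalSum l).comp (ValGroup.toFun A)).comp (QuotientAddGroup.mk' _)) (by
      intro P hP
      have h1 := hl P.1 (List.mem_cons_of_mem _ (List.mem_map.2 ⟨P, hP, rfl⟩))
      rw [← ValGroup.toFun_cls P.2, cls_eq P.2] at h1
      exact h1)
  have h2 : ValGroup.toFun A ((QuotientAddGroup.mk' (valRel A)) z) = 0 := hx
  rw [AddMonoidHom.comp_apply, AddMonoidHom.comp_apply, h2, map_zero] at this
  exact this

/-- A function-valued homomorphism that takes generators to functions of a valuation group lifts to
that group. -/
theorem exists_lift_toFun {G F : Type*} [AddCommGroup G] {B : Set F → Prop} (hB : IsSetLattice B)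
    (Φ : G →+ (F → ℤ)) {S : Set G} (hS : AddSubgroup.closure S = ⊤)
    (h : ∀ g ∈ S, ∃ ξ : ValGroup B, ValGroup.toFun B ξ = Φ g) :
    ∃ Ψ : G →+ ValGroup B, ∀ g, ValGroup.toFun B (Ψ g) = Φ g := by
  have hr : ∀ g, ∃ ξ : ValGroup B, ValGroup.toFun B ξ = Φ g := by
    intro g
    have : g ∈ AddSubgroup.closure S := hS ▸ AddSubgroup.mem_top g
    induction this using AddSubgroup.closure_induction with
    | mem x hx => exact h x hx
    | zero => exact ⟨0, by simp⟩
    | add x y _ _ hx hy =>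
      obtain ⟨ξ, hξ⟩ := hx
      obtain ⟨η, hη⟩ := hy
      exact ⟨ξ + η, by rw [map_add, map_add, hξ, hη]⟩
    | neg x _ hx =>
      obtain ⟨ξ, hξ⟩ := hx
      exact ⟨-ξ, by rw [map_neg, map_neg, hξ]⟩
  choose Ψ hΨ using hr
  -- Preimages under `toFun` are unique, which makes the chosen ones additive.
  have hinj := ValGroup.toFun_injective hB
  exact ⟨⟨⟨Ψ, hinj (by rw [hΨ, map_zero, map_zero])⟩,
    fun a b => hinj (by rw [map_add, hΨ, hΨ, hΨ, map_add])⟩, hΨ⟩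

/-- If the members of a lattice of sets are the finite unions of pieces, the classes of the pieces
generate the valuation group. -/
theorem closure_pieces (hA : IsSetLattice A) (piece : Set E → Prop)
    (hinter : ∀ c d, A c → A d → piece c → piece d → c ∩ d = ∅ ∨ piece (c ∩ d))
    (hunion : ∀ P, A P → ∃ C : Finset (Set E), (∀ c ∈ C, piece c ∧ A c) ∧ P = ⋃ c ∈ C, c) :
    AddSubgroup.closure {x | ∃ c, piece c ∧ A c ∧ x = cls A c} = ⊤ := by
  set G := AddSubgroup.closure {x | ∃ c, piece c ∧ A c ∧ x = cls A c} with hG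
  -- The induction is on the number of pieces: intersecting one piece with the union of the others
  -- gives a union of as many sets as there are others. Empty sets are admitted because these
  -- intersections may be empty.
  have main : ∀ n, ∀ l : List (Set E), l.length = n → (∀ c ∈ l, (c = ∅ ∨ piece c) ∧ A c) →
      cls A (l.foldr (· ∪ ·) ∅) ∈ G := by
    intro n
    induction n with
    | zero =>
      intro l hl _
      rw [List.length_eq_zero_iff.1 hl, List.foldr_nil, cls_empty hA.empty]
      exact zero_mem _
    | succ n ih =>
      intro l hl h
      obtain ⟨c, l, rfl⟩ := List.exists_cons_of_length_eq_add_one hl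
      have hl : l.length = n := by simpa using hl
      have hc := h c (by simp)
      have hl' : ∀ d ∈ l, (d = ∅ ∨ piece d) ∧ A d := fun d hd => h d (by simp [hd])
      rw [List.foldr_cons, cls_union hA hc.2 (hA.foldr_union fun P hP => (hl' P hP).2)]
      have e : c ∩ l.foldr (· ∪ ·) ∅ = (l.map (c ∩ ·)).foldr (· ∪ ·) ∅ := by
        clear * -
        induction l with
        | nil => simp
        | cons d l ih => simp only [List.foldr_cons, List.map_cons, Set.inter_union_distrib_left]; rw [ih]
      refine sub_mem (add_mem ?_ (ih l hl hl')) ?_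
      · rcases hc.1 with h1 | h1
        · rw [h1, cls_empty hA.empty]; exact zero_mem _
        · exact AddSubgroup.subset_closure ⟨c, h1, hc.2, rfl⟩
      · rw [e]
        refine ih _ (by simpa using hl) ?_
        intro d' hd'
        obtain ⟨d, hd, rfl⟩ := List.mem_map.1 hd'
        refine ⟨?_, hA.inter _ _ hc.2 (hl' d hd).2⟩
        rcases hc.1 with h1 | h1
        · left; simp [h1]
        rcases (hl' d hd).1 with h2 | h2
        · left; simp [h2]
        exact hinter c d hc.2 (hl' d hd).2 h1 h2
  rw [eq_top_iff, ← closure_range_mk, AddSubgroup.closure_le]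
  rintro _ ⟨P, rfl⟩
  obtain ⟨C, hC, hP⟩ := hunion P.1 P.2
  have : P.1 = C.toList.foldr (· ∪ ·) ∅ := by
    rw [hP]
    ext x
    constructor
    · intro hx
      obtain ⟨c, hc, hx⟩ := Set.mem_iUnion₂.1 hx
      exact subset_foldr_union (Finset.mem_toList.2 hc) hx
    · have : ∀ l : List (Set E), x ∈ l.foldr (· ∪ ·) ∅ → ∃ c ∈ l, x ∈ c := by
        intro l
        induction l with
        | nil => simp
        | cons d l ih =>
          rintro (h | h)
          · exact ⟨d, by simp, h⟩
          · obtain ⟨c, hc, hx⟩ := ih h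
            exact ⟨c, by simp [hc], hx⟩
      intro hx
      obtain ⟨c, hc, hx⟩ := this _ hx
      exact Set.mem_iUnion₂.2 ⟨c, Finset.mem_toList.1 hc, hx⟩
  have h2 := main _ C.toList rfl fun c hc =>
    ⟨Or.inr (hC c (Finset.mem_toList.1 hc)).1, (hC c (Finset.mem_toList.1 hc)).2⟩
  rw [← this, cls_eq P.2] at h2
  exact h2

end Lattice

/-! ## The Minkowski–Weyl theorem -/

section Weyl

variable {E : Type*} [AddCommGroup E] [Module ℝ E]

open PointedCone

theorem hull_nonneg {s : Set E} {l : E →ₗ[ℝ] ℝ} (h : ∀ p ∈ s, 0 ≤ l p) {x : E}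
    (hx : x ∈ hull ℝ s) : 0 ≤ l x := by
  induction hx using Submodule.span_induction with
  | mem z hz => exact h z hz
  | zero => simp
  | add a b _ _ ha hb => rw [map_add]; exact add_nonneg ha hb
  | smul c a _ ha =>
    have : l (c • a) = c.1 * l a := by rw [← smul_eq_mul, ← map_smul]; rfl
    rw [this]; exact mul_nonneg c.2 ha

theorem hull_le_submodule {s : Set E} {V : Submodule ℝ E} (h : s ⊆ V) {x : E}
    (hx : x ∈ hull ℝ s) : x ∈ V :=
  (Submodule.span_le (p := V.restrictScalars {c : ℝ // 0 ≤ c})).2 h hx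

/-- A finitely generated cone is a finite intersection of half-spaces. -/
theorem exists_functionals_of_hull (V : Submodule ℝ E) [FiniteDimensional ℝ V] (s : Finset E)
    (hs : (s : Set E) ⊆ V) :
    ∃ L : Finset (E →ₗ[ℝ] ℝ), ∀ x, x ∈ hull ℝ (s : Set E) ↔ x ∈ V ∧ ∀ l ∈ L, 0 ≤ l x := by
  classical
  induction s using Finset.induction_on with
  | empty =>
    let b := Module.finBasis ℝ V
    choose g hg using fun i => LinearMap.exists_extend (b.coord i)
    refine ⟨Finset.univ.image g ∪ Finset.univ.image (fun i => -g i), fun x => ?_⟩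
    simp only [Finset.coe_empty, Submodule.span_empty, Submodule.mem_bot, hull]
    constructor
    · rintro rfl
      simp
    · rintro ⟨hx, h⟩
      have : (⟨x, hx⟩ : V) = 0 := by
        rw [← b.forall_coord_eq_zero_iff]
        intro i
        have e : b.coord i ⟨x, hx⟩ = g i x := by rw [← hg i]; rfl
        have h1 := h (g i) (by simp)
        have h2 := h (-g i) (by simp)
        rw [LinearMap.neg_apply] at h2
        linarith
      simpa using this
  | insert v s hv ih =>
    rw [Finset.coe_insert, Set.insert_subset_iff] at hs
    obtain ⟨L, hL⟩ := ih hs.2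
    -- Fourier–Motzkin elimination of the coefficient `t` in `x - t • v`: functionals nonnegative at
    -- `v` survive, and pairs of opposite sign at `v` are combined into a functional that vanishes
    -- at `v`.
    refine ⟨L.filter (fun l => 0 ≤ l v) ∪
      ((L ×ˢ L).filter (fun p => 0 < p.1 v ∧ p.2 v < 0)).image
        (fun p => p.1 v • p.2 - p.2 v • p.1), fun x => ?_⟩
    rw [Finset.coe_insert, hull, Submodule.mem_span_insert]
    constructor
    · rintro ⟨a, z, hz, rfl⟩
      have hz' := (hL z).1 hz
      refine ⟨V.add_mem (V.smul_mem a.1 hs.1) hz'.1, fun l hl => ?_⟩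
      have key : ∀ m : E →ₗ[ℝ] ℝ, m (a • v + z) = a.1 * m v + m z := fun m => by
        rw [map_add, ← smul_eq_mul, ← map_smul]; rfl
      rcases Finset.mem_union.1 hl with hl | hl
      · rw [Finset.mem_filter] at hl
        rw [key]
        exact add_nonneg (mul_nonneg a.2 hl.2) (hz'.2 l hl.1)
      · obtain ⟨⟨p, q⟩, hpq, rfl⟩ := Finset.mem_image.1 hl
        simp only [Finset.mem_filter, Finset.mem_product] at hpq
        simp only [LinearMap.sub_apply, LinearMap.smul_apply, smul_eq_mul, key]
        have h1 := hz'.2 p hpq.1.1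
        have h2 := hz'.2 q hpq.1.2
        nlinarith [mul_nonneg hpq.2.1.le h2, mul_nonneg (neg_nonneg.2 hpq.2.2.le) h1]
    · rintro ⟨hx, h⟩
      -- Each functional negative at `v` bounds the coefficient of `v` from below, as does `0`. The
      -- largest lower bound is taken; the combined functionals say that it respects every upper
      -- bound.
      set B : Finset ℝ := insert 0 ((L.filter (fun l => l v < 0)).image (fun m => m x / m v))
      have hB : B.Nonempty := ⟨0, by simp [B]⟩
      set t := B.max' hB
      have ht0 : 0 ≤ t := B.le_max' 0 (by simp [B])
      refine ⟨⟨t, ht0⟩, x - t • v, (hL _).2 ⟨V.sub_mem hx (V.smul_mem t hs.1), fun l hl => ?_⟩,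
        by show x = t • v + (x - t • v); abel⟩
      rw [map_sub, map_smul, smul_eq_mul]
      rcases lt_trichotomy (l v) 0 with hlv | hlv | hlv
      · have : l x / l v ≤ t := B.le_max' _ (by
          simp only [B, Finset.mem_insert, Finset.mem_image, Finset.mem_filter]
          exact Or.inr ⟨l, ⟨hl, hlv⟩, rfl⟩)
        rw [div_le_iff_of_neg hlv] at this
        linarith
      · have := h l (Finset.mem_union_left _ (Finset.mem_filter.2 ⟨hl, hlv.ge⟩))
        rw [hlv]; linarith
      · have ht : t ∈ B := B.max'_mem hB
        rcases Finset.mem_insert.1 ht with ht | ht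
        · rw [ht]
          have := h l (Finset.mem_union_left _ (Finset.mem_filter.2 ⟨hl, hlv.le⟩))
          linarith
        · obtain ⟨m, hm, hmt⟩ := Finset.mem_image.1 ht
          rw [Finset.mem_filter] at hm
          have := h _ (Finset.mem_union_right _ (Finset.mem_image.2 ⟨(l, m), Finset.mem_filter.2
            ⟨Finset.mem_product.2 ⟨hl, hm.1⟩, hlv, hm.2⟩, rfl⟩))
          simp only [LinearMap.sub_apply, LinearMap.smul_apply, smul_eq_mul] at this
          rw [← hmt]
          have h3 : m x / m v * l v ≤ l x := by
            rw [div_mul_eq_mul_div, div_le_iff_of_neg hm.2]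
            linarith
          linarith

/-- The intersection of a finitely generated cone with a half-space is finitely generated. -/
theorem exists_hull_inter_halfspace (s : Finset E) (l : E →ₗ[ℝ] ℝ) :
    ∃ s' : Finset E, (∀ x, x ∈ hull ℝ (s' : Set E) ↔ x ∈ hull ℝ (s : Set E) ∧ 0 ≤ l x) ∧
      ∀ h : E →ₗ[ℝ] ℝ, (∀ p ∈ s, 0 < h p) → ∀ p ∈ s', 0 < h p := by
  classical
  -- New generators: the old ones in the half-space, and the points where the hyperplane `l = 0`
  -- meets the planar cones spanned by two generators on opposite sides.
  set sp := s.filter (fun p => 0 ≤ l p)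
  set sn := s.filter (fun p => l p < 0)
  set sc := ((s ×ˢ s).filter (fun p => 0 < l p.1 ∧ l p.2 < 0)).image
    (fun p => l p.1 • p.2 - l p.2 • p.1)
  have hsp : ∀ p, p ∈ sp ↔ p ∈ s ∧ 0 ≤ l p := fun p => Finset.mem_filter
  have hsn : ∀ p, p ∈ sn ↔ p ∈ s ∧ l p < 0 := fun p => Finset.mem_filter
  have hsc : ∀ x ∈ sc, ∃ p ∈ s, ∃ q ∈ s, 0 < l p ∧ l q < 0 ∧ x = l p • q - l q • p := by
    intro x hx
    obtain ⟨⟨p, q⟩, hpq, rfl⟩ := Finset.mem_image.1 hx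
    simp only [Finset.mem_filter, Finset.mem_product] at hpq
    exact ⟨p, hpq.1.1, q, hpq.1.2, hpq.2.1, hpq.2.2, rfl⟩
  have hs : sp ∪ sn = s := by
    ext p
    rw [Finset.mem_union, hsp, hsn]
    rcases le_or_gt 0 (l p) with h | h <;> simp [h]
  have hsub : ∀ p ∈ s, p ∈ hull ℝ (s : Set E) := fun p hp => Submodule.subset_span hp
  refine ⟨sp ∪ sc, fun x => ⟨fun hx => ⟨?_, ?_⟩, fun ⟨hx, hlx⟩ => ?_⟩, ?_⟩
  · refine (Submodule.span_le (p := hull ℝ (s : Set E))).2 ?_ hx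
    intro y hy
    rcases Finset.mem_union.1 hy with hy | hy
    · exact hsub y ((hsp y).1 hy).1
    · obtain ⟨p, hp, q, hq, h1, h2, rfl⟩ := hsc y hy
      rw [sub_eq_add_neg, ← neg_smul]
      exact add_mem (PointedCone.smul_mem _ h1.le (hsub q hq))
        (PointedCone.smul_mem _ (by linarith) (hsub p hp))
  · refine hull_nonneg ?_ hx
    intro y hy
    rcases Finset.mem_union.1 hy with hy | hy
    · exact ((hsp y).1 hy).2
    · obtain ⟨p, hp, q, hq, h1, h2, rfl⟩ := hsc y hy
      simp only [map_sub, map_smul, smul_eq_mul]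
      linarith [mul_comm (l p) (l q)]
  · set C := hull ℝ ((sp ∪ sc : Finset E) : Set E) with hC
    have hspC : ∀ y ∈ hull ℝ (sp : Set E), y ∈ C := fun y hy =>
      Submodule.span_mono (by simp) hy
    have cross1 : ∀ q ∈ sn, ∀ y ∈ hull ℝ (sp : Set E), l y • q - l q • y ∈ C := by
      intro q hq y hy
      induction hy using Submodule.span_induction with
      | mem p hp =>
        have hp' := (hsp p).1 hp
        have hq' := (hsn q).1 hq
        rcases hp'.2.eq_or_lt with h | h
        · rw [← h, zero_smul, zero_sub, ← neg_smul]
          exact PointedCone.smul_mem _ (by linarith [hq'.2]) (hspC p (Submodule.subset_span hp))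
        · refine Submodule.subset_span ?_
          rw [Finset.coe_union]
          exact Or.inr (Finset.mem_image.2 ⟨(p, q), Finset.mem_filter.2
            ⟨Finset.mem_product.2 ⟨hp'.1, hq'.1⟩, h, hq'.2⟩, rfl⟩)
      | zero => simp
      | add a b _ _ ha hb =>
        have : l (a + b) • q - l q • (a + b) = (l a • q - l q • a) + (l b • q - l q • b) := by
          rw [map_add]; module
        rw [this]; exact add_mem ha hb
      | smul c a _ ha =>
        have : l (c • a) • q - l q • (c • a) = c • (l a • q - l q • a) := by
          show l (c.1 • a) • q - l q • (c.1 • a) = c.1 • (l a • q - l q • a)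
          rw [map_smul, smul_eq_mul]; module
        rw [this]; exact Submodule.smul_mem C c ha
    have cross : ∀ y ∈ hull ℝ (sp : Set E), ∀ z ∈ hull ℝ (sn : Set E),
        l y • z - l z • y ∈ C := by
      intro y hy z hz
      induction hz using Submodule.span_induction with
      | mem q hq => exact cross1 q hq y hy
      | zero => simp
      | add a b _ _ ha hb =>
        have : l y • (a + b) - l (a + b) • y = (l y • a - l a • y) + (l y • b - l b • y) := by
          rw [map_add]; module
        rw [this]; exact add_mem ha hb
      | smul c a _ ha =>
        have : l y • (c • a) - l (c • a) • y = c • (l y • a - l a • y) := by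
          show l y • (c.1 • a) - l (c.1 • a) • y = c.1 • (l y • a - l a • y)
          rw [map_smul, smul_eq_mul]; module
        rw [this]; exact Submodule.smul_mem C c ha
    have hneg : ∀ z ∈ hull ℝ (sn : Set E), z = 0 ∨ l z < 0 := by
      intro z hz
      induction hz using Submodule.span_induction with
      | mem q hq => exact Or.inr ((hsn q).1 hq).2
      | zero => exact Or.inl rfl
      | add a b _ _ ha hb =>
        rw [map_add]
        rcases ha with rfl | ha <;> rcases hb with rfl | hb
        · simp
        · right; simpa using hb
        · right; simpa using ha
        · right; linarith
      | smul c a _ ha =>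
        rcases ha with rfl | ha
        · simp
        · rcases c.2.eq_or_lt with h | h
          · left; show c.1 • a = 0; rw [← h, zero_smul]
          · right; show l (c.1 • a) < 0; rw [map_smul, smul_eq_mul]; exact mul_neg_of_pos_of_neg h ha
    rw [← hs, Finset.coe_union, hull, Submodule.span_union, Submodule.mem_sup] at hx
    obtain ⟨y, hy, z, hz, rfl⟩ := hx
    rw [map_add] at hlx
    rcases hneg z hz with rfl | hlz
    · simpa using hspC y hy
    · have hly : 0 < l y := by linarith
      -- All of the negative part `z` is absorbed into a vector on the hyperplane; what remains is a
      -- nonnegative multiple of `y`, since `l (y + z) ≥ 0`.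
      have : y + z = (l y)⁻¹ • (l y • z - l z • y) + ((l y + l z) / l y) • y := by
        rw [smul_sub, smul_smul, smul_smul, inv_mul_cancel₀ hly.ne', one_smul, add_div,
          div_self hly.ne', add_smul, one_smul, div_eq_inv_mul]
        abel
      rw [this]
      exact add_mem (PointedCone.smul_mem _ (inv_pos.2 hly).le (cross y hy z hz))
        (PointedCone.smul_mem _ (div_nonneg hlx hly.le) (hspC y hy))
  -- This clause will be used with `h` the height coordinate: cutting the cone over a polytope
  -- creates no generators at height zero.
  · intro h hp y hy
    rcases Finset.mem_union.1 hy with hy | hy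
    · exact hp y ((hsp y).1 hy).1
    · obtain ⟨p, hp', q, hq, h1, h2, rfl⟩ := hsc y hy
      simp only [map_sub, map_smul, smul_eq_mul]
      nlinarith [mul_pos h1 (hp q hq), mul_pos (neg_pos.2 h2) (hp p hp')]

theorem exists_hull_inter_halfspaces (s : Finset E) (L : Finset (E →ₗ[ℝ] ℝ)) :
    ∃ s' : Finset E, (∀ x, x ∈ hull ℝ (s' : Set E) ↔ x ∈ hull ℝ (s : Set E) ∧ ∀ l ∈ L, 0 ≤ l x) ∧
      ∀ h : E →ₗ[ℝ] ℝ, (∀ p ∈ s, 0 < h p) → ∀ p ∈ s', 0 < h p := by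
  classical
  induction L using Finset.induction_on with
  | empty => exact ⟨s, by simp, by simp⟩
  | insert l L _ ih =>
    obtain ⟨s₁, h1, h1'⟩ := ih
    obtain ⟨s₂, h2, h2'⟩ := exists_hull_inter_halfspace s₁ l
    refine ⟨s₂, fun x => ?_, fun h hp => h2' h (h1' h hp)⟩
    rw [h2, h1, Finset.forall_mem_insert]
    tauto

/-- A finite-dimensional subspace is a finitely generated cone. -/
theorem exists_hull_eq_submodule (V : Submodule ℝ E) [FiniteDimensional ℝ V] :
    ∃ s : Finset E, ∀ x, x ∈ hull ℝ (s : Set E) ↔ x ∈ V := by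
  classical
  obtain ⟨t, ht⟩ := (Submodule.fg_iff_finiteDimensional V).2 inferInstance
  have htV : (t : Set E) ⊆ V := ht ▸ Submodule.subset_span
  refine ⟨t ∪ t.image (fun x => -x), fun x => ⟨fun hx => hull_le_submodule ?_ hx, fun hx => ?_⟩⟩
  · intro y hy
    rcases Finset.mem_union.1 hy with hy | hy
    · exact htV hy
    · obtain ⟨z, hz, rfl⟩ := Finset.mem_image.1 hy
      exact V.neg_mem (htV hz)
  · rw [← ht] at hx
    set C := hull ℝ ((t ∪ t.image (fun x => -x) : Finset E) : Set E) with hC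
    suffices x ∈ C ∧ -x ∈ C from this.1
    induction hx using Submodule.span_induction with
    | mem z hz =>
      exact ⟨Submodule.subset_span (Finset.mem_union_left _ hz),
        Submodule.subset_span (Finset.mem_union_right _ (Finset.mem_image_of_mem _ hz))⟩
    | zero => simp
    | add a b _ _ ha hb =>
      exact ⟨add_mem ha.1 hb.1, by rw [neg_add]; exact add_mem ha.2 hb.2⟩
    | smul c a _ ha =>
      rcases le_total 0 c with h | h
      · exact ⟨PointedCone.smul_mem _ h ha.1, by
          rw [← smul_neg]; exact PointedCone.smul_mem _ h ha.2⟩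
      · refine ⟨?_, ?_⟩
        · have := PointedCone.smul_mem C (neg_nonneg.2 h) ha.2
          rwa [smul_neg, neg_smul, neg_neg] at this
        · have := PointedCone.smul_mem C (neg_nonneg.2 h) ha.1
          rwa [neg_smul] at this

/-- The slice at height one of a finitely generated cone whose generators have positive height. -/
theorem mem_convexHull_iff_hull (s : Finset (E × ℝ)) (hs : ∀ p ∈ s, 0 < p.2) (x : E) :
    (x, (1 : ℝ)) ∈ hull ℝ (s : Set (E × ℝ)) ↔
      x ∈ convexHull ℝ ((fun p : E × ℝ => p.2⁻¹ • p.1) '' (s : Set (E × ℝ))) := by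
  set K := convexHull ℝ ((fun p : E × ℝ => p.2⁻¹ • p.1) '' (s : Set (E × ℝ))) with hK
  constructor
  · intro hx
    have main : ∀ y ∈ hull ℝ (s : Set (E × ℝ)), y = 0 ∨ (0 < y.2 ∧ y.2⁻¹ • y.1 ∈ K) := by
      intro y hy
      induction hy using Submodule.span_induction with
      | mem p hp => exact Or.inr ⟨hs p hp, subset_convexHull ℝ _ ⟨p, hp, rfl⟩⟩
      | zero => exact Or.inl rfl
      | add a b _ _ ha hb =>
        rcases ha with rfl | ha <;> rcases hb with rfl | hb
        · simp
        · right; simpa using hb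
        · right; simpa using ha
        · right
          have h0 : 0 < a.2 + b.2 := add_pos ha.1 hb.1
          refine ⟨h0, ?_⟩
          have := (convex_convexHull ℝ _) ha.2 hb.2 (a := a.2 / (a.2 + b.2))
            (b := b.2 / (a.2 + b.2)) (div_nonneg ha.1.le h0.le) (div_nonneg hb.1.le h0.le)
            (by rw [← add_div, div_self h0.ne'])
          convert this using 1
          have h1 := ha.1.ne'
          have h2 := hb.1.ne'
          rw [smul_smul, smul_smul, div_mul_eq_mul_div, div_mul_eq_mul_div, mul_inv_cancel₀ h1,
            mul_inv_cancel₀ h2, one_div, Prod.snd_add, Prod.fst_add, smul_add]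
      | smul c a _ ha =>
        rcases ha with rfl | ha
        · simp
        · rcases c.2.eq_or_lt with h | h
          · left; show c.1 • a = 0; rw [← h, zero_smul]
          · right
            refine ⟨mul_pos h ha.1, ?_⟩
            have : (c • a).2⁻¹ • (c • a).1 = a.2⁻¹ • a.1 := by
              show (c.1 * a.2)⁻¹ • (c.1 • a.1) = _
              rw [smul_smul, mul_inv, mul_comm c.1⁻¹, mul_assoc, inv_mul_cancel₀ h.ne', mul_one]
            rw [this]; exact ha.2
    rcases main _ hx with h | h
    · simp [Prod.ext_iff] at h
    · simpa using h.2
  · intro hx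
    have hc : Convex ℝ {x : E | (x, (1 : ℝ)) ∈ hull ℝ (s : Set (E × ℝ))} := by
      intro x hx y hy a b ha hb hab
      have := add_mem (PointedCone.smul_mem (hull ℝ (s : Set (E × ℝ))) ha hx)
        (PointedCone.smul_mem (hull ℝ (s : Set (E × ℝ))) hb hy)
      simpa [hab] using this
    refine (convexHull_min ?_ hc) hx
    rintro _ ⟨p, hp, rfl⟩
    have := PointedCone.smul_mem (hull ℝ (s : Set (E × ℝ))) (inv_pos.2 (hs p hp)).le
      (Submodule.subset_span hp)
    have e : p.2⁻¹ • p = (p.2⁻¹ • p.1, (1 : ℝ)) := by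
      ext
      · rfl
      · show p.2⁻¹ * p.2 = 1
        exact inv_mul_cancel₀ (hs p hp).ne'
    rwa [e] at this

theorem mem_convexHull_iff_hull_image [DecidableEq (E × ℝ)] (s : Finset E) (x : E) :
    x ∈ convexHull ℝ (s : Set E) ↔
      (x, (1 : ℝ)) ∈ hull ℝ ((s.image (fun p => (p, (1 : ℝ))) : Finset (E × ℝ)) : Set (E × ℝ)) := by
  rw [mem_convexHull_iff_hull _ (by simp)]
  have : (fun p : E × ℝ => p.2⁻¹ • p.1) '' (s.image (fun p => (p, (1 : ℝ))) : Finset (E × ℝ))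
      = (s : Set E) := by
    ext y; simp
  rw [this]

end Weyl

/-! ## Polyhedra -/

section Polyhedra

variable {E : Type*} [NormedAddCommGroup E] [InnerProductSpace ℝ E]

/-- The affine function `x ↦ ⟨a, x⟩ + b`. -/
def affFun (p : E × ℝ) (x : E) : ℝ := inner ℝ p.1 x + p.2

/-- The polyhedron in `V` where the affine functions in `L` are nonnegative. -/
def polyhedron (V : FinSub E) (L : Finset (E × ℝ)) : Set E :=
  {x | x ∈ V.1 ∧ ∀ p ∈ L, 0 ≤ affFun p x}

/-- The polyhedral cone in `V` where the linear functions in `L` are nonnegative. -/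
def polyCone (V : FinSub E) (L : Finset E) : Set E :=
  {x | x ∈ V.1 ∧ ∀ a ∈ L, 0 ≤ inner ℝ a x}

theorem polyCone_eq_polyhedron [DecidableEq (E × ℝ)] (V : FinSub E) (L : Finset E) :
    polyCone V L = polyhedron V (L.image fun a => (a, 0)) := by
  ext x
  simp [polyCone, polyhedron, affFun]

theorem exists_inner_eq (V : FinSub E) (l : E →ₗ[ℝ] ℝ) :
    ∃ a ∈ V.1, ∀ x ∈ V.1, l x = inner ℝ a x := by
  let f : V.1 →L[ℝ] ℝ := LinearMap.toContinuousLinearMap (l.comp V.1.subtype)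
  refine ⟨((InnerProductSpace.toDual ℝ V.1).symm f : V.1), Submodule.coe_mem _, fun x hx => ?_⟩
  have := InnerProductSpace.toDual_symm_apply (𝕜 := ℝ) (x := (⟨x, hx⟩ : V.1)) (y := f)
  rw [Submodule.coe_inner] at this
  rw [this]
  rfl

theorem IsConvexCone.exists_polyCone {P : Set E} (h : IsConvexCone P) {V : FinSub E}
    (hV : P ⊆ V.1) : ∃ L : Finset E, (∀ a ∈ L, a ∈ V.1) ∧ P = polyCone V L := by
  classical
  obtain ⟨s, rfl⟩ := h
  obtain ⟨L, hL⟩ := exists_functionals_of_hull V.1 s (Submodule.subset_span.trans hV)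
  choose a ha hl using exists_inner_eq V
  refine ⟨L.image a, by simpa using fun l _ => ha l, ?_⟩
  ext x
  rw [SetLike.mem_coe, hL]
  simp only [polyCone, Finset.forall_mem_image, Set.mem_ofPred_eq]
  refine and_congr_right fun hx => forall₂_congr fun l _ => ?_
  rw [hl l x hx]

theorem isConvexCone_polyCone (V : FinSub E) (L : Finset E) : IsConvexCone (polyCone V L) := by
  classical
  obtain ⟨s, hs⟩ := exists_hull_eq_submodule V.1
  obtain ⟨s', hs', -⟩ := exists_hull_inter_halfspaces s (L.image fun a => (innerₛₗ ℝ a))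
  refine ⟨s', ?_⟩
  ext x
  rw [SetLike.mem_coe, hs', hs]
  simp [polyCone]

theorem IsConvexPolytope.exists_polyhedron {P : Set E} (h : IsConvexPolytope P) {V : FinSub E}
    (hV : P ⊆ V.1) : ∃ L : Finset (E × ℝ), P = polyhedron V L := by
  classical
  obtain ⟨s, -, rfl⟩ := h
  let W : Submodule ℝ (E × ℝ) := V.1.prod ⊤
  have : FiniteDimensional ℝ W := (Submodule.fg_iff_finiteDimensional W).1
    (((Submodule.fg_iff_finiteDimensional V.1).2 V.2).prod
      ((Submodule.fg_iff_finiteDimensional (⊤ : Submodule ℝ ℝ)).2 inferInstance))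
  obtain ⟨L, hL⟩ := exists_functionals_of_hull W (s.image (fun p => (p, (1 : ℝ)))) (by
    intro y hy
    obtain ⟨p, hp, rfl⟩ := Finset.mem_image.1 hy
    exact ⟨hV (subset_convexHull ℝ _ hp), trivial⟩)
  choose a ha hl using fun l : E × ℝ →ₗ[ℝ] ℝ => exists_inner_eq V (l.comp (LinearMap.inl ℝ E ℝ))
  refine ⟨L.image fun l => (a l, l (0, 1)), ?_⟩
  ext x
  rw [mem_convexHull_iff_hull_image, hL]
  simp only [polyhedron, Finset.forall_mem_image, Set.mem_ofPred_eq]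
  have hW : (x, (1 : ℝ)) ∈ W ↔ x ∈ V.1 := by simp [W]
  rw [hW]
  refine and_congr_right fun hx => forall₂_congr fun l _ => ?_
  rw [affFun, ← hl l x hx]
  have : l (x, 1) = l (x, 0) + l (0, 1) := by rw [← map_add]; simp
  rw [this]
  rfl

/-- Homogenization: the cone over `P` placed at height one is cut by the linear half-spaces lying
over the affine ones. The generators of the result still have positive height, so its slice at
height one is the convex hull of the rescaled generators, empty if there are none. -/
theorem IsConvexPolytope.inter_polyhedron {P : Set E} (h : IsConvexPolytope P) (V : FinSub E)
    (hV : P ⊆ V.1) (L : Finset (E × ℝ)) :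
    P ∩ polyhedron V L = ∅ ∨ IsConvexPolytope (P ∩ polyhedron V L) := by
  classical
  obtain ⟨s, -, rfl⟩ := h
  let g : E × ℝ → (E × ℝ →ₗ[ℝ] ℝ) := fun p => (innerₛₗ ℝ p.1).coprod (LinearMap.lsmul ℝ ℝ p.2)
  have hg : ∀ p x, g p (x, 1) = affFun p x := by intro p x; simp [g, affFun]
  obtain ⟨s', hs', hpos⟩ := exists_hull_inter_halfspaces
    (s.image (fun p => (p, (1 : ℝ)))) (L.image g)
  have hpos := hpos (LinearMap.snd ℝ E ℝ) (by simp)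
  have key : convexHull ℝ (s : Set E) ∩ polyhedron V L =
      convexHull ℝ ((fun p : E × ℝ => p.2⁻¹ • p.1) '' (s' : Set (E × ℝ))) := by
    ext x
    rw [← mem_convexHull_iff_hull s' hpos, hs', Set.mem_inter_iff, ← mem_convexHull_iff_hull_image]
    simp only [Finset.forall_mem_image, hg]
    constructor
    · rintro ⟨h1, h2⟩; exact ⟨h1, h2.2⟩
    · rintro ⟨h1, h2⟩; exact ⟨h1, hV h1, h2⟩
  rw [key]
  rcases s'.eq_empty_or_nonempty with h0 | h0
  · left; simp [h0]
  · right
    exact ⟨s'.image (fun p : E × ℝ => p.2⁻¹ • p.1), h0.image _, by rw [Finset.coe_image]⟩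

end Polyhedra

/-! ## The lattices of cones and of polytopes -/

section Lattices

variable {E : Type*}

/-- `P` is a finite union of pieces. -/
def IsUnionOf (piece : Set E → Prop) (P : Set E) : Prop :=
  ∃ C : Finset (Set E), (∀ c ∈ C, piece c) ∧ P = ⋃ c ∈ C, c

theorem IsUnionOf.of_piece {piece : Set E → Prop} {P : Set E} (h : piece P) :
    IsUnionOf piece P := ⟨{P}, by simpa using h, by simp⟩

theorem IsUnionOf.empty {piece : Set E → Prop} : IsUnionOf piece (∅ : Set E) :=
  ⟨∅, by simp, by simp⟩

theorem IsUnionOf.union {piece : Set E → Prop} {P Q : Set E} (hP : IsUnionOf piece P)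
    (hQ : IsUnionOf piece Q) : IsUnionOf piece (P ∪ Q) := by
  classical
  obtain ⟨C, hC, rfl⟩ := hP
  obtain ⟨D, hD, rfl⟩ := hQ
  refine ⟨C ∪ D, fun c hc => ?_, by rw [Finset.set_biUnion_union]⟩
  rcases Finset.mem_union.1 hc with h | h
  · exact hC c h
  · exact hD c h

theorem IsUnionOf.biUnion {piece : Set E → Prop} {ι : Type*} (s : Finset ι) (f : ι → Set E)
    (h : ∀ i ∈ s, IsUnionOf piece (f i)) : IsUnionOf piece (⋃ i ∈ s, f i) := by
  classical
  induction s using Finset.induction_on with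
  | empty => simpa using IsUnionOf.empty
  | insert a s _ ih =>
    rw [Finset.set_biUnion_insert]
    exact (h a (by simp)).union (ih fun i hi => h i (by simp [hi]))

theorem isSetLattice_unionOf (piece : Set E → Prop) (S : Set E)
    (hinter : ∀ c d, c ⊆ S → d ⊆ S → piece c → piece d → c ∩ d = ∅ ∨ piece (c ∩ d)) :
    IsSetLattice (fun P => IsUnionOf piece P ∧ P ⊆ S) where
  empty := ⟨IsUnionOf.empty, Set.empty_subset _⟩
  union P Q hP hQ := ⟨hP.1.union hQ.1, Set.union_subset hP.2 hQ.2⟩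
  inter P Q hP hQ := by
    refine ⟨?_, fun x hx => hP.2 hx.1⟩
    obtain ⟨⟨C, hC, rfl⟩, hPS⟩ := hP
    obtain ⟨⟨D, hD, rfl⟩, hQS⟩ := hQ
    have : (⋃ c ∈ C, c) ∩ (⋃ d ∈ D, d) = ⋃ c ∈ C, ⋃ d ∈ D, c ∩ d := by
      ext x; simp only [Set.mem_inter_iff, Set.mem_iUnion]
      constructor
      · rintro ⟨⟨c, hc, h⟩, ⟨d, hd, h'⟩⟩; exact ⟨c, hc, d, hd, h, h'⟩
      · rintro ⟨c, hc, d, hd, h, h'⟩; exact ⟨⟨c, hc, h⟩, ⟨d, hd, h'⟩⟩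
    rw [this]
    refine IsUnionOf.biUnion _ _ fun c hc => IsUnionOf.biUnion _ _ fun d hd => ?_
    rcases hinter c d ((Set.subset_biUnion_of_mem (u := id) hc).trans hPS)
      ((Set.subset_biUnion_of_mem (u := id) hd).trans hQS) (hC c hc) (hD d hd) with h | h
    · rw [h]; exact IsUnionOf.empty
    · exact IsUnionOf.of_piece h

theorem closure_pieces_unionOf (piece : Set E → Prop) (S : Set E)
    (hinter : ∀ c d, c ⊆ S → d ⊆ S → piece c → piece d → c ∩ d = ∅ ∨ piece (c ∩ d)) :
    AddSubgroup.closure {x | ∃ c, piece c ∧ c ⊆ S ∧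
      x = cls (fun P => IsUnionOf piece P ∧ P ⊆ S) c} = ⊤ := by
  rw [← closure_pieces (isSetLattice_unionOf piece S hinter) piece
    (fun c d hc hd h h' => hinter c d hc.2 hd.2 h h')]
  · congr 1
    ext x
    constructor
    · rintro ⟨c, hc, hS, rfl⟩; exact ⟨c, hc, ⟨IsUnionOf.of_piece hc, hS⟩, rfl⟩
    · rintro ⟨c, hc, hS, rfl⟩; exact ⟨c, hc, hS.2, rfl⟩
  · rintro P ⟨⟨C, hC, rfl⟩, hS⟩
    exact ⟨C, fun c hc => ⟨hC c hc, IsUnionOf.of_piece (hC c hc),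
      (Set.subset_biUnion_of_mem (u := id) hc).trans hS⟩, rfl⟩

end Lattices

/-! ### Intersections and generators for the cones and polytopes in a fixed subspace. -/

variable {E : Type*} [NormedAddCommGroup E] [InnerProductSpace ℝ E]

theorem polyCone_inter [DecidableEq E] (V : FinSub E) (L M : Finset E) :
    polyCone V L ∩ polyCone V M = polyCone V (L ∪ M) := by
  ext x
  simp only [polyCone, Set.mem_inter_iff, Set.mem_ofPred_eq, Finset.mem_union]
  constructor
  · rintro ⟨⟨h, h1⟩, ⟨-, h2⟩⟩
    exact ⟨h, fun p hp => hp.elim (h1 p) (h2 p)⟩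
  · rintro ⟨h, h1⟩
    exact ⟨⟨h, fun p hp => h1 p (Or.inl hp)⟩, ⟨h, fun p hp => h1 p (Or.inr hp)⟩⟩

theorem IsConvexCone.inter {V : FinSub E} {c d : Set E} (hc : c ⊆ V.1) (hd : d ⊆ V.1)
    (h : IsConvexCone c) (h' : IsConvexCone d) : IsConvexCone (c ∩ d) := by
  classical
  obtain ⟨L, -, rfl⟩ := h.exists_polyCone hc
  obtain ⟨M, -, rfl⟩ := h'.exists_polyCone hd
  rw [polyCone_inter]
  exact isConvexCone_polyCone V _

theorem IsConvexPolytope.inter {V : FinSub E} {c d : Set E} (hc : c ⊆ V.1) (hd : d ⊆ V.1)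
    (h : IsConvexPolytope c) (h' : IsConvexPolytope d) : c ∩ d = ∅ ∨ IsConvexPolytope (c ∩ d) := by
  obtain ⟨M, rfl⟩ := h'.exists_polyhedron hd
  exact h.inter_polyhedron V hc M

theorem isSetLattice_cone (V : FinSub E) : IsSetLattice (IsConeIn V) :=
  isSetLattice_unionOf IsConvexCone (V.1 : Set E) fun _ _ hc hd h h' => Or.inr (h.inter hc hd h')

theorem isSetLattice_polytope (V : FinSub E) : IsSetLattice (IsPolytopeIn V) :=
  isSetLattice_unionOf IsConvexPolytope (V.1 : Set E) fun _ _ hc hd h h' => h.inter hc hd h'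

theorem closure_convexCone (V : FinSub E) :
    AddSubgroup.closure {x | ∃ c, IsConvexCone c ∧ c ⊆ V.1 ∧ x = coneCls V c} = ⊤ :=
  closure_pieces_unionOf IsConvexCone (V.1 : Set E) fun _ _ hc hd h h' => Or.inr (h.inter hc hd h')

theorem closure_convexPolytope (V : FinSub E) :
    AddSubgroup.closure {x | ∃ c, IsConvexPolytope c ∧ c ⊆ V.1 ∧ x = polyCls V c} = ⊤ :=
  closure_pieces_unionOf IsConvexPolytope (V.1 : Set E) fun _ _ hc hd h h' => h.inter hc hd h'

theorem IsConvexCone.isConeIn {V : FinSub E} {P : Set E} (h : IsConvexCone P) (hV : P ⊆ V.1) :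
    IsConeIn V P := ⟨IsUnionOf.of_piece h, hV⟩

theorem IsConvexPolytope.isPolytopeIn {V : FinSub E} {P : Set E} (h : IsConvexPolytope P)
    (hV : P ⊆ V.1) : IsPolytopeIn V P := ⟨IsUnionOf.of_piece h, hV⟩

theorem IsConvexCone.exists_polyhedron {P : Set E} (h : IsConvexCone P) {V : FinSub E}
    (hV : P ⊆ V.1) : ∃ L : Finset (E × ℝ), P = polyhedron V L := by
  classical
  obtain ⟨L, -, rfl⟩ := h.exists_polyCone hV
  exact ⟨_, polyCone_eq_polyhedron V L⟩

theorem IsConvexCone.zero_mem {P : Set E} (h : IsConvexCone P) : (0 : E) ∈ P := by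
  obtain ⟨s, rfl⟩ := h; exact Submodule.zero_mem _

theorem IsConvexCone.nonempty {P : Set E} (h : IsConvexCone P) : P.Nonempty := ⟨0, h.zero_mem⟩

theorem IsConvexPolytope.nonempty {P : Set E} (h : IsConvexPolytope P) : P.Nonempty := by
  obtain ⟨s, hs, rfl⟩ := h
  exact convexHull_nonempty_iff.2 hs

/-! ## Relative interiors and frontiers of polyhedra -/

theorem affFun_add_smul (p : E × ℝ) (x w : E) (t : ℝ) :
    affFun p (x + t • w) = affFun p x + t * inner ℝ p.1 w := by
  simp only [affFun, inner_add_right, inner_smul_right]; ring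

theorem affFun_sub (p : E × ℝ) (x y : E) : affFun p x - affFun p y = inner ℝ p.1 (x - y) := by
  simp only [affFun, inner_sub_right]; ring

theorem continuous_affFun (p : E × ℝ) : Continuous (affFun p) := by
  unfold affFun; fun_prop

theorem isClosed_polyhedron (V : FinSub E) (L : Finset (E × ℝ)) : IsClosed (polyhedron V L) := by
  have : polyhedron V L = (V.1 : Set E) ∩ ⋂ p ∈ L, {x | 0 ≤ affFun p x} := by
    ext x; simp [polyhedron]
  rw [this]
  exact V.1.closed_of_finiteDimensional.inter
    (isClosed_biInter fun p _ => isClosed_le continuous_const (continuous_affFun p))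

theorem convex_polyhedron (V : FinSub E) (L : Finset (E × ℝ)) : Convex ℝ (polyhedron V L) := by
  intro x hx y hy a b ha hb hab
  refine ⟨V.1.add_mem (V.1.smul_mem _ hx.1) (V.1.smul_mem _ hy.1), fun p hp => ?_⟩
  have : affFun p (a • x + b • y) = a * affFun p x + b * affFun p y := by
    simp only [affFun, inner_add_right, inner_smul_right]
    linear_combination (-p.2) * hab
  rw [this]
  exact add_nonneg (mul_nonneg ha (hx.2 p hp)) (mul_nonneg hb (hy.2 p hp))

theorem exists_forall_affFun_pos {P : Set E} (hP : Convex ℝ P) (hne : P.Nonempty)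
    (L : Finset (E × ℝ)) (h0 : ∀ p ∈ L, ∀ y ∈ P, 0 ≤ affFun p y)
    (h1 : ∀ p ∈ L, ∃ y ∈ P, 0 < affFun p y) : ∃ x ∈ P, ∀ p ∈ L, 0 < affFun p x := by
  classical
  induction L using Finset.induction_on with
  | empty => exact ⟨_, hne.some_mem, by simp⟩
  | insert q L _ ih =>
    obtain ⟨x, hx, hx'⟩ := ih (fun p hp => h0 p (by simp [hp])) (fun p hp => h1 p (by simp [hp]))
    obtain ⟨y, hy, hy'⟩ := h1 q (by simp)
    refine ⟨(1 / 2 : ℝ) • x + (1 / 2 : ℝ) • y, hP hx hy (by norm_num) (by norm_num) (by norm_num),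
      fun p hp => ?_⟩
    have : affFun p ((1 / 2 : ℝ) • x + (1 / 2 : ℝ) • y) = (affFun p x + affFun p y) / 2 := by
      simp only [affFun, inner_add_right, inner_smul_right]; ring
    rw [this]
    have hpx := h0 p hp x hx
    have hpy := h0 p hp y hy
    rcases Finset.mem_insert.1 hp with rfl | hp
    · linarith
    · linarith [hx' p hp]

/-- A segment from a point of `P` to a relative interior point can be prolonged inside `P`, because
the line through both stays in the affine span. For polyhedra this property characterizes the
relative interior (`mem_intrinsicInterior_iff_forall`), and most later arguments use it in this
form. -/
theorem exists_add_smul_mem_of_mem_intrinsicInterior {P : Set E} {x : E}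
    (hx : x ∈ intrinsicInterior ℝ P) {y : E} (hy : y ∈ P) : ∃ ε : ℝ, 0 < ε ∧ x + ε • (x - y) ∈ P := by
  obtain ⟨z, hz, rfl⟩ := mem_intrinsicInterior.1 hx
  let f : ℝ → affineSpan ℝ P := fun t =>
    ⟨AffineMap.lineMap (z : E) y (-t), AffineMap.lineMap_mem _ z.2 (subset_affineSpan ℝ P hy)⟩
  have hf : Continuous f := by
    refine Continuous.subtype_mk ?_ _
    exact AffineMap.lineMap_continuous.comp continuous_neg
  have h0 : f 0 = z := by ext; simp [f]
  have : ∀ᶠ t in nhds (0 : ℝ), f t ∈ interior ((↑) ⁻¹' P : Set (affineSpan ℝ P)) :=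
    hf.continuousAt.eventually_mem (h0 ▸ isOpen_interior.mem_nhds hz)
  obtain ⟨ε, hε, h⟩ := Metric.eventually_nhds_iff.1 this
  refine ⟨ε / 2, by positivity, ?_⟩
  have h2 := interior_subset (h (y := ε / 2) (by
    rw [Real.dist_eq, sub_zero, abs_of_pos (by positivity)]; linarith))
  have e : (f (ε / 2) : E) = z + (ε / 2) • ((z : E) - y) := by
    simp only [f, AffineMap.lineMap_apply, vsub_eq_sub, vadd_eq_add]; module
  have h3 : (f (ε / 2) : E) ∈ P := h2
  rwa [e] at h3

theorem affineSpan_polyhedron_le (V : FinSub E) (L : Finset (E × ℝ)) {z : E}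
    (hz : z ∈ affineSpan ℝ (polyhedron V L)) : z ∈ V.1 := by
  have : affineSpan ℝ (polyhedron V L) ≤ V.1.toAffineSubspace :=
    affineSpan_le.2 fun x hx => hx.1
  exact this hz

theorem affFun_eq_zero_on_affineSpan {P : Set E} {p : E × ℝ} (h : ∀ y ∈ P, affFun p y = 0) {z : E}
    (hz : z ∈ affineSpan ℝ P) : affFun p z = 0 := by
  refine affineSpan_induction hz h ?_
  intro c u v w hu hv hw
  simp only [vsub_eq_sub, vadd_eq_add, add_comm _ w, affFun_add_smul, ← affFun_sub, hu, hv, hw]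
  simp

/-- Inequalities that are equalities on the whole polyhedron persist on its affine span. The
remaining ones, made strict, are open conditions; conversely a remaining one cannot be an equality
at `x`, as a prolongation beyond `x` would violate it. -/
theorem mem_intrinsicInterior_polyhedron {V : FinSub E} {L : Finset (E × ℝ)} {x : E} :
    x ∈ intrinsicInterior ℝ (polyhedron V L) ↔ x ∈ polyhedron V L ∧
      ∀ p ∈ L, (∃ y ∈ polyhedron V L, 0 < affFun p y) → 0 < affFun p x := by
  classical
  constructor
  · intro hx
    have hxP := intrinsicInterior_subset hx
    refine ⟨hxP, fun p hp ⟨y, hy, hpy⟩ => ?_⟩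
    obtain ⟨ε, hε, h⟩ := exists_add_smul_mem_of_mem_intrinsicInterior hx hy
    have := h.2 p hp
    rw [affFun_add_smul, ← affFun_sub] at this
    by_contra hneg
    nlinarith [mul_pos hε hpy, hxP.2 p hp]
  · rintro ⟨hx, h⟩
    refine mem_intrinsicInterior.2 ⟨⟨x, subset_affineSpan ℝ _ hx⟩, ?_, rfl⟩
    rw [mem_interior]
    set M := L.filter (fun p => ∃ y ∈ polyhedron V L, 0 < affFun p y)
    refine ⟨(↑) ⁻¹' (⋂ p ∈ M, {z : E | 0 < affFun p z}), ?_, ?_, ?_⟩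
    · rintro ⟨z, hz⟩ hzM
      refine ⟨affineSpan_polyhedron_le V L hz, fun p hp => ?_⟩
      by_cases hpM : ∃ y ∈ polyhedron V L, 0 < affFun p y
      · exact (Set.mem_iInter₂.1 hzM p (Finset.mem_filter.2 ⟨hp, hpM⟩) : 0 < affFun p z).le
      · push Not at hpM
        exact (affFun_eq_zero_on_affineSpan
          (fun y hy => le_antisymm (hpM y hy) (hy.2 p hp)) hz).ge
    · exact (isOpen_biInter_finset fun p _ =>
        isOpen_lt continuous_const (continuous_affFun p)).preimage continuous_subtype_val
    · exact Set.mem_iInter₂.2 fun p hp => h p (Finset.mem_filter.1 hp).1 (Finset.mem_filter.1 hp).2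

theorem mem_intrinsicInterior_iff_forall {V : FinSub E} {L : Finset (E × ℝ)} {P : Set E}
    (hP : P = polyhedron V L) {x : E} :
    x ∈ intrinsicInterior ℝ P ↔ x ∈ P ∧ ∀ y ∈ P, ∃ ε : ℝ, 0 < ε ∧ x + ε • (x - y) ∈ P := by
  subst hP
  constructor
  · exact fun hx => ⟨intrinsicInterior_subset hx,
      fun y hy => exists_add_smul_mem_of_mem_intrinsicInterior hx hy⟩
  · rintro ⟨hx, h⟩
    refine mem_intrinsicInterior_polyhedron.2 ⟨hx, fun p hp ⟨y, hy, hpy⟩ => ?_⟩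
    obtain ⟨ε, hε, h'⟩ := h y hy
    have := h'.2 p hp
    rw [affFun_add_smul, ← affFun_sub] at this
    by_contra hneg
    nlinarith [mul_pos hε hpy, hx.2 p hp]

theorem intrinsicInterior_polyhedron_nonempty {V : FinSub E} {L : Finset (E × ℝ)}
    (h : (polyhedron V L).Nonempty) : (intrinsicInterior ℝ (polyhedron V L)).Nonempty := by
  classical
  obtain ⟨x, hx, hx'⟩ := exists_forall_affFun_pos (convex_polyhedron V L) h
    (L.filter fun p => ∃ y ∈ polyhedron V L, 0 < affFun p y)
    (fun p hp y hy => hy.2 p (Finset.mem_filter.1 hp).1) (fun p hp => (Finset.mem_filter.1 hp).2)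
  exact ⟨x, mem_intrinsicInterior_polyhedron.2
    ⟨hx, fun p hp hy => hx' p (Finset.mem_filter.2 ⟨hp, hy⟩)⟩⟩

theorem intrinsicFrontier_eq_sdiff {P : Set E} (hP : IsClosed P) :
    intrinsicFrontier ℝ P = P \ intrinsicInterior ℝ P := by
  rw [← intrinsicClosure_sdiff_intrinsicInterior,
    IsClosed.intrinsicClosure (hP.preimage continuous_subtype_val)]

open Classical in
theorem intrinsicFrontier_polyhedron (V : FinSub E) (L : Finset (E × ℝ)) :
    intrinsicFrontier ℝ (polyhedron V L) =
      ⋃ p ∈ L.filter (fun p => ∃ y ∈ polyhedron V L, 0 < affFun p y),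
        polyhedron V L ∩ polyhedron V {(-p.1, -p.2)} := by
  rw [intrinsicFrontier_eq_sdiff (isClosed_polyhedron V L)]
  ext x
  rw [Set.mem_sdiff, mem_intrinsicInterior_polyhedron, Set.mem_iUnion₂]
  have hneg : ∀ p : E × ℝ, affFun (-p.1, -p.2) x = -affFun p x := fun p => by
    simp only [affFun, inner_neg_left]; ring
  constructor
  · rintro ⟨hx, h⟩
    push Not at h
    obtain ⟨p, hp, hy, hpx⟩ := h hx
    exact ⟨p, Finset.mem_filter.2 ⟨hp, hy⟩, hx, hx.1, by simpa [hneg] using hpx⟩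
  · rintro ⟨p, hp, hx, hx'⟩
    refine ⟨hx, fun h => ?_⟩
    have h1 := h.2 p (Finset.mem_filter.1 hp).1 (Finset.mem_filter.1 hp).2
    have h2 := hx'.2 _ (Finset.mem_singleton_self _)
    rw [hneg] at h2
    linarith

/-! ### Relative boundaries and interiors as elements of the valuation groups. -/

theorem IsConvexCone.isConeIn_frontier {V : FinSub E} {P : Set E} (h : IsConvexCone P)
    (hV : P ⊆ V.1) : IsConeIn V (intrinsicFrontier ℝ P) := by
  classical
  obtain ⟨L, -, rfl⟩ := h.exists_polyCone hV
  have hcl : IsClosed (polyCone V L) := by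
    rw [polyCone_eq_polyhedron]; exact isClosed_polyhedron _ _
  refine ⟨?_, (intrinsicFrontier_subset hcl).trans hV⟩
  rw [polyCone_eq_polyhedron, intrinsicFrontier_polyhedron]
  refine IsUnionOf.biUnion _ _ fun p hp => IsUnionOf.of_piece ?_
  obtain ⟨a, -, rfl⟩ := Finset.mem_image.1 (Finset.mem_filter.1 hp).1
  have : polyhedron V {(-a, -(0 : ℝ))} = polyCone V {-a} := by
    rw [polyCone_eq_polyhedron]; simp
  rw [← polyCone_eq_polyhedron, this]
  exact h.inter hV (fun x hx => hx.1) (isConvexCone_polyCone _ _)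

theorem IsConvexPolytope.isPolytopeIn_frontier {V : FinSub E} {P : Set E} (h : IsConvexPolytope P)
    (hV : P ⊆ V.1) : IsPolytopeIn V (intrinsicFrontier ℝ P) := by
  classical
  obtain ⟨L, rfl⟩ := h.exists_polyhedron hV
  refine ⟨?_, (intrinsicFrontier_subset (isClosed_polyhedron V L)).trans hV⟩
  rw [intrinsicFrontier_polyhedron]
  refine IsUnionOf.biUnion _ _ fun p hp => ?_
  rcases h.inter_polyhedron V hV {(-p.1, -p.2)} with h1 | h1
  · rw [h1]; exact IsUnionOf.empty
  · exact IsUnionOf.of_piece h1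

theorem toFun_coneCls {V : FinSub E} {P : Set E} (h : IsConeIn V P) :
    ValGroup.toFun (IsConeIn V) (coneCls V P) = ind P := ValGroup.toFun_cls h

theorem toFun_polyCls {V : FinSub E} {P : Set E} (h : IsPolytopeIn V P) :
    ValGroup.toFun (IsPolytopeIn V) (polyCls V P) = ind P := ValGroup.toFun_cls h

theorem ind_sub_ind_frontier {V : FinSub E} {L : Finset (E × ℝ)} {P : Set E}
    (hP : P = polyhedron V L) : ind P - ind (intrinsicFrontier ℝ P) = ind (intrinsicInterior ℝ P) := by
  subst hP
  ext x
  rw [intrinsicFrontier_eq_sdiff (isClosed_polyhedron V L), Pi.sub_apply]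
  by_cases h1 : x ∈ intrinsicInterior ℝ (polyhedron V L)
  · have h2 := intrinsicInterior_subset h1
    simp [ind, h1, h2]
  · by_cases h2 : x ∈ polyhedron V L <;> simp [ind, h1, h2]

theorem toFun_coneIntCls {V : FinSub E} {P : Set E} (h : IsConvexCone P) (hV : P ⊆ V.1) :
    ValGroup.toFun (IsConeIn V) (coneIntCls V P) = ind (intrinsicInterior ℝ P) := by
  obtain ⟨L, hL⟩ := h.exists_polyhedron hV
  rw [coneIntCls, map_sub, toFun_coneCls (h.isConeIn hV), toFun_coneCls (h.isConeIn_frontier hV),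
    ind_sub_ind_frontier hL]

theorem toFun_polyIntCls {V : FinSub E} {P : Set E} (h : IsConvexPolytope P) (hV : P ⊆ V.1) :
    ValGroup.toFun (IsPolytopeIn V) (polyIntCls V P) = ind (intrinsicInterior ℝ P) := by
  obtain ⟨L, hL⟩ := h.exists_polyhedron hV
  rw [polyIntCls, map_sub, toFun_polyCls (h.isPolytopeIn hV),
    toFun_polyCls (h.isPolytopeIn_frontier hV), ind_sub_ind_frontier hL]

/-! ## Extension of functions of convex cones that are additive under hyperplane cuts -/

/-- The half-space where `⟨a, x⟩ ≥ 0`. -/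
def halfSpace (a : E) : PointedCone ℝ E where
  carrier := {x | 0 ≤ inner ℝ a x}
  zero_mem' := by simp
  add_mem' {x y} hx hy := by
    show 0 ≤ inner ℝ a (x + y)
    rw [inner_add_right]; exact add_nonneg hx hy
  smul_mem' c x hx := by
    show 0 ≤ inner ℝ a (c.1 • x)
    rw [inner_smul_right]; exact mul_nonneg c.2 hx

theorem mem_halfSpace {a x : E} : x ∈ halfSpace a ↔ 0 ≤ inner ℝ a x := Iff.rfl

theorem mem_halfSpace_neg {a x : E} : x ∈ halfSpace (-a) ↔ inner ℝ a x ≤ 0 := by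
  rw [mem_halfSpace, inner_neg_left, Left.nonneg_neg_iff]

/-- The polyhedral cone `polyCone V L` as a pointed cone. -/
def polyConeP (V : FinSub E) (L : Finset E) : PointedCone ℝ E where
  carrier := polyCone V L
  zero_mem' := ⟨V.1.zero_mem, by simp⟩
  add_mem' {x y} hx hy := ⟨V.1.add_mem hx.1 hy.1, fun a ha => by
    rw [inner_add_right]; exact add_nonneg (hx.2 a ha) (hy.2 a ha)⟩
  smul_mem' c x hx := ⟨V.1.smul_mem c.1 hx.1, fun a ha => by
    show 0 ≤ inner ℝ a (c.1 • x)
    rw [inner_smul_right]; exact mul_nonneg c.2 (hx.2 a ha)⟩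

@[simp] theorem coe_polyConeP (V : FinSub E) (L : Finset E) :
    (polyConeP V L : Set E) = polyCone V L := rfl

theorem polyConeP_erase [DecidableEq E] (V : FinSub E) {L : Finset E} {a : E} (ha : a ∈ L) :
    polyConeP V L = polyConeP V (L.erase a) ⊓ halfSpace a := by
  ext x
  constructor
  · intro hx
    exact ⟨⟨hx.1, fun b hb => hx.2 b (Finset.mem_of_mem_erase hb)⟩, hx.2 a ha⟩
  · rintro ⟨h1, h2⟩
    refine ⟨h1.1, fun b hb => ?_⟩
    by_cases h : b = a
    · subst h; exact h2
    · exact h1.2 b (Finset.mem_erase.2 ⟨h, hb⟩)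

/-- `φ` is additive under cutting pointed cones in `V` by hyperplanes. -/
def CutAdditive (V : FinSub E) (φ : PointedCone ℝ E → ℤ) : Prop :=
  ∀ P : PointedCone ℝ E, (P : Set E) ⊆ V.1 → ∀ a, φ P =
    φ (P ⊓ halfSpace a) + φ (P ⊓ halfSpace (-a)) - φ (P ⊓ halfSpace a ⊓ halfSpace (-a))

/-- A cut-additive function that is concentrated on the relatively open cone `O` with closure
`C`. -/
structure ConcentratedOn (V : FinSub E) (φ : PointedCone ℝ E → ℤ) (C O : Set E) : Prop where
  cut : CutAdditive V φ
  congr : ∀ P Q : PointedCone ℝ E, (P : Set E) ⊆ V.1 → (Q : Set E) ⊆ V.1 →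
    (P : Set E) ∩ C = (Q : Set E) ∩ C → φ P = φ Q
  zero : ∀ P : PointedCone ℝ E, (P : Set E) ⊆ V.1 → (P : Set E) ∩ O = ∅ → φ P = 0
  add_mem : ∀ x ∈ O, ∀ y ∈ C, x + y ∈ O

theorem inf_halfSpace_subset {V : FinSub E} {P : PointedCone ℝ E} (hP : (P : Set E) ⊆ V.1)
    (a : E) : ((P ⊓ halfSpace a : PointedCone ℝ E) : Set E) ⊆ V.1 := fun _ hx => hP hx.1

theorem ConcentratedOn.zeroPart {V : FinSub E} {φ : PointedCone ℝ E → ℤ} {C O : Set E}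
    (h : ConcentratedOn V φ C O) (a : E) :
    ConcentratedOn V (fun P => φ (P ⊓ halfSpace a ⊓ halfSpace (-a)))
      (C ∩ {x | inner ℝ a x = 0}) (O ∩ {x | inner ℝ a x = 0}) where
  cut P hP b := by
    show φ _ = φ _ + φ _ - φ _
    have e1 : ∀ c, P ⊓ halfSpace c ⊓ halfSpace a ⊓ halfSpace (-a) =
      P ⊓ halfSpace a ⊓ halfSpace (-a) ⊓ halfSpace c := fun c => by ac_rfl
    rw [h.cut _ (inf_halfSpace_subset (inf_halfSpace_subset hP a) (-a)) b, ← e1 b, ← e1 (-b)]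
    have e2 : P ⊓ halfSpace b ⊓ halfSpace a ⊓ halfSpace (-a) ⊓ halfSpace (-b) =
      P ⊓ halfSpace b ⊓ halfSpace (-b) ⊓ halfSpace a ⊓ halfSpace (-a) := by ac_rfl
    rw [e2]
  congr P Q hP hQ hPQ := by
    refine h.congr _ _ (inf_halfSpace_subset (inf_halfSpace_subset hP a) (-a))
      (inf_halfSpace_subset (inf_halfSpace_subset hQ a) (-a)) ?_
    ext x
    have := Set.ext_iff.1 hPQ x
    simp only [Set.mem_inter_iff, Set.mem_ofPred_eq, SetLike.mem_coe, Submodule.mem_inf,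
      mem_halfSpace (a := a)] at this ⊢
    constructor
    · rintro ⟨⟨⟨h1, h2⟩, h3⟩, h4⟩
      exact ⟨⟨⟨(this.1 ⟨h1, h4, le_antisymm (mem_halfSpace_neg.1 h3) h2⟩).1, h2⟩, h3⟩, h4⟩
    · rintro ⟨⟨⟨h1, h2⟩, h3⟩, h4⟩
      exact ⟨⟨⟨(this.2 ⟨h1, h4, le_antisymm (mem_halfSpace_neg.1 h3) h2⟩).1, h2⟩, h3⟩, h4⟩
  zero P hP hO := by
    refine h.zero _ (inf_halfSpace_subset (inf_halfSpace_subset hP a) (-a)) ?_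
    refine Set.eq_empty_of_forall_notMem fun x hx => ?_
    have : x ∈ (P : Set E) ∩ (O ∩ {x | inner ℝ a x = 0}) :=
      ⟨hx.1.1.1, hx.2, le_antisymm (mem_halfSpace_neg.1 hx.1.2) hx.1.1.2⟩
    rw [hO] at this
    exact this
  add_mem x hx y hy := ⟨h.add_mem x hx.1 y hy.1, by
    have h1 := hx.2
    have h2 := hy.2
    simp only [Set.mem_ofPred_eq] at h1 h2 ⊢
    rw [inner_add_right, h1, h2, add_zero]⟩

/-- The contribution to `φ` of the open side of the hyperplane. Together with `zeroPart` and the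
positive part for `-a` it recovers `φ`. -/
theorem ConcentratedOn.posPart {V : FinSub E} {φ : PointedCone ℝ E → ℤ} {C O : Set E}
    (h : ConcentratedOn V φ C O) (a : E) :
    ConcentratedOn V
      (fun P => φ (P ⊓ halfSpace a) - φ (P ⊓ halfSpace a ⊓ halfSpace (-a)))
      (C ∩ {x | 0 ≤ inner ℝ a x}) (O ∩ {x | 0 < inner ℝ a x}) where
  cut P hP b := by
    have h1 := h.cut _ (inf_halfSpace_subset hP a) b
    have h2 := (h.zeroPart a).cut P hP b
    show φ _ - φ _ = φ _ - φ _ + (φ _ - φ _) - (φ _ - φ _)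
    rw [h1, h2]
    have e1 : P ⊓ halfSpace a ⊓ halfSpace b = P ⊓ halfSpace b ⊓ halfSpace a := by ac_rfl
    have e2 : P ⊓ halfSpace a ⊓ halfSpace (-b) = P ⊓ halfSpace (-b) ⊓ halfSpace a := by ac_rfl
    have e3 : P ⊓ halfSpace b ⊓ halfSpace a ⊓ halfSpace (-b) =
      P ⊓ halfSpace b ⊓ halfSpace (-b) ⊓ halfSpace a := by ac_rfl
    rw [e1, e2, e3]
    ring
  congr P Q hP hQ hPQ := by
    have key : ∀ x, (x ∈ P ∧ 0 ≤ inner ℝ a x) ∧ x ∈ C ↔ (x ∈ Q ∧ 0 ≤ inner ℝ a x) ∧ x ∈ C := by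
      intro x
      have := Set.ext_iff.1 hPQ x
      simp only [Set.mem_inter_iff, Set.mem_ofPred_eq, SetLike.mem_coe] at this
      tauto
    have e1 := h.congr _ _ (inf_halfSpace_subset hP a) (inf_halfSpace_subset hQ a)
      (Set.ext key)
    have e2 := h.congr _ _ (inf_halfSpace_subset (inf_halfSpace_subset hP a) (-a))
      (inf_halfSpace_subset (inf_halfSpace_subset hQ a) (-a)) (by
        ext x
        have := key x
        simp only [Set.mem_inter_iff, SetLike.mem_coe, Submodule.mem_inf, mem_halfSpace] at this ⊢
        tauto)
    show φ _ - φ _ = φ _ - φ _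
    rw [e1, e2]
  zero P hP hO := by
    show φ _ - φ _ = 0
    -- If `P` meets `O` in a point `x` of the hyperplane, then `P ∩ C` has no point `y` on the
    -- positive side, since `x + y` would lie in `O` and on that side; the two terms then agree.
    -- Otherwise `P` misses `O` on the whole closed side and both terms vanish.
    by_cases hx : ∃ x ∈ P, x ∈ O ∧ inner ℝ a x = 0
    · obtain ⟨x, hxP, hxO, hx0⟩ := hx
      rw [sub_eq_zero]
      refine h.congr _ _ (inf_halfSpace_subset hP a)
        (inf_halfSpace_subset (inf_halfSpace_subset hP a) (-a)) ?_
      ext y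
      simp only [Set.mem_inter_iff, SetLike.mem_coe, Submodule.mem_inf, mem_halfSpace_neg]
      refine ⟨fun ⟨h1, h2⟩ => ⟨⟨h1, ?_⟩, h2⟩, fun ⟨h1, h2⟩ => ⟨h1.1, h2⟩⟩
      by_contra hneg
      have : x + y ∈ (P : Set E) ∩ (O ∩ {x | 0 < inner ℝ a x}) :=
        ⟨P.add_mem hxP h1.1, h.add_mem x hxO y h2, by
          simp only [Set.mem_ofPred_eq]
          rw [inner_add_right, hx0, zero_add]; exact not_le.1 hneg⟩
      rw [hO] at this
      exact this
    · have : ((P ⊓ halfSpace a : PointedCone ℝ E) : Set E) ∩ O = ∅ := by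
        refine Set.eq_empty_of_forall_notMem fun x hx' => ?_
        rcases (mem_halfSpace.1 hx'.1.2).eq_or_lt with h0 | h0
        · exact hx ⟨x, hx'.1.1, hx'.2, h0.symm⟩
        · have : x ∈ (P : Set E) ∩ (O ∩ {x | 0 < inner ℝ a x}) := ⟨hx'.1.1, hx'.2, h0⟩
          rw [hO] at this
          exact this
      rw [h.zero _ (inf_halfSpace_subset hP a) this,
        h.zero _ (inf_halfSpace_subset (inf_halfSpace_subset hP a) (-a)), sub_zero]
      refine Set.eq_empty_of_forall_notMem fun x hx' => ?_
      have h2 : x ∈ ((P ⊓ halfSpace a : PointedCone ℝ E) : Set E) ∩ O := ⟨hx'.1.1, hx'.2⟩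
      rw [this] at h2
      exact h2
  add_mem x hx y hy := ⟨h.add_mem x hx.1 y hy.1, by
    have h1 := hx.2
    have h2 := hy.2
    simp only [Set.mem_ofPred_eq] at h1 h2 ⊢
    rw [inner_add_right]; exact add_pos_of_pos_of_nonneg h1 h2⟩

/-- The analogue of `exists_evalSum_of_valuation` for functions defined on convex cones only. Each
functional in `L` cuts the relatively open region `O` into a positive, a negative and a zero part,
and `φ` splits accordingly. When no functional is left, one point of the region suffices. -/
theorem ConcentratedOn.exists_evalSum {V : FinSub E} (L : Finset E) :
    ∀ {φ : PointedCone ℝ E → ℤ} {C O : Set E}, ConcentratedOn V φ C O →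
      ∃ l : List (E × ℤ), (∀ p ∈ l, p.1 ∈ O) ∧ ∀ L' ⊆ L,
        φ (polyConeP V L') = evalSum l (ind (polyCone V L')) := by
  classical
  induction L using Finset.induction_on with
  | empty =>
    intro φ C O h
    by_cases hO : ((V.1 : Set E) ∩ O).Nonempty
    · obtain ⟨x, hxV, hxO⟩ := hO
      refine ⟨[(x, φ (polyConeP V ∅))], by simpa using hxO, ?_⟩
      intro L' hL'
      rw [Finset.subset_empty.1 hL']
      have : x ∈ polyCone V ∅ := ⟨hxV, by simp⟩
      simp [evalSum, ind_of_mem this]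
    · refine ⟨[], by simp, fun L' hL' => ?_⟩
      rw [Finset.subset_empty.1 hL', h.zero (polyConeP V ∅) (fun x (hx : x ∈ polyCone V ∅) => hx.1)]
      · simp [evalSum]
      · refine Set.eq_empty_of_forall_notMem fun x hx => hO ⟨x, hx.1.1, hx.2⟩
  | insert a L ha ih =>
    intro φ C O h
    obtain ⟨lp, hlp, hlp'⟩ := ih (h.posPart a)
    obtain ⟨ln, hln, hln'⟩ := ih (h.posPart (-a))
    obtain ⟨lz, hlz, hlz'⟩ := ih (h.zeroPart a)
    refine ⟨lp ++ (ln ++ lz), ?_, ?_⟩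
    · intro p hp
      simp only [List.mem_append] at hp
      rcases hp with hp | hp | hp
      · exact (hlp p hp).1
      · exact (hln p hp).1
      · exact (hlz p hp).1
    · intro L' hL'
      have hsub : ∀ M : Finset E, (polyConeP V M : Set E) ⊆ V.1 :=
        fun M x (hx : x ∈ polyCone V M) => hx.1
      rw [evalSum_append, evalSum_append]
      by_cases haL : a ∈ L'
      · have hM : L'.erase a ⊆ L := by
          intro x hx
          rw [Finset.mem_erase] at hx
          exact (Finset.mem_insert.1 (hL' hx.2)).resolve_left hx.1
        set M := L'.erase a with hMdef
        have e : polyConeP V L' = polyConeP V M ⊓ halfSpace a := polyConeP_erase V haL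
        have hmem : ∀ x, x ∈ polyCone V L' ↔ x ∈ polyCone V M ∧ 0 ≤ inner ℝ a x := fun x => by
          have := SetLike.ext_iff.1 e x
          exact this
        have h1 : evalSum lp (ind (polyCone V L')) = evalSum lp (ind (polyCone V M)) :=
          evalSum_congr fun p hp => ind_congr (by
            rw [hmem]; exact and_iff_left (le_of_lt (hlp p hp).2))
        have h2 : evalSum lz (ind (polyCone V L')) = evalSum lz (ind (polyCone V M)) :=
          evalSum_congr fun p hp => ind_congr (by
            rw [hmem]; exact and_iff_left (hlz p hp).2.ge)
        have h3 : evalSum ln (ind (polyCone V L')) = 0 := by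
          rw [← map_zero (evalSum ln)]
          refine evalSum_congr fun p hp => ind_of_notMem fun hmem' => ?_
          have h4 : 0 < inner ℝ (-a) p.1 := (hln p hp).2
          rw [inner_neg_left] at h4
          linarith [((hmem _).1 hmem').2]
        rw [h1, h2, h3, ← hlp' M hM, ← hlz' M hM, e, h.cut _ (inf_halfSpace_subset (hsub M) a) a]
        have e1 : polyConeP V M ⊓ halfSpace a ⊓ halfSpace a = polyConeP V M ⊓ halfSpace a := by
          rw [inf_assoc, inf_idem]
        rw [e1]
        ring
      · have hM : L' ⊆ L := fun x hx =>
          (Finset.mem_insert.1 (hL' hx)).resolve_left fun hxa => haL (hxa ▸ hx)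
        rw [← hlp' L' hM, ← hlz' L' hM, ← hln' L' hM, h.cut _ (hsub L') a, neg_neg]
        have e1 : polyConeP V L' ⊓ halfSpace (-a) ⊓ halfSpace a =
          polyConeP V L' ⊓ halfSpace a ⊓ halfSpace (-a) := by ac_rfl
        rw [e1]
        ring

/-- On the finitely many polyhedral cones of a given relation, `φ` is a combination of point
evaluations of indicator functions, so it respects every relation between their classes in the cone
group. -/
theorem exists_hom_of_cutAdditive {V : FinSub E} {φ : PointedCone ℝ E → ℤ}
    (hφ : CutAdditive V φ) :
    ∃ Φ : ConeGroup V →+ ℤ, ∀ P : PointedCone ℝ E, IsConvexCone (P : Set E) →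
      (P : Set E) ⊆ V.1 → Φ (coneCls V P) = φ P := by
  classical
  have hC : ConcentratedOn V φ Set.univ Set.univ :=
    { cut := hφ
      congr := fun P Q _ _ h => by
        rw [Set.inter_univ, Set.inter_univ] at h
        exact congrArg φ (SetLike.coe_injective h)
      zero := fun P _ h => by
        rw [Set.inter_univ] at h
        have : (0 : E) ∈ (P : Set E) := P.zero_mem
        rw [h] at this
        exact this.elim
      add_mem := fun _ _ _ _ => trivial }
  let g : FreeAbelianGroup (Finset E) →+ ConeGroup V :=
    FreeAbelianGroup.lift fun L => coneCls V (polyCone V L)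
  let f : FreeAbelianGroup (Finset E) →+ ℤ := FreeAbelianGroup.lift fun L => φ (polyConeP V L)
  have hcone : ∀ L, IsConeIn V (polyCone V L) := fun L =>
    (isConvexCone_polyCone V L).isConeIn fun x hx => hx.1
  have hker : ∀ z, g z = 0 → f z = 0 := by
    intro z hz
    obtain ⟨K, hK⟩ := exists_list_determining (M := ℤ) z
    obtain ⟨l, -, hl⟩ := hC.exists_evalSum (K.toFinset.biUnion id)
    rw [hK f (((evalSum l).comp (ValGroup.toFun _)).comp g) ?_]
    · rw [AddMonoidHom.comp_apply, hz, map_zero]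
    · intro L hL
      simp only [f, g, AddMonoidHom.comp_apply, FreeAbelianGroup.lift_apply_of]
      rw [toFun_coneCls (hcone L), hl L]
      exact Finset.subset_biUnion_of_mem id (List.mem_toFinset.2 hL)
  have hsurj : Function.Surjective g := by
    rw [← AddMonoidHom.range_eq_top, eq_top_iff, ← closure_convexCone V, AddSubgroup.closure_le]
    rintro _ ⟨c, hc, hV, rfl⟩
    obtain ⟨L, -, rfl⟩ := hc.exists_polyCone hV
    exact ⟨FreeAbelianGroup.of L, by simp [g]⟩
  have hwd : ∀ a b, g a = g b → f a = f b := fun a b h => by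
    rw [← sub_eq_zero, ← map_sub]
    exact hker _ (by rw [map_sub, h, sub_self])
  have hinv : ∀ x, g (Function.surjInv hsurj x) = x := Function.surjInv_eq hsurj
  refine ⟨⟨⟨fun x => f (Function.surjInv hsurj x), ?_⟩, fun x y => ?_⟩, fun P hP hV => ?_⟩
  · rw [← map_zero f]; exact hwd _ _ (by rw [hinv, map_zero])
  · rw [← map_add f]; exact hwd _ _ (by rw [hinv, map_add, hinv, hinv])
  · obtain ⟨L, -, hL⟩ := hP.exists_polyCone hV
    have : P = polyConeP V L := SetLike.coe_injective hL
    show f (Function.surjInv hsurj (coneCls V P)) = φ P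
    rw [this, hwd _ (FreeAbelianGroup.of L)]
    · simp [f]
    · rw [hinv]; simp [g]

/-! ## The Euler homomorphism -/

/-- The set `P` is symmetric; for a pointed cone, this means that it is a vector subspace. -/
def IsSymm (P : Set E) : Prop := ∀ x ∈ P, -x ∈ P

theorem exists_submodule_of_isSymm {P : PointedCone ℝ E} (h : IsSymm (P : Set E)) :
    ∃ U : Submodule ℝ E, (U : Set E) = P := by
  have hsmul : ∀ (c : ℝ) (x : E), x ∈ P → c • x ∈ P := by
    intro c x hx
    rcases le_total 0 c with hc | hc
    · exact PointedCone.smul_mem P hc hx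
    · have := PointedCone.smul_mem P (neg_nonneg.2 hc) (h x hx)
      rwa [smul_neg, neg_smul, neg_neg] at this
  exact ⟨⟨P.toAddSubmonoid, fun c x hx => hsmul c x hx⟩, rfl⟩

theorem vectorSpan_submodule (U : Submodule ℝ E) : vectorSpan ℝ (U : Set E) = U := by
  rw [vectorSpan_eq_span_vsub_set_right ℝ U.zero_mem]
  simp

theorem dim_submodule (U : Submodule ℝ E) : dim (U : Set E) = Module.finrank ℝ U := by
  rw [dim, vectorSpan_submodule]

theorem finrank_inf_orthogonal (U : Submodule ℝ E) [FiniteDimensional ℝ U] {a v : E} (hv : v ∈ U)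
    (hav : inner ℝ a v ≠ 0) {W : Submodule ℝ E} (hW : ∀ x, x ∈ W ↔ x ∈ U ∧ inner ℝ a x = 0) :
    Module.finrank ℝ W + 1 = Module.finrank ℝ U := by
  let f : Module.Dual ℝ U := (innerₛₗ ℝ a).domRestrict U
  have hf : f ≠ 0 := fun h0 => hav (by
    have := LinearMap.congr_fun h0 ⟨v, hv⟩
    simpa [f] using this)
  have : W = (LinearMap.ker f).map U.subtype := by
    ext x
    rw [hW, Submodule.mem_map]
    constructor
    · rintro ⟨h1, h2⟩
      exact ⟨⟨x, h1⟩, by simpa [f] using h2, rfl⟩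
    · rintro ⟨y, hy, rfl⟩
      exact ⟨y.2, by simpa [f] using hy⟩
  rw [this, Submodule.finrank_map_subtype_eq]
  exact Module.Dual.finrank_ker_add_one_of_ne_zero hf

open Classical in
/-- The value of the Euler homomorphism on a convex cone. -/
def coneEuler (P : Set E) : ℤ := if IsSymm P then (-1) ^ dim P else 0

/-- If `a` does not change sign on `P`, one half is `P` and the other is the wall. If it does,
neither half is symmetric, while `P` is a subspace if and only if the wall is, and then the wall has
one dimension less. -/
theorem cutAdditive_coneEuler (V : FinSub E) :
    CutAdditive V (fun P => coneEuler (P : Set E)) := by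
  intro P hP a
  set Pp := P ⊓ halfSpace a with hPp
  set Pn := P ⊓ halfSpace (-a) with hPn
  set P0 := Pp ⊓ halfSpace (-a) with hP0
  have mp : ∀ x, x ∈ Pp ↔ x ∈ P ∧ 0 ≤ inner ℝ a x := fun x => Iff.rfl
  have mn : ∀ x, x ∈ Pn ↔ x ∈ P ∧ inner ℝ a x ≤ 0 := fun x => by
    rw [hPn, Submodule.mem_inf, mem_halfSpace_neg]
  have m0 : ∀ x, x ∈ P0 ↔ x ∈ P ∧ inner ℝ a x = 0 := fun x => by
    rw [hP0, Submodule.mem_inf, mp, mem_halfSpace_neg, and_assoc, le_antisymm_iff]; tauto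
  show coneEuler (P : Set E) = coneEuler (Pp : Set E) + coneEuler (Pn : Set E) -
    coneEuler (P0 : Set E)
  by_cases hpos : ∀ x ∈ P, inner ℝ a x ≤ 0
  · have e1 : Pn = P := by ext x; rw [mn]; exact and_iff_left_of_imp (hpos x)
    have e2 : P0 = Pp := by
      ext x; rw [m0, mp]
      exact and_congr_right fun hx => ⟨fun h => h.ge, fun h => le_antisymm (hpos x hx) h⟩
    rw [e1, e2]; ring
  by_cases hneg : ∀ x ∈ P, 0 ≤ inner ℝ a x
  · have e1 : Pp = P := by ext x; rw [mp]; exact and_iff_left_of_imp (hneg x)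
    have e2 : P0 = Pn := by
      ext x; rw [m0, mn]
      exact and_congr_right fun hx => ⟨fun h => h.le, fun h => le_antisymm h (hneg x hx)⟩
    rw [e1, e2]; ring
  push Not at hpos hneg
  obtain ⟨v, hv, hav⟩ := hpos
  obtain ⟨u, hu, hau⟩ := hneg
  have hPp' : ¬ IsSymm (Pp : Set E) := fun h => by
    have := ((mp _).1 (h v ((mp v).2 ⟨hv, hav.le⟩))).2
    rw [inner_neg_right] at this; linarith
  have hPn' : ¬ IsSymm (Pn : Set E) := fun h => by
    have := ((mn _).1 (h u ((mn u).2 ⟨hu, hau.le⟩))).2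
    rw [inner_neg_right] at this; linarith
  rw [coneEuler, coneEuler, coneEuler, coneEuler, if_neg hPp', if_neg hPn']
  by_cases h0 : IsSymm (P0 : Set E)
  · have hsymm : IsSymm (P : Set E) := by
      -- A positive combination of `x` and `y` lies on the wall, so its negative is in `P`; adding
      -- back either summand leaves a positive multiple of `-x` or of `-y`.
      have key : ∀ x ∈ P, ∀ y ∈ P, 0 < inner ℝ a x → inner ℝ a y < 0 → -x ∈ P ∧ -y ∈ P := by
        intro x hx y hy hax hay
        have hz : (-inner ℝ a y) • x + (inner ℝ a x) • y ∈ P0 := (m0 _).2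
          ⟨P.add_mem (PointedCone.smul_mem P (by linarith) hx) (PointedCone.smul_mem P hax.le hy),
            by rw [inner_add_right, inner_smul_right, inner_smul_right]; ring⟩
        have hz' := ((m0 _).1 (h0 _ hz)).1
        have h1 : (-inner ℝ a y) • (-x) ∈ P := by
          have := P.add_mem hz' (PointedCone.smul_mem P hax.le hy)
          convert this using 1; module
        have h2 : (inner ℝ a x) • (-y) ∈ P := by
          have := P.add_mem hz' (PointedCone.smul_mem P (by linarith : 0 ≤ -inner ℝ a y) hx)
          convert this using 1; module
        exact ⟨(PointedCone.smul_mem_iff P (by linarith)).1 h1,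
          (PointedCone.smul_mem_iff P hax).1 h2⟩
      intro x hx
      rcases lt_trichotomy (inner ℝ a x) 0 with h | h | h
      · exact (key v hv x hx hav h).2
      · exact ((m0 _).1 (h0 x ((m0 x).2 ⟨hx, h⟩))).1
      · exact (key x hx u hu h hau).1
    rw [if_pos hsymm, if_pos h0]
    obtain ⟨U, hU⟩ := exists_submodule_of_isSymm hsymm
    obtain ⟨W, hW⟩ := exists_submodule_of_isSymm h0
    have hUV : U ≤ V.1 := fun x hx => hP (hU ▸ hx)
    have : FiniteDimensional ℝ U := Submodule.finiteDimensional_of_le hUV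
    have hvU : v ∈ U := by rw [← SetLike.mem_coe, hU]; exact hv
    have hd := finrank_inf_orthogonal U (a := a) hvU hav.ne' (W := W) (fun x => by
      rw [← SetLike.mem_coe, hW, ← SetLike.mem_coe (p := U), hU]; exact m0 x)
    rw [← hU, ← hW, dim_submodule, dim_submodule, ← hd, pow_succ]
    ring
  · have hsymm : ¬ IsSymm (P : Set E) := fun h => h0 fun x hx => (m0 _).2
      ⟨h x ((m0 x).1 hx).1, by rw [inner_neg_right, ((m0 x).1 hx).2, neg_zero]⟩
    rw [if_neg hsymm, if_neg h0]; simp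

theorem exists_eulerHom (V : FinSub E) : ∃ Φ : ConeGroup V →+ ℤ, ∀ P : Set E, IsConvexCone P →
    P ⊆ V.1 → Φ (coneCls V P) = coneEuler P := by
  obtain ⟨Φ, hΦ⟩ := exists_hom_of_cutAdditive (cutAdditive_coneEuler V)
  refine ⟨Φ, fun P hP hV => ?_⟩
  obtain ⟨s, rfl⟩ := hP
  exact hΦ _ ⟨s, rfl⟩ hV

/-- The homomorphism with value `(-1)^dim P` on vector subspaces `P` and `0` on the other convex
cones. -/
def eulerHom (V : FinSub E) : ConeGroup V →+ ℤ := (exists_eulerHom V).choose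

theorem eulerHom_coneCls {V : FinSub E} {P : Set E} (hP : IsConvexCone P) (hV : P ⊆ V.1) :
    eulerHom V (coneCls V P) = coneEuler P := (exists_eulerHom V).choose_spec P hP hV

/-! ## Duality -/

-- The functional `u` is nonpositive on `P` if and only if it is so on both halves, and nonpositive
-- on the wall if and only if it is so on at least one half: points with positive value in both
-- halves would combine to such a point on the wall. For `u` in `V` this says that the indicator
-- function of the dual cone, evaluated at `u`, is additive under cuts of `P`.
open Classical in
theorem cutAdditive_dual (V : FinSub E) (u : E) :
    CutAdditive V (fun P => if ∀ v ∈ P, inner ℝ u v ≤ 0 then 1 else 0) := by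
  intro P hP a
  set Pp := P ⊓ halfSpace a with hPp
  set Pn := P ⊓ halfSpace (-a) with hPn
  set P0 := Pp ⊓ halfSpace (-a) with hP0
  have mp : ∀ x, x ∈ Pp ↔ x ∈ P ∧ 0 ≤ inner ℝ a x := fun x => Iff.rfl
  have mn : ∀ x, x ∈ Pn ↔ x ∈ P ∧ inner ℝ a x ≤ 0 := fun x => by
    rw [hPn, Submodule.mem_inf, mem_halfSpace_neg]
  have m0 : ∀ x, x ∈ P0 ↔ x ∈ P ∧ inner ℝ a x = 0 := fun x => by
    rw [hP0, Submodule.mem_inf, mp, mem_halfSpace_neg, and_assoc, le_antisymm_iff]; tauto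
  have key : (∀ v ∈ P, inner ℝ u v ≤ 0) ↔ (∀ v ∈ Pp, inner ℝ u v ≤ 0) ∧
      (∀ v ∈ Pn, inner ℝ u v ≤ 0) := by
    constructor
    · exact fun h => ⟨fun v hv => h v ((mp v).1 hv).1, fun v hv => h v ((mn v).1 hv).1⟩
    · rintro ⟨h1, h2⟩ v hv
      rcases le_total 0 (inner ℝ a v) with h | h
      · exact h1 v ((mp v).2 ⟨hv, h⟩)
      · exact h2 v ((mn v).2 ⟨hv, h⟩)
  have key0 : (∀ v ∈ P0, inner ℝ u v ≤ 0) ↔ (∀ v ∈ Pp, inner ℝ u v ≤ 0) ∨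
      (∀ v ∈ Pn, inner ℝ u v ≤ 0) := by
    constructor
    · intro h
      by_contra! hcon
      obtain ⟨⟨x, hx, hux⟩, ⟨y, hy, huy⟩⟩ := hcon
      have hx' := (mp x).1 hx
      have hy' := (mn y).1 hy
      rcases hx'.2.eq_or_lt with h0 | h0
      · exact absurd (h x ((m0 x).2 ⟨hx'.1, h0.symm⟩)) (not_le.2 hux)
      rcases hy'.2.eq_or_lt with h0' | h0'
      · exact absurd (h y ((m0 y).2 ⟨hy'.1, h0'⟩)) (not_le.2 huy)
      have hz := h ((-inner ℝ a y) • x + (inner ℝ a x) • y) ((m0 _).2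
          ⟨P.add_mem (PointedCone.smul_mem P (by linarith) hx'.1)
            (PointedCone.smul_mem P h0.le hy'.1),
            by rw [inner_add_right, inner_smul_right, inner_smul_right]; ring⟩)
      rw [inner_add_right, inner_smul_right, inner_smul_right] at hz
      nlinarith [mul_pos (neg_pos.2 h0') hux, mul_pos h0 huy]
    · rintro (h | h) v hv
      · exact h v ((mp v).2 ⟨((m0 v).1 hv).1, ((m0 v).1 hv).2.ge⟩)
      · exact h v ((mn v).2 ⟨((m0 v).1 hv).1, ((m0 v).1 hv).2.le⟩)
  show (if ∀ v ∈ P, inner ℝ u v ≤ 0 then (1 : ℤ) else 0) =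
    (if ∀ v ∈ Pp, inner ℝ u v ≤ 0 then 1 else 0) + (if ∀ v ∈ Pn, inner ℝ u v ≤ 0 then 1 else 0) -
    (if ∀ v ∈ P0, inner ℝ u v ≤ 0 then 1 else 0)
  by_cases h1 : ∀ v ∈ Pp, inner ℝ u v ≤ 0 <;> by_cases h2 : ∀ v ∈ Pn, inner ℝ u v ≤ 0
  · rw [if_pos (key.2 ⟨h1, h2⟩), if_pos h1, if_pos h2, if_pos (key0.2 (Or.inl h1))]; norm_num
  · rw [if_neg fun h => h2 (key.1 h).2, if_pos h1, if_neg h2, if_pos (key0.2 (Or.inl h1))]; norm_num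
  · rw [if_neg fun h => h1 (key.1 h).1, if_neg h1, if_pos h2, if_pos (key0.2 (Or.inr h2))]; norm_num
  · rw [if_neg fun h => h1 (key.1 h).1, if_neg h1, if_neg h2, if_neg fun h => ?_]
    · norm_num
    · exact (key0.1 h).elim h1 h2

theorem dualCone_hull [DecidableEq E] (V : FinSub E) (s : Finset E) :
    dualCone V (PointedCone.hull ℝ (s : Set E) : Set E) = polyCone V (s.image fun a => -a) := by
  ext w
  simp only [dualCone, polyCone, Set.mem_ofPred_eq, Finset.forall_mem_image, inner_neg_left,
    Left.nonneg_neg_iff, SetLike.mem_coe]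
  refine and_congr_right fun _ => ⟨fun h a ha => ?_, fun h v hv => ?_⟩
  · rw [real_inner_comm]; exact h a (Submodule.subset_span ha)
  · have := hull_nonneg (l := -innerₛₗ ℝ w) (s := (s : Set E)) (fun p hp => by
      have := h hp
      rw [real_inner_comm] at this
      simpa using this) hv
    simpa using this

theorem IsConvexCone.dualCone {V : FinSub E} {P : Set E} (h : IsConvexCone P) :
    IsConvexCone (dualCone V P) := by
  classical
  obtain ⟨s, rfl⟩ := h
  rw [dualCone_hull]
  exact isConvexCone_polyCone _ _

theorem dualCone_subset (V : FinSub E) (P : Set E) : dualCone V P ⊆ V.1 := fun _ h => h.1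

theorem ConeGroup.hom_ext {V : FinSub E} {M : Type*} [AddCommGroup M] {f g : ConeGroup V →+ M}
    (h : ∀ P, IsConvexCone P → P ⊆ V.1 → f (coneCls V P) = g (coneCls V P)) : f = g := by
  refine AddMonoidHom.eq_of_eqOn_dense (closure_convexCone V) ?_
  rintro _ ⟨P, hP, hV, rfl⟩
  exact h P hP hV

theorem PolyGroup.hom_ext {V : FinSub E} {M : Type*} [AddCommGroup M] {f g : PolyGroup V →+ M}
    (h : ∀ P, IsConvexPolytope P → P ⊆ V.1 → f (polyCls V P) = g (polyCls V P)) : f = g := by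
  refine AddMonoidHom.eq_of_eqOn_dense (closure_convexPolytope V) ?_
  rintro _ ⟨P, hP, hV, rfl⟩
  exact h P hP hV

theorem exists_isDuality (V : FinSub E) : ∃ D, IsDuality V D := by
  classical
  choose Φ hΦ using fun u : E => exists_hom_of_cutAdditive (cutAdditive_dual V u)
  let Ψ : ConeGroup V →+ (E → ℤ) :=
    AddMonoidHom.mk' (fun ξ u => if u ∈ V.1 then Φ u ξ else 0) (fun ξ η => by
      ext u; by_cases hu : u ∈ V.1 <;> simp [hu])
  have hΨ : ∀ P, IsConvexCone P → P ⊆ V.1 → Ψ (coneCls V P) = ind (dualCone V P) := by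
    rintro P hP hV
    have hP' := hP
    obtain ⟨s, rfl⟩ := hP
    ext u
    by_cases hu : u ∈ V.1
    · show (if u ∈ V.1 then Φ u _ else 0) = _
      rw [if_pos hu, hΦ u _ hP' hV]
      simp only [ind, dualCone, Set.mem_ofPred_eq, hu, true_and, SetLike.mem_coe]
    · show (if u ∈ V.1 then Φ u _ else 0) = _
      rw [if_neg hu, ind_of_notMem fun h => hu h.1]
  obtain ⟨D, hD⟩ := exists_lift_toFun (isSetLattice_cone V) Ψ (closure_convexCone V) (by
    rintro _ ⟨P, hP, hV, rfl⟩
    exact ⟨coneCls V (dualCone V P), by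
      rw [hΨ P hP hV, toFun_coneCls (hP.dualCone.isConeIn (dualCone_subset V P))]⟩)
  refine ⟨D, fun P hP hV => ValGroup.toFun_injective (isSetLattice_cone V) ?_⟩
  rw [hD, hΨ P hP hV]
  exact (toFun_coneCls (hP.dualCone.isConeIn (dualCone_subset V P))).symm

theorem IsDuality.unique {V : FinSub E} {D D' : ConeGroup V →+ ConeGroup V} (h : IsDuality V D)
    (h' : IsDuality V D') : D = D' :=
  ConeGroup.hom_ext fun P hP hV => by rw [h P hP hV, h' P hP hV]

theorem isDuality_duality (V : FinSub E) : IsDuality V (duality V) :=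
  Classical.epsilon_spec (exists_isDuality V)

/-! ## Tangent cones -/

/-- The set of vectors that point from `x` into `P`. -/
def tangent (P : Set E) (x : E) : Set E :=
  {w | ∀ᶠ t in nhdsWithin (0 : ℝ) (Set.Ioi 0), x + t • w ∈ P}

/-- Every ray from every point is, near its origin, contained in `P` or disjoint from `P`. -/
def RayDetermined (P : Set E) : Prop :=
  ∀ x w : E, (∃ᶠ t in nhdsWithin (0 : ℝ) (Set.Ioi 0), x + t • w ∈ P) → w ∈ tangent P x

theorem mem_tangent {P : Set E} {x w : E} :
    w ∈ tangent P x ↔ ∀ᶠ t in nhdsWithin (0 : ℝ) (Set.Ioi 0), x + t • w ∈ P := Iff.rfl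

theorem eventually_lt_of_pos {ε : ℝ} (hε : 0 < ε) :
    ∀ᶠ t in nhdsWithin (0 : ℝ) (Set.Ioi 0), 0 < t ∧ t < ε :=
  Ioo_mem_nhdsGT hε

theorem rayDetermined_of_convex {P : Set E} (hP : Convex ℝ P) : RayDetermined P := by
  intro x w h
  obtain ⟨r, hr, hr0, -⟩ := (h.and_eventually (eventually_lt_of_pos one_pos)).exists
  filter_upwards [eventually_lt_of_pos hr0] with t ht
  obtain ⟨s, hs, hs0, hst⟩ := (h.and_eventually (eventually_lt_of_pos ht.1)).exists
  have hrs : 0 < r - s := by linarith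
  have := hP hs hr (a := (r - t) / (r - s)) (b := (t - s) / (r - s))
    (div_nonneg (by linarith) hrs.le) (div_nonneg (by linarith) hrs.le)
    (by rw [← add_div]; exact (div_eq_one_iff_eq hrs.ne').2 (by ring))
  convert this using 1
  rw [smul_add, smul_add, smul_smul, smul_smul, add_add_add_comm, ← add_smul, ← add_smul]
  have e1 : (r - t) / (r - s) + (t - s) / (r - s) = 1 := by field_simp; ring
  have e2 : (r - t) / (r - s) * s + (t - s) / (r - s) * r = t := by field_simp; ring
  rw [e1, e2, one_smul]

theorem mem_tangent_iff_of_convex {P : Set E} (hP : Convex ℝ P) {x : E} (hx : x ∈ P) {w : E} :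
    w ∈ tangent P x ↔ ∃ ε : ℝ, 0 < ε ∧ x + ε • w ∈ P := by
  constructor
  · intro h
    obtain ⟨t, ht, ht0, -⟩ := ((mem_tangent.1 h).and (eventually_lt_of_pos one_pos)).exists
    exact ⟨t, ht0, ht⟩
  · rintro ⟨ε, hε, h⟩
    show ∀ᶠ t in nhdsWithin (0 : ℝ) (Set.Ioi 0), x + t • w ∈ P
    filter_upwards [eventually_lt_of_pos hε] with t ht
    have := hP.add_smul_mem hx h (t := t / ε) ⟨(div_pos ht.1 hε).le,
      (div_le_one hε).2 ht.2.le⟩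
    rwa [smul_smul, div_mul_cancel₀ _ hε.ne'] at this

theorem tangent_eq_empty {P : Set E} (hP : IsClosed P) {x : E} (hx : x ∉ P) : tangent P x = ∅ := by
  refine Set.eq_empty_of_forall_notMem fun w hw => hx ?_
  have hc : Filter.Tendsto (fun t : ℝ => x + t • w) (nhdsWithin 0 (Set.Ioi 0)) (nhds x) := by
    have : Continuous fun t : ℝ => x + t • w := by fun_prop
    have h := this.tendsto 0
    rw [zero_smul, add_zero] at h
    exact h.mono_left nhdsWithin_le_nhds
  exact hP.mem_of_tendsto hc hw

theorem tangent_empty (x : E) : tangent (∅ : Set E) x = ∅ :=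
  tangent_eq_empty isClosed_empty (Set.notMem_empty x)

theorem tangent_inter (P Q : Set E) (x : E) : tangent (P ∩ Q) x = tangent P x ∩ tangent Q x := by
  ext w
  rw [Set.mem_inter_iff, mem_tangent, mem_tangent, mem_tangent, ← Filter.eventually_and]
  rfl

theorem tangent_mono {P Q : Set E} (h : P ⊆ Q) (x : E) : tangent P x ⊆ tangent Q x :=
  fun _ hw => (mem_tangent.1 hw).mono fun _ ht => h ht

/-- Without ray determinacy a ray could enter and leave both sets infinitely often near `x`. This is
what makes taking tangent cones a valuation. -/
theorem tangent_union {P Q : Set E} (hP : RayDetermined P) (hQ : RayDetermined Q) (x : E) :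
    tangent (P ∪ Q) x = tangent P x ∪ tangent Q x := by
  ext w
  constructor
  · intro hw
    rcases Filter.frequently_or_distrib.1 (mem_tangent.1 hw).frequently with h | h
    · exact Or.inl (hP x w h)
    · exact Or.inr (hQ x w h)
  · rintro (h | h)
    · exact tangent_mono Set.subset_union_left x h
    · exact tangent_mono Set.subset_union_right x h

theorem RayDetermined.union {P Q : Set E} (hP : RayDetermined P) (hQ : RayDetermined Q) :
    RayDetermined (P ∪ Q) := by
  intro x w h
  rw [tangent_union hP hQ]
  exact (Filter.frequently_or_distrib.1 h).imp (hP x w) (hQ x w)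

theorem rayDetermined_biUnion (C : Finset (Set E)) (h : ∀ c ∈ C, RayDetermined c) :
    RayDetermined (⋃ c ∈ C, c) ∧ ∀ x, tangent (⋃ c ∈ C, c) x = ⋃ c ∈ C, tangent c x := by
  classical
  induction C using Finset.induction_on with
  | empty =>
    constructor
    · intro x w hw; simp at hw
    · intro x; simp [tangent_empty]
  | insert c C _ ih =>
    obtain ⟨h1, h2⟩ := ih fun d hd => h d (by simp [hd])
    simp only [Finset.set_biUnion_insert]
    exact ⟨(h c (by simp)).union h1, fun x => by rw [tangent_union (h c (by simp)) h1, h2]⟩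

open Classical in
theorem tangent_polyhedron {V : FinSub E} {L : Finset (E × ℝ)} {x : E} (hx : x ∈ polyhedron V L) :
    tangent (polyhedron V L) x =
      polyCone V ((L.filter fun p => affFun p x = 0).image Prod.fst) := by
  ext w
  constructor
  · intro hw
    obtain ⟨t, ht, h⟩ := (mem_tangent_iff_of_convex (convex_polyhedron V L) hx).1 hw
    refine ⟨?_, ?_⟩
    · have := V.1.smul_mem t⁻¹ (V.1.sub_mem h.1 hx.1)
      rwa [add_sub_cancel_left, smul_smul, inv_mul_cancel₀ ht.ne', one_smul] at this
    · intro a ha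
      obtain ⟨p, hp, rfl⟩ := Finset.mem_image.1 ha
      rw [Finset.mem_filter] at hp
      have := h.2 p hp.1
      rw [affFun_add_smul, hp.2, zero_add] at this
      exact nonneg_of_mul_nonneg_right this ht
  · rintro ⟨hwV, hw⟩
    have key : ∀ p ∈ L, ∀ᶠ t in nhdsWithin (0 : ℝ) (Set.Ioi 0), 0 ≤ affFun p (x + t • w) := by
      intro p hp
      rcases (hx.2 p hp).eq_or_lt with h0 | h0
      · filter_upwards [eventually_lt_of_pos one_pos] with t ht
        rw [affFun_add_smul, ← h0, zero_add]
        exact mul_nonneg ht.1.le (hw p.1 (Finset.mem_image_of_mem _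
          (Finset.mem_filter.2 ⟨hp, h0.symm⟩)))
      · have hc : Continuous fun t : ℝ => affFun p (x + t • w) :=
          (continuous_affFun p).comp (by fun_prop)
        have := (hc.tendsto 0).eventually (lt_mem_nhds (a := 0) (by simpa using h0))
        exact (this.filter_mono nhdsWithin_le_nhds).mono fun t ht => ht.le
    have := (Filter.eventually_all_finset L).2 key
    exact this.mono fun t ht => ⟨V.1.add_mem hx.1 (V.1.smul_mem t hwV), ht⟩

theorem tangent_polyhedron_piece (V : FinSub E) (L : Finset (E × ℝ)) (x : E) :
    tangent (polyhedron V L) x = ∅ ∨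
      (IsConvexCone (tangent (polyhedron V L) x) ∧ tangent (polyhedron V L) x ⊆ V.1) := by
  classical
  by_cases hx : x ∈ polyhedron V L
  · right
    rw [tangent_polyhedron hx]
    exact ⟨isConvexCone_polyCone _ _, fun y hy => hy.1⟩
  · exact Or.inl (tangent_eq_empty (isClosed_polyhedron V L) hx)

/-- The sets whose tangent cones define a homomorphism. -/
def HasTangentCones (V : FinSub E) (P : Set E) : Prop :=
  RayDetermined P ∧ ∀ x, IsConeIn V (tangent P x)

theorem hasTangentCones_of_pieces {V : FinSub E} {C : Finset (Set E)}
    (h : ∀ c ∈ C, ∃ L, c = polyhedron V L) : HasTangentCones V (⋃ c ∈ C, c) := by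
  have := rayDetermined_biUnion C fun c hc => by
    obtain ⟨L, rfl⟩ := h c hc
    exact rayDetermined_of_convex (convex_polyhedron V L)
  refine ⟨this.1, fun x => ?_⟩
  rw [this.2 x]
  refine ⟨IsUnionOf.biUnion _ _ fun c hc => ?_, Set.iUnion₂_subset fun c hc => ?_⟩
  · obtain ⟨L, rfl⟩ := h c hc
    rcases tangent_polyhedron_piece V L x with h1 | h1
    · rw [h1]; exact IsUnionOf.empty
    · exact IsUnionOf.of_piece h1.1
  · obtain ⟨L, rfl⟩ := h c hc
    rcases tangent_polyhedron_piece V L x with h1 | h1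
    · rw [h1]; exact Set.empty_subset _
    · exact h1.2

theorem IsConeIn.hasTangentCones {V : FinSub E} {P : Set E} (h : IsConeIn V P) :
    HasTangentCones V P := by
  obtain ⟨⟨C, hC, rfl⟩, hV⟩ := h
  exact hasTangentCones_of_pieces fun c hc =>
    (hC c hc).exists_polyhedron ((Set.subset_biUnion_of_mem (u := id) hc).trans hV)

theorem IsPolytopeIn.hasTangentCones {V : FinSub E} {P : Set E} (h : IsPolytopeIn V P) :
    HasTangentCones V P := by
  obtain ⟨⟨C, hC, rfl⟩, hV⟩ := h
  exact hasTangentCones_of_pieces fun c hc =>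
    (hC c hc).exists_polyhedron ((Set.subset_biUnion_of_mem (u := id) hc).trans hV)

/-- The homomorphism `P ↦ tangent P x`. -/
def tangentHom {A : Set E → Prop} {V : FinSub E} (hA : ∀ P, A P → HasTangentCones V P) (x : E) :
    ValGroup A →+ ConeGroup V :=
  ValGroup.lift (fun P => coneCls V (tangent P.1 x))
    { empty := fun P hP => by
        rw [hP, tangent_empty]; exact cls_empty (isSetLattice_cone V).empty
      union := fun P Q R S hR hS => by
        rw [hR, hS, tangent_union (hA _ P.2).1 (hA _ Q.2).1, tangent_inter]
        exact cls_union (isSetLattice_cone V) ((hA _ P.2).2 x) ((hA _ Q.2).2 x) }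

theorem tangentHom_cls {A : Set E → Prop} {V : FinSub E} (hA : ∀ P, A P → HasTangentCones V P)
    (x : E) {P : Set E} (hP : A P) : tangentHom hA x (cls A P) = coneCls V (tangent P x) := by
  rw [cls_eq hP, tangentHom, ValGroup.lift_mk]

/-- The tangent cone homomorphism on `Σ(V)`. -/
abbrev coneTangent (V : FinSub E) (x : E) : ConeGroup V →+ ConeGroup V :=
  tangentHom (A := IsConeIn V) (fun _ h => h.hasTangentCones) x

/-- The tangent cone homomorphism on `𝒫(V)`. -/
abbrev polyTangent (V : FinSub E) (x : E) : PolyGroup V →+ ConeGroup V :=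
  tangentHom (A := IsPolytopeIn V) (fun _ h => h.hasTangentCones) x

theorem toFun_coneTangent {V : FinSub E} (x : E) {P : Set E} (hP : IsConeIn V P) :
    ValGroup.toFun _ (coneTangent V x (coneCls V P)) = ind (tangent P x) := by
  rw [coneCls, tangentHom_cls _ _ hP, toFun_coneCls (hP.hasTangentCones.2 x)]

/-! ## The interior involutions -/

/-- The direction from `x` to a point `y` can be reversed exactly when the segment from `y` to `x`
can be prolonged. -/
theorem isSymm_tangent_iff {V : FinSub E} {L : Finset (E × ℝ)} {x : E} (hx : x ∈ polyhedron V L) :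
    IsSymm (tangent (polyhedron V L) x) ↔ x ∈ intrinsicInterior ℝ (polyhedron V L) := by
  have hc := convex_polyhedron V L
  rw [mem_intrinsicInterior_iff_forall rfl]
  constructor
  · intro h
    refine ⟨hx, fun y hy => ?_⟩
    have h1 : y - x ∈ tangent (polyhedron V L) x :=
      (mem_tangent_iff_of_convex hc hx).2 ⟨1, one_pos, by simpa using hy⟩
    have h2 := h _ h1
    rw [neg_sub] at h2
    exact (mem_tangent_iff_of_convex hc hx).1 h2
  · rintro ⟨-, h⟩ w hw
    obtain ⟨ε, hε, hw'⟩ := (mem_tangent_iff_of_convex hc hx).1 hw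
    obtain ⟨δ, hδ, h'⟩ := h _ hw'
    refine (mem_tangent_iff_of_convex hc hx).2 ⟨δ * ε, mul_pos hδ hε, ?_⟩
    convert h' using 1
    module

theorem tangent_eq_vectorSpan {V : FinSub E} {L : Finset (E × ℝ)} {x : E}
    (hx : x ∈ intrinsicInterior ℝ (polyhedron V L)) :
    tangent (polyhedron V L) x = vectorSpan ℝ (polyhedron V L) := by
  classical
  have hx' := intrinsicInterior_subset hx
  have hc := convex_polyhedron V L
  obtain ⟨U, hU⟩ : ∃ U : Submodule ℝ E, (U : Set E) = tangent (polyhedron V L) x := by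
    have h := (isSymm_tangent_iff hx').2 hx
    rw [tangent_polyhedron hx'] at h ⊢
    exact exists_submodule_of_isSymm (P := polyConeP V _) h
  refine Set.Subset.antisymm ?_ ?_
  · intro w hw
    obtain ⟨ε, hε, hw'⟩ := (mem_tangent_iff_of_convex hc hx').1 hw
    have := (vectorSpan ℝ (polyhedron V L)).smul_mem ε⁻¹ (vsub_mem_vectorSpan ℝ hw' hx')
    rwa [vsub_eq_sub, add_sub_cancel_left, smul_smul, inv_mul_cancel₀ hε.ne', one_smul] at this
  · rw [← hU, SetLike.coe_subset_coe, vectorSpan_eq_span_vsub_set_right ℝ hx', Submodule.span_le]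
    rintro _ ⟨y, hy, rfl⟩
    rw [hU]
    exact (mem_tangent_iff_of_convex hc hx').2 ⟨1, one_pos, by simpa using hy⟩

/-- The local description of `I`: at relative interior points the tangent cone is the direction
space of `P`, and at other points of `P` it is a convex cone that is not a subspace, on which
`eulerHom` vanishes. -/
theorem eulerHom_tangent {V : FinSub E} {P : Set E} {L : Finset (E × ℝ)} (hP : P = polyhedron V L)
    (x : E) : eulerHom V (coneCls V (tangent P x)) =
      (-1) ^ dim P * ind (intrinsicInterior ℝ P) x := by
  classical
  subst hP
  by_cases hx : x ∈ polyhedron V L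
  · have h1 : IsConvexCone (tangent (polyhedron V L) x) ∧ tangent (polyhedron V L) x ⊆ V.1 := by
      rw [tangent_polyhedron hx]
      exact ⟨isConvexCone_polyCone _ _, fun y hy => hy.1⟩
    rw [eulerHom_coneCls h1.1 h1.2, coneEuler]
    by_cases h : x ∈ intrinsicInterior ℝ (polyhedron V L)
    · rw [if_pos ((isSymm_tangent_iff hx).2 h), ind_of_mem h, mul_one, tangent_eq_vectorSpan h,
        dim_submodule, dim]
    · rw [if_neg (mt (isSymm_tangent_iff hx).1 h), ind_of_notMem h, mul_zero]
  · rw [tangent_eq_empty (isClosed_polyhedron V L) hx,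
      ind_of_notMem fun h => hx (intrinsicInterior_subset h), mul_zero, coneCls,
      cls_empty (isSetLattice_cone V).empty, map_zero]

/-- The function of points `x` that is the Euler number of the tangent cone at `x`. -/
def interiorFun {A : Set E → Prop} {V : FinSub E} (hA : ∀ P, A P → HasTangentCones V P) :
    ValGroup A →+ (E → ℤ) :=
  AddMonoidHom.mk' (fun ξ x => eulerHom V (tangentHom hA x ξ)) fun ξ η => by
    ext x; simp

theorem IsConeInterior.unique {V : FinSub E} {I J : ConeGroup V →+ ConeGroup V}
    (h : IsConeInterior V I) (h' : IsConeInterior V J) : I = J :=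
  ConeGroup.hom_ext fun P hP hV => by rw [h P hP hV, h' P hP hV]

theorem IsPolyInterior.unique {V : FinSub E} {I J : PolyGroup V →+ PolyGroup V}
    (h : IsPolyInterior V I) (h' : IsPolyInterior V J) : I = J :=
  PolyGroup.hom_ext fun P hP hV => by rw [h P hP hV, h' P hP hV]

theorem interiorFun_coneCls {V : FinSub E} {P : Set E} (hP : IsConvexCone P) (hV : P ⊆ V.1) :
    interiorFun (A := IsConeIn V) (V := V) (fun _ h => h.hasTangentCones) (coneCls V P) =
      ValGroup.toFun _ ((-1 : ℤ) ^ dim P • coneIntCls V P) := by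
  obtain ⟨L, hL⟩ := hP.exists_polyhedron hV
  rw [map_zsmul, toFun_coneIntCls hP hV]
  ext x
  show eulerHom V (tangentHom _ x (cls _ P)) = _
  rw [tangentHom_cls _ _ (hP.isConeIn hV), eulerHom_tangent hL]
  simp

theorem interiorFun_polyCls {V : FinSub E} {P : Set E} (hP : IsConvexPolytope P) (hV : P ⊆ V.1) :
    interiorFun (A := IsPolytopeIn V) (V := V) (fun _ h => h.hasTangentCones) (polyCls V P) =
      ValGroup.toFun _ ((-1 : ℤ) ^ dim P • polyIntCls V P) := by
  obtain ⟨L, hL⟩ := hP.exists_polyhedron hV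
  rw [map_zsmul, toFun_polyIntCls hP hV]
  ext x
  show eulerHom V (tangentHom _ x (cls _ P)) = _
  rw [tangentHom_cls _ _ (hP.isPolytopeIn hV), eulerHom_tangent hL]
  simp

/-- The pointwise formula is kept beside the defining property because it computes `I` on all
classes, not only on those of convex cones. -/
theorem exists_isConeInterior (V : FinSub E) : ∃ I, IsConeInterior V I ∧
    ∀ ξ x, ValGroup.toFun _ (I ξ) x = eulerHom V (coneTangent V x ξ) := by
  obtain ⟨I, hI⟩ := exists_lift_toFun (isSetLattice_cone V)
    (interiorFun (A := IsConeIn V) (V := V) (fun _ h => h.hasTangentCones))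
    (closure_convexCone V) (by
      rintro _ ⟨P, hP, hV, rfl⟩
      exact ⟨_, (interiorFun_coneCls hP hV).symm⟩)
  refine ⟨I, fun P hP hV => ValGroup.toFun_injective (isSetLattice_cone V) ?_, fun ξ x => ?_⟩
  · rw [hI, interiorFun_coneCls hP hV]
  · rw [hI]; rfl

theorem exists_isPolyInterior (V : FinSub E) : ∃ I, IsPolyInterior V I ∧
    ∀ ξ x, ValGroup.toFun _ (I ξ) x = eulerHom V (polyTangent V x ξ) := by
  obtain ⟨I, hI⟩ := exists_lift_toFun (isSetLattice_polytope V)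
    (interiorFun (A := IsPolytopeIn V) (V := V) (fun _ h => h.hasTangentCones))
    (closure_convexPolytope V) (by
      rintro _ ⟨P, hP, hV, rfl⟩
      exact ⟨_, (interiorFun_polyCls hP hV).symm⟩)
  refine ⟨I, fun P hP hV => ValGroup.toFun_injective (isSetLattice_polytope V) ?_, fun ξ x => ?_⟩
  · rw [hI, interiorFun_polyCls hP hV]
  · rw [hI]; rfl

theorem isConeInterior_coneInterior (V : FinSub E) : IsConeInterior V (coneInterior V) :=
  Classical.epsilon_spec ((exists_isConeInterior V).imp fun _ h => h.1)

theorem isPolyInterior_polyInterior (V : FinSub E) : IsPolyInterior V (polyInterior V) :=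
  Classical.epsilon_spec ((exists_isPolyInterior V).imp fun _ h => h.1)

theorem toFun_coneInterior {V : FinSub E} (ξ : ConeGroup V) (x : E) :
    ValGroup.toFun _ (coneInterior V ξ) x = eulerHom V (coneTangent V x ξ) := by
  obtain ⟨I, hI, h⟩ := exists_isConeInterior V
  rw [(isConeInterior_coneInterior V).unique hI, h]

theorem toFun_polyInterior {V : FinSub E} (ξ : PolyGroup V) (x : E) :
    ValGroup.toFun _ (polyInterior V ξ) x = eulerHom V (polyTangent V x ξ) := by
  obtain ⟨I, hI, h⟩ := exists_isPolyInterior V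
  rw [(isPolyInterior_polyInterior V).unique hI, h]

/-! ## Generators of the cone group -/

theorem polyCone_subset (V : FinSub E) (L : Finset E) : polyCone V L ⊆ V.1 := fun _ h => h.1

theorem isConeIn_polyCone (V : FinSub E) (L : Finset E) : IsConeIn V (polyCone V L) :=
  (isConvexCone_polyCone V L).isConeIn (polyCone_subset V L)

theorem ind_polyCone (V : FinSub E) (L : Finset E) (x : E) :
    ind (polyCone V L) x = ind (V.1 : Set E) x * ∏ a ∈ L, ind {y : E | 0 ≤ inner ℝ a y} x := by
  classical
  have : ∏ a ∈ L, ind {y : E | 0 ≤ inner ℝ a y} x = ind {y : E | ∀ a ∈ L, 0 ≤ inner ℝ a y} x := by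
    simp only [ind, Set.mem_ofPred_eq]
    rw [Finset.prod_ite_zero]
    simp
  rw [this, ← ind_inter]
  rfl

theorem sum_powerset_eq_prod {ι : Type*} [DecidableEq ι] (B : Finset ι) (f : ι → ℤ) :
    ∑ T ∈ B.powerset, (-1 : ℤ) ^ T.card * ∏ a ∈ T, f a = ∏ a ∈ B, (1 - f a) := by
  have := Finset.prod_add (fun a => -f a) (fun _ => (1 : ℤ)) B
  have h2 : ∏ a ∈ B, (1 - f a) = ∏ a ∈ B, (-f a + 1) := Finset.prod_congr rfl fun a _ => by ring
  rw [h2, this]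
  refine Finset.sum_congr rfl fun T _ => ?_
  rw [Finset.prod_const_one, mul_one, Finset.prod_neg]

/-- In a linear relation between the functionals with some negative coefficient, let `B` be the set
of those with negative coefficients. No point is nonnegative on the others and negative on all of
`B`, for the relation would have a positive value there. Expanding the indicator function of this
empty set over the subsets of `B` expresses the cone through cones with fewer inequalities. -/
theorem coneCls_polyCone_mem_closure (V : FinSub E) (n : ℕ) :
    ∀ L : Finset E, L.card = n → (∀ a ∈ L, a ∈ V.1) → coneCls V (polyCone V L) ∈
      AddSubgroup.closure {x : ConeGroup V | ∃ L : Finset E, (∀ a ∈ L, a ∈ V.1) ∧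
        LinearIndepOn ℝ id (L : Set E) ∧ x = coneCls V (polyCone V L)} := by
  classical
  induction n using Nat.strong_induction_on with
  | _ n ih =>
  intro L hL hLV
  set G := AddSubgroup.closure {x : ConeGroup V | ∃ L : Finset E, (∀ a ∈ L, a ∈ V.1) ∧
        LinearIndepOn ℝ id (L : Set E) ∧ x = coneCls V (polyCone V L)}
  by_cases hi : LinearIndepOn ℝ id (L : Set E)
  · exact AddSubgroup.subset_closure ⟨L, hLV, hi, rfl⟩
  obtain ⟨f, hf, a₀, ha₀, hfa₀⟩ : ∃ f : E → ℝ, ∑ a ∈ L, f a • a = 0 ∧ ∃ a ∈ L, f a < 0 := by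
    rw [linearIndepOn_finset_iff] at hi
    push Not at hi
    obtain ⟨f, hf, a, ha, hfa⟩ := hi
    rcases lt_or_gt_of_ne hfa with h | h
    · exact ⟨f, hf, a, ha, h⟩
    · refine ⟨-f, ?_, a, ha, by simpa using h⟩
      simpa using hf
  set B := L.filter (fun a => f a < 0) with hB
  set A := L.filter (fun a => ¬ f a < 0) with hA
  have hAB : A ∪ B = L := by
    rw [Finset.union_comm]; exact Finset.filter_union_filter_not_eq _ L
  have hdisj : Disjoint A B := (Finset.disjoint_filter_filter_not L L _).symm
  have hzero : ∑ T ∈ B.powerset, (-1 : ℤ) ^ T.card • coneCls V (polyCone V (A ∪ T)) = 0 := by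
    refine ValGroup.toFun_injective (isSetLattice_cone V) ?_
    rw [map_sum, map_zero]
    ext x
    rw [Finset.sum_apply]
    have h1 : ∀ T ∈ B.powerset,
        ValGroup.toFun _ ((-1 : ℤ) ^ T.card • coneCls V (polyCone V (A ∪ T))) x =
        (ind (V.1 : Set E) x * ∏ a ∈ A, ind {y : E | 0 ≤ inner ℝ a y} x) *
          ((-1) ^ T.card * ∏ a ∈ T, ind {y : E | 0 ≤ inner ℝ a y} x) := by
      intro T hT
      rw [map_zsmul, toFun_coneCls (isConeIn_polyCone _ _), Pi.smul_apply, ind_polyCone,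
        Finset.prod_union (hdisj.mono_right (Finset.mem_powerset.1 hT)), smul_eq_mul]
      ring
    rw [Finset.sum_congr rfl h1, ← Finset.mul_sum, sum_powerset_eq_prod]
    by_contra hne
    have hne' := left_ne_zero_of_mul hne
    have hneB := right_ne_zero_of_mul hne
    have hneA := right_ne_zero_of_mul hne'
    rw [Finset.prod_ne_zero_iff] at hneA hneB
    have hAx : ∀ a ∈ A, 0 ≤ inner ℝ a x := fun a ha => by
      by_contra h
      exact hneA a ha (ind_of_notMem h)
    have hBx : ∀ a ∈ B, inner ℝ a x < 0 := fun a ha => by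
      by_contra h
      exact hneB a ha (by rw [ind_of_mem (show x ∈ {y : E | 0 ≤ inner ℝ a y} from not_lt.1 h),
        sub_self])
    have hsum : ∑ a ∈ L, f a * inner ℝ a x = 0 := by
      have := congrArg (fun v => inner ℝ v x) hf
      simpa [sum_inner, inner_smul_left] using this
    have hpos : 0 < ∑ a ∈ L, f a * inner ℝ a x := by
      refine Finset.sum_pos' (fun a ha => ?_) ⟨a₀, ha₀, ?_⟩
      · by_cases h : f a < 0
        · exact (mul_pos_of_neg_of_neg h (hBx a (Finset.mem_filter.2 ⟨ha, h⟩))).le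
        · exact mul_nonneg (not_lt.1 h) (hAx a (Finset.mem_filter.2 ⟨ha, h⟩))
      · exact mul_pos_of_neg_of_neg hfa₀ (hBx a₀ (Finset.mem_filter.2 ⟨ha₀, hfa₀⟩))
    exact absurd hsum hpos.ne'
  rw [← Finset.add_sum_erase _ _ (Finset.mem_powerset_self B), hAB] at hzero
  have hrest : ∑ T ∈ B.powerset.erase B,
      (-1 : ℤ) ^ T.card • coneCls V (polyCone V (A ∪ T)) ∈ G := by
    refine sum_mem fun T hT => zsmul_mem (ih _ ?_ _ rfl ?_) _
    · rw [Finset.mem_erase, Finset.mem_powerset] at hT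
      rw [← hL, ← hAB]
      refine Finset.card_lt_card ⟨Finset.union_subset_union_right hT.2, fun h => hT.1 ?_⟩
      refine Finset.Subset.antisymm hT.2 fun b hb => ?_
      exact (Finset.mem_union.1 (h (Finset.mem_union_right _ hb))).resolve_left
        fun hbA => (Finset.disjoint_left.1 hdisj) hbA hb
    · intro a ha
      rw [Finset.mem_erase, Finset.mem_powerset] at hT
      exact hLV a (hAB ▸ Finset.union_subset_union_right hT.2 ha)
  have h2 : (-1 : ℤ) ^ B.card • coneCls V (polyCone V L) ∈ G := by
    rw [eq_neg_of_add_eq_zero_left hzero]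
    exact neg_mem hrest
  have h3 := zsmul_mem h2 ((-1 : ℤ) ^ B.card)
  rwa [smul_smul, ← mul_pow, neg_one_mul, neg_neg, one_pow, one_smul] at h3

/-- The cone group is generated by the cones cut out by linearly independent functionals. -/
theorem closure_polyCone (V : FinSub E) :
    AddSubgroup.closure {x : ConeGroup V | ∃ L : Finset E, (∀ a ∈ L, a ∈ V.1) ∧
        LinearIndepOn ℝ id (L : Set E) ∧ x = coneCls V (polyCone V L)} = ⊤ := by
  rw [eq_top_iff, ← closure_convexCone V, AddSubgroup.closure_le]
  rintro _ ⟨P, hP, hV, rfl⟩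
  obtain ⟨L, hL, rfl⟩ := hP.exists_polyCone hV
  exact coneCls_polyCone_mem_closure V _ L rfl hL

theorem ConeGroup.hom_ext_polyCone {V : FinSub E} {M : Type*} [AddCommGroup M]
    {f g : ConeGroup V →+ M} (h : ∀ L : Finset E, (∀ a ∈ L, a ∈ V.1) →
      LinearIndepOn ℝ id (L : Set E) → f (coneCls V (polyCone V L)) = g (coneCls V (polyCone V L))) :
    f = g := by
  refine AddMonoidHom.eq_of_eqOn_dense (closure_polyCone V) ?_
  rintro _ ⟨L, hL, hi, rfl⟩
  exact h L hL hi

/-- Independent functionals take all combinations of values. This provides the points with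
prescribed signs that generic cones need not have, and is the reason for passing to these
generators. -/
theorem exists_inner_eq_of_linearIndepOn {V : FinSub E} {L : Finset E} (hL : ∀ a ∈ L, a ∈ V.1)
    (hi : LinearIndepOn ℝ id (L : Set E)) (ε : E → ℝ) : ∃ z ∈ V.1, ∀ a ∈ L, inner ℝ a z = ε a := by
  let b := Module.Basis.span hi
  obtain ⟨g, hg⟩ := LinearMap.exists_extend (b.constr ℝ fun i => ε i)
  obtain ⟨z, hz, hgz⟩ := exists_inner_eq V g
  refine ⟨z, hz, fun a ha => ?_⟩
  rw [real_inner_comm, ← hgz a (hL a ha)]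
  have h1 := Module.Basis.constr_basis b ℝ (fun i => ε i) ⟨a, ha⟩
  rw [← hg] at h1
  have h2 : (b ⟨a, ha⟩ : E) = a  := congrArg Subtype.val (Module.Basis.span_apply hi ⟨a, ha⟩)
  rw [LinearMap.comp_apply, Submodule.subtype_apply, h2] at h1
  exact h1

/-! ## Half-open cones -/

theorem isSymm_submodule (U : Submodule ℝ E) : IsSymm (U : Set E) := fun _ hx => U.neg_mem hx

theorem coneEuler_submodule (U : Submodule ℝ E) :
    coneEuler (U : Set E) = (-1) ^ Module.finrank ℝ U := by
  rw [coneEuler, if_pos (isSymm_submodule U), dim_submodule]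

-- The strict inequalities are imposed one at a time by subtracting the closed cone where `-b` is
-- nonnegative. The point `z` stays strictly positive on the weak inequalities throughout, so every
-- closed cone defined by at least one inequality is not a subspace and has Euler number `0`; only
-- the whole space `V` can contribute.
open Classical in
theorem exists_halfOpen (V : FinSub E) (B : Finset E) : ∀ A : Finset E,
    (∃ z ∈ V.1, (∀ a ∈ A, 0 < inner ℝ a z) ∧ ∀ b ∈ B, inner ℝ b z < 0) →
    ∃ ξ : ConeGroup V, ValGroup.toFun _ ξ =
      ind {x : E | x ∈ V.1 ∧ (∀ a ∈ A, 0 ≤ inner ℝ a x) ∧ ∀ b ∈ B, 0 < inner ℝ b x} ∧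
      eulerHom V ξ = if A = ∅ then (-1) ^ V.dim else 0 := by
  induction B using Finset.induction_on with
  | empty =>
    rintro A ⟨z, hz, hA, -⟩
    refine ⟨coneCls V (polyCone V A), ?_, ?_⟩
    · rw [toFun_coneCls (isConeIn_polyCone V A)]
      simp [polyCone]
    · rw [eulerHom_coneCls (isConvexCone_polyCone V A) (polyCone_subset V A)]
      split_ifs with h
      · have : polyCone V A = V.1 := by
          subst h; ext x; simp [polyCone]
        rw [this, coneEuler_submodule]
        rfl
      · obtain ⟨a, ha⟩ := Finset.nonempty_iff_ne_empty.2 h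
        refine if_neg fun hs => ?_
        have := (hs z ⟨hz, fun a ha => (hA a ha).le⟩).2 a ha
        rw [inner_neg_right] at this
        linarith [hA a ha]
  | insert b B _ ih =>
    rintro A ⟨z, hz, hA, hB⟩
    have hB' : ∀ c ∈ B, inner ℝ c z < 0 := fun c hc => hB c (by simp [hc])
    obtain ⟨ξ, h1, h2⟩ := ih A ⟨z, hz, hA, hB'⟩
    obtain ⟨η, h3, h4⟩ := ih (insert (-b) A) ⟨z, hz, by
      rw [Finset.forall_mem_insert, inner_neg_left]
      exact ⟨by linarith [hB b (by simp)], hA⟩, hB'⟩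
    refine ⟨ξ - η, ?_, ?_⟩
    · rw [map_sub, h1, h3]
      ext x
      simp only [Pi.sub_apply, ind, Set.mem_ofPred_eq, Finset.forall_mem_insert, inner_neg_left,
        Left.nonneg_neg_iff]
      by_cases hb : inner ℝ b x ≤ 0
      · simp only [hb, not_lt.2 hb, true_and, false_and, and_false, if_false]
        split_ifs <;> rfl
      · simp [hb, not_le.1 hb]
    · rw [map_sub, h2, h4, if_neg (Finset.insert_ne_empty _ _), sub_zero]

/-! ## The interior involution on generators -/

theorem mem_intrinsicInterior_polyCone {V : FinSub E} {L : Finset E}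
    (h : ∃ z ∈ V.1, ∀ a ∈ L, 0 < inner ℝ a z) {x : E} :
    x ∈ intrinsicInterior ℝ (polyCone V L) ↔ x ∈ V.1 ∧ ∀ a ∈ L, 0 < inner ℝ a x := by
  classical
  obtain ⟨z, hz, hpos⟩ := h
  have hzL : z ∈ polyCone V L := ⟨hz, fun a ha => (hpos a ha).le⟩
  have e := polyCone_eq_polyhedron V L
  rw [e, mem_intrinsicInterior_polyhedron, ← e]
  simp only [Finset.forall_mem_image, affFun, add_zero]
  constructor
  · rintro ⟨h1, h2⟩
    exact ⟨h1.1, fun a ha => h2 ha ⟨z, hzL, hpos a ha⟩⟩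
  · rintro ⟨h1, h2⟩
    exact ⟨⟨h1, fun a ha => (h2 a ha).le⟩, fun a ha _ => h2 a ha⟩

theorem dim_polyCone {V : FinSub E} {L : Finset E} (h : ∃ z ∈ V.1, ∀ a ∈ L, 0 < inner ℝ a z) :
    dim (polyCone V L) = V.dim := by
  classical
  obtain ⟨z, hz, hpos⟩ := h
  have e := polyCone_eq_polyhedron V L
  have hzI := (mem_intrinsicInterior_polyCone (L := L) ⟨z, hz, hpos⟩).2 ⟨hz, hpos⟩
  have h1 : tangent (polyCone V L) z = V.1 := by
    rw [e] at hzI ⊢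
    rw [tangent_polyhedron (intrinsicInterior_subset hzI)]
    ext w
    simp only [polyCone, Finset.forall_mem_image, Finset.mem_filter, Set.mem_ofPred_eq,
      SetLike.mem_coe, and_iff_left_iff_imp]
    rintro - p ⟨hp, hp0⟩
    obtain ⟨a, ha, rfl⟩ := Finset.mem_image.1 hp
    simp only [affFun, add_zero] at hp0
    exact absurd hp0 (hpos a ha).ne'
  have h2 : vectorSpan ℝ (polyCone V L) = V.1 := by
    apply SetLike.coe_injective
    rw [← h1, e]
    rw [e] at hzI
    exact (tangent_eq_vectorSpan hzI).symm
  rw [dim, h2]; rfl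

/-- The Euler homomorphism of the interior involute is the value at the origin. -/
theorem eulerHom_coneInterior (V : FinSub E) (ξ : ConeGroup V) :
    eulerHom V (coneInterior V ξ) = ValGroup.toFun _ ξ 0 := by
  have : (eulerHom V).comp (coneInterior V) =
      (Pi.evalAddMonoidHom (fun _ : E => ℤ) 0).comp (ValGroup.toFun (IsConeIn V)) := by
    refine ConeGroup.hom_ext_polyCone fun L hL hi => ?_
    -- The interior is the half-open cone with all inequalities strict, for which `exists_halfOpen`
    -- asks for a point negative on `L`; the opposite point lies in the interior.
    obtain ⟨z, hz, hLz⟩ := exists_inner_eq_of_linearIndepOn hL hi fun _ => -1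
    have hpos : ∃ z ∈ V.1, ∀ a ∈ L, 0 < inner ℝ a z := ⟨-z, V.1.neg_mem hz, fun a ha => by
      rw [inner_neg_right, hLz a ha]; norm_num⟩
    have hC := isConvexCone_polyCone V L
    have hV := polyCone_subset V L
    obtain ⟨η, h1, h2⟩ := exists_halfOpen V L ∅ ⟨z, hz, by simp, fun b hb => by
      rw [hLz b hb]; norm_num⟩
    have h3 : coneIntCls V (polyCone V L) = η := by
      refine ValGroup.toFun_injective (isSetLattice_cone V) ?_
      rw [toFun_coneIntCls hC hV, h1]
      congr 1
      ext x
      rw [mem_intrinsicInterior_polyCone hpos]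
      simp
    simp only [AddMonoidHom.comp_apply, Pi.evalAddMonoidHom_apply]
    rw [isConeInterior_coneInterior V _ hC hV, map_zsmul, h3, h2, if_pos rfl, dim_polyCone hpos,
      toFun_coneCls (isConeIn_polyCone V L), ind_of_mem hC.zero_mem, smul_eq_mul, ← mul_pow]
    simp
  exact DFunLike.congr_fun this ξ

/-- A convex cone contains the origin, so the Euler number of `(-1)^dim P • (int P)` is `1`. -/
theorem eulerHom_coneIntCls {V : FinSub E} {P : Set E} (hP : IsConvexCone P) (hV : P ⊆ V.1) :
    eulerHom V (coneIntCls V P) = (-1) ^ dim P := by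
  have h := eulerHom_coneInterior V (coneCls V P)
  rw [isConeInterior_coneInterior V _ hP hV, map_zsmul, toFun_coneCls (hP.isConeIn hV),
    ind_of_mem hP.zero_mem, smul_eq_mul] at h
  have h2 : ((-1 : ℤ) ^ dim P) * (-1) ^ dim P = 1 := by rw [← mul_pow]; simp
  calc eulerHom V (coneIntCls V P) = ((-1) ^ dim P * (-1) ^ dim P) * eulerHom V (coneIntCls V P) := by
        rw [h2, one_mul]
    _ = (-1) ^ dim P := by rw [mul_assoc, h, mul_one]

-- Moving a little from `y` in the direction `w`, an inequality that does not decrease along `w`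
-- need only hold at `y`, and one that decreases must hold strictly. As a condition on `y` this
-- defines a half-open cone.
open Classical in
theorem mem_tangent_polyCone {V : FinSub E} {L : Finset E} {w : E} (hw : w ∈ V.1) (y : E) :
    w ∈ tangent (polyCone V L) y ↔ y ∈ V.1 ∧
      (∀ a ∈ L.filter (fun a => 0 ≤ inner ℝ a w), 0 ≤ inner ℝ a y) ∧
      ∀ a ∈ L.filter (fun a => inner ℝ a w < 0), 0 < inner ℝ a y := by
  have e := polyCone_eq_polyhedron V L
  by_cases hy : y ∈ polyCone V L
  · rw [e] at hy ⊢
    rw [tangent_polyhedron hy, ← e] at *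
    simp only [polyCone, Finset.forall_mem_image, Finset.mem_filter, Set.mem_ofPred_eq, affFun]
    constructor
    · rintro ⟨-, h⟩
      refine ⟨hy.1, fun a ha => hy.2 a ha.1, fun a ha => (hy.2 a ha.1).lt_of_ne fun h0 => ?_⟩
      have := @h (a, 0) (Finset.mem_filter.2 ⟨Finset.mem_image_of_mem _ ha.1, by simpa using h0.symm⟩)
      exact absurd this (not_le.2 ha.2)
    · rintro ⟨-, -, h⟩
      refine ⟨hw, ?_⟩
      intro p hp'
      obtain ⟨hp, hp0⟩ := Finset.mem_filter.1 hp'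
      obtain ⟨a, ha, rfl⟩ := Finset.mem_image.1 hp
      by_contra hneg
      have := h a ⟨ha, not_le.1 hneg⟩
      simp only [add_zero] at hp0
      exact absurd hp0 this.ne'
  · have h0 : tangent (polyCone V L) y = ∅ := by
      rw [e] at hy ⊢
      exact tangent_eq_empty (isClosed_polyhedron _ _) hy
    rw [h0]
    refine ⟨fun h => h.elim, fun ⟨h1, h2, h3⟩ => hy ⟨h1, fun a ha => ?_⟩⟩
    rcases le_or_gt 0 (inner ℝ a w) with h | h
    · exact h2 a (Finset.mem_filter.2 ⟨ha, h⟩)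
    · exact (h3 a (Finset.mem_filter.2 ⟨ha, h⟩)).le

/-- Moving a cone by an infinitesimal multiple of `-w` gives a homomorphism, whose Euler number
is the value of the interior involute at `-w`. -/
theorem exists_shift {V : FinSub E} {w : E} (hw : w ∈ V.1) :
    ∃ S : ConeGroup V →+ ConeGroup V,
      (∀ ξ y, ValGroup.toFun _ (S ξ) y = ValGroup.toFun _ (coneTangent V y ξ) w) ∧
      ∀ ξ, eulerHom V (S ξ) = ValGroup.toFun _ (coneInterior V ξ) (-w) := by
  classical
  let Φ : ConeGroup V →+ (E → ℤ) :=
    AddMonoidHom.mk' (fun ξ y => ValGroup.toFun _ (coneTangent V y ξ) w) fun ξ η => by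
      ext y; simp
  have key : ∀ L : Finset E, (∀ a ∈ L, a ∈ V.1) → LinearIndepOn ℝ id (L : Set E) →
      ∃ η : ConeGroup V, ValGroup.toFun _ η = Φ (coneCls V (polyCone V L)) ∧
        eulerHom V η = ValGroup.toFun _ (coneInterior V (coneCls V (polyCone V L))) (-w) := by
    intro L hL hi
    -- The signs are those required by `exists_halfOpen`: positive where the inequality stays weak,
    -- negative where it becomes strict.
    obtain ⟨z, hz, hLz⟩ := exists_inner_eq_of_linearIndepOn hL hi
      fun a => if 0 ≤ inner ℝ a w then 1 else -1
    obtain ⟨u, hu, hLu⟩ := exists_inner_eq_of_linearIndepOn hL hi fun _ => 1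
    have hpos : ∃ z ∈ V.1, ∀ a ∈ L, 0 < inner ℝ a z :=
      ⟨u, hu, fun a ha => by rw [hLu a ha]; norm_num⟩
    have hC := isConvexCone_polyCone V L
    have hV := polyCone_subset V L
    obtain ⟨η, h1, h2⟩ := exists_halfOpen V (L.filter fun a => inner ℝ a w < 0)
      (L.filter fun a => 0 ≤ inner ℝ a w) ⟨z, hz, fun a ha => by
        rw [Finset.mem_filter] at ha
        rw [hLz a ha.1, if_pos ha.2]; norm_num, fun a ha => by
        rw [Finset.mem_filter] at ha
        rw [hLz a ha.1, if_neg (not_le.2 ha.2)]; norm_num⟩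
    refine ⟨η, ?_, ?_⟩
    · rw [h1]
      ext y
      show _ = ValGroup.toFun _ (coneTangent V y _) w
      rw [toFun_coneTangent y (isConeIn_polyCone V L)]
      exact ind_congr (mem_tangent_polyCone hw y).symm
    · rw [h2, isConeInterior_coneInterior V _ hC hV, map_zsmul, toFun_coneIntCls hC hV,
        dim_polyCone hpos, Pi.smul_apply, smul_eq_mul]
      -- The Euler number of the half-open cone is nonzero only if all its inequalities are strict,
      -- that is, if all the functionals are negative at `w`.
      have hiff : L.filter (fun a => 0 ≤ inner ℝ a w) = ∅ ↔
          -w ∈ intrinsicInterior ℝ (polyCone V L) := by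
        rw [mem_intrinsicInterior_polyCone hpos, Finset.filter_eq_empty_iff]
        simp [inner_neg_right, hw]
      by_cases h : L.filter (fun a => 0 ≤ inner ℝ a w) = ∅
      · rw [if_pos h, ind_of_mem (hiff.1 h), mul_one]
      · rw [if_neg h, ind_of_notMem (mt hiff.2 h), mul_zero]
  obtain ⟨S, hS⟩ := exists_lift_toFun (isSetLattice_cone V) Φ (closure_polyCone V) (by
    rintro _ ⟨L, hL, hi, rfl⟩
    obtain ⟨η, h, -⟩ := key L hL hi
    exact ⟨η, h⟩)
  refine ⟨S, fun ξ y => by rw [hS]; rfl, fun ξ => ?_⟩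
  have : (eulerHom V).comp S = (Pi.evalAddMonoidHom (fun _ : E => ℤ) (-w)).comp
      ((ValGroup.toFun (IsConeIn V)).comp (coneInterior V)) := by
    refine ConeGroup.hom_ext_polyCone fun L hL hi => ?_
    obtain ⟨η, h1, h2⟩ := key L hL hi
    have : S (coneCls V (polyCone V L)) = η :=
      ValGroup.toFun_injective (isSetLattice_cone V) (by rw [hS, h1])
    simp only [AddMonoidHom.comp_apply, Pi.evalAddMonoidHom_apply]
    rw [this, h2]
  exact DFunLike.congr_fun this ξ

/-! ## Duality and the interior involution -/

theorem dualCone_dualCone {V : FinSub E} {P : Set E} (hP : IsConvexCone P) (hV : P ⊆ V.1) :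
    dualCone V (dualCone V P) = P := by
  obtain ⟨L, hL, rfl⟩ := hP.exists_polyCone hV
  ext x
  constructor
  · rintro ⟨hx, h⟩
    refine ⟨hx, fun a ha => ?_⟩
    have := h (-a) ⟨V.1.neg_mem (hL a ha), fun v hv => by
      rw [inner_neg_left, Left.neg_nonpos_iff]; exact hv.2 a ha⟩
    rw [inner_neg_right, Left.neg_nonpos_iff, real_inner_comm] at this
    exact this
  · intro hx
    exact ⟨hx.1, fun w hw => by rw [real_inner_comm]; exact hw.2 x hx⟩

theorem isConvexCone_hull (s : Finset E) :
    IsConvexCone (PointedCone.hull ℝ (s : Set E) : Set E) := ⟨s, rfl⟩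

theorem hull_subset {V : FinSub E} {s : Finset E} (hs : ∀ a ∈ s, a ∈ V.1) :
    (PointedCone.hull ℝ (s : Set E) : Set E) ⊆ V.1 := fun _ hx => hull_le_submodule hs hx

theorem mem_hull_image_neg [DecidableEq E] (s : Finset E) (x : E) :
    x ∈ PointedCone.hull ℝ ((s.image fun a => -a : Finset E) : Set E) ↔
      -x ∈ PointedCone.hull ℝ (s : Set E) := by
  have key : ∀ (t u : Set E), (∀ a ∈ t, -a ∈ u) → ∀ y, y ∈ PointedCone.hull ℝ t →
      -y ∈ PointedCone.hull ℝ u := by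
    intro t u htu y hy
    induction hy using Submodule.span_induction with
    | mem z hz => exact Submodule.subset_span (htu z hz)
    | zero => simp
    | add a b _ _ ha hb => rw [neg_add]; exact add_mem ha hb
    | smul c a _ ha => rw [← smul_neg]; exact Submodule.smul_mem _ c ha
  constructor
  · refine key _ _ ?_ x
    intro a ha
    obtain ⟨b, hb, rfl⟩ := Finset.mem_image.1 ha
    simpa using hb
  · intro h
    have := key (s : Set E) ((s.image fun a => -a : Finset E) : Set E)
      (fun a ha => Finset.mem_image_of_mem _ ha) _ h
    rwa [neg_neg] at this

/-! ### Faces of a simplicial cone in dual coordinates. -/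

section DualBasis

variable {M : Finset E} {z : E → E}

theorem eq_sum_of_mem_span [DecidableEq E]
    (hz : ∀ a ∈ M, ∀ b ∈ M, inner ℝ b (z a) = if b = a then (1 : ℝ) else 0) {x : E}
    (hx : x ∈ Submodule.span ℝ (M : Set E)) : x = ∑ a ∈ M, inner ℝ (z a) x • a := by
  induction hx using Submodule.span_induction with
  | mem b hb =>
    have : ∀ a ∈ M, inner ℝ (z a) b • a = if a = b then a else 0 := fun a ha => by
      rw [real_inner_comm, hz a ha b hb]
      by_cases h : b = a
      · simp [h]
      · simp [h, Ne.symm h]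
    rw [Finset.sum_congr rfl this, Finset.sum_ite_eq' M b]
    exact (if_pos hb).symm
  | zero => simp
  | add a b _ _ ha hb =>
    conv_lhs => rw [ha, hb]
    rw [← Finset.sum_add_distrib]
    exact Finset.sum_congr rfl fun c _ => by rw [inner_add_right, add_smul]
  | smul c a _ ha =>
    conv_lhs => rw [ha]
    rw [Finset.smul_sum]
    exact Finset.sum_congr rfl fun d _ => by rw [inner_smul_right, mul_smul]

/-- The inner products with the `z a` are the coordinates in the basis `M` of its span, so the face
generated by `S` is given by signs of coordinates. -/
theorem mem_hull_iff_dual [DecidableEq E]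
    (hz : ∀ a ∈ M, ∀ b ∈ M, inner ℝ b (z a) = if b = a then (1 : ℝ) else 0) {S : Finset E}
    (hS : S ⊆ M) (x : E) :
    x ∈ PointedCone.hull ℝ (S : Set E) ↔ x ∈ Submodule.span ℝ (M : Set E) ∧
      (∀ a ∈ S, 0 ≤ inner ℝ (z a) x) ∧ ∀ a ∈ M \ S, inner ℝ (z a) x = 0 := by
  constructor
  · intro hx
    refine ⟨hull_le_submodule (Submodule.subset_span.trans
      (Submodule.span_mono (Finset.coe_subset.2 hS))) hx, fun a ha => ?_, fun a ha => ?_⟩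
    · refine hull_nonneg (l := innerₛₗ ℝ (z a)) (fun b hb => ?_) hx
      have := hz a (hS ha) b (hS hb)
      rw [innerₛₗ_apply_apply, real_inner_comm, this]
      split_ifs <;> norm_num
    · rw [Finset.mem_sdiff] at ha
      have h0 : ∀ b ∈ S, inner ℝ (z a) b = 0 := fun b hb => by
        rw [real_inner_comm, hz a ha.1 b (hS hb), if_neg]
        rintro rfl
        exact ha.2 hb
      have h1 := hull_nonneg (s := (S : Set E)) (l := innerₛₗ ℝ (z a))
        (fun b hb => (h0 b hb).ge) hx
      have h2 := hull_nonneg (s := (S : Set E)) (l := -innerₛₗ ℝ (z a))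
        (fun b hb => by simp [h0 b hb]) hx
      simp only [LinearMap.neg_apply, innerₛₗ_apply_apply] at h1 h2
      linarith
  · rintro ⟨hx, h1, h2⟩
    rw [eq_sum_of_mem_span hz hx]
    refine sum_mem fun a ha => ?_
    by_cases haS : a ∈ S
    · exact PointedCone.smul_mem _ (h1 a haS) (Submodule.subset_span haS)
    · rw [h2 a (Finset.mem_sdiff.2 ⟨ha, haS⟩), zero_smul]; exact Submodule.zero_mem _

/-- The subspace spanned by a finite set. -/
def FinSub.span (M : Finset E) : FinSub E :=
  ⟨Submodule.span ℝ (M : Set E), FiniteDimensional.span_finset ℝ M⟩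

theorem hull_eq_polyCone [DecidableEq E]
    (hz : ∀ a ∈ M, ∀ b ∈ M, inner ℝ b (z a) = if b = a then (1 : ℝ) else 0) :
    (PointedCone.hull ℝ (M : Set E) : Set E) = polyCone (FinSub.span M) (M.image z) := by
  ext x
  rw [SetLike.mem_coe, mem_hull_iff_dual hz (Finset.Subset.refl M)]
  simp [polyCone, FinSub.span]

theorem exists_pos_on_dual [DecidableEq E]
    (hz : ∀ a ∈ M, ∀ b ∈ M, inner ℝ b (z a) = if b = a then (1 : ℝ) else 0) :
    ∃ u ∈ (FinSub.span M).1, ∀ c ∈ M.image z, 0 < inner ℝ c u := by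
  refine ⟨∑ b ∈ M, b, sum_mem fun b hb => Submodule.subset_span hb, ?_⟩
  intro c hc
  obtain ⟨a, ha, rfl⟩ := Finset.mem_image.1 hc
  have : inner ℝ (z a) (∑ b ∈ M, b) = 1 := by
    rw [inner_sum]
    rw [Finset.sum_congr rfl fun b hb => by rw [real_inner_comm, hz a ha b hb]]
    rw [Finset.sum_ite_eq' M a, if_pos ha]
  rw [this]; exact one_pos

/-- The alternating sum over the faces is the expansion of a product over the coordinates, with
factor `[c = 0] - [c ≥ 0] = -[c > 0]` for each coordinate `c`. -/
theorem sum_powerset_ind_hull [DecidableEq E]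
    (hz : ∀ a ∈ M, ∀ b ∈ M, inner ℝ b (z a) = if b = a then (1 : ℝ) else 0) (x : E) :
    ∑ S ∈ M.powerset, (-1 : ℤ) ^ S.card * ind (PointedCone.hull ℝ (S : Set E) : Set E) x =
      (-1) ^ M.card * ind (intrinsicInterior ℝ (PointedCone.hull ℝ (M : Set E) : Set E)) x := by
  set p : E → ℤ := fun a => ind {y : E | 0 ≤ inner ℝ (z a) y} x
  set q : E → ℤ := fun a => ind {y : E | inner ℝ (z a) y = 0} x
  set r : E → ℤ := fun a => ind {y : E | 0 < inner ℝ (z a) y} x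
  set u : ℤ := ind (Submodule.span ℝ (M : Set E) : Set E) x
  have hprod : ∀ (S : Finset E) (Q : E → Set E),
      ∏ a ∈ S, ind (Q a) x = ind {y | ∀ a ∈ S, y ∈ Q a} x := by
    intro S Q
    classical
    simp only [ind, Set.mem_ofPred_eq]
    rw [Finset.prod_ite_zero]
    simp
  have h1 : ∀ S ∈ M.powerset,
      (-1 : ℤ) ^ S.card * ind (PointedCone.hull ℝ (S : Set E) : Set E) x =
        u * ((∏ a ∈ S, -p a) * ∏ a ∈ M \ S, q a) := by
    intro S hS
    have : ind (PointedCone.hull ℝ (S : Set E) : Set E) x =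
        u * ((∏ a ∈ S, p a) * ∏ a ∈ M \ S, q a) := by
      rw [hprod, hprod, ← ind_inter, ← ind_inter]
      exact ind_congr (mem_hull_iff_dual hz (Finset.mem_powerset.1 hS) x)
    rw [this, Finset.prod_neg]
    ring
  rw [Finset.sum_congr rfl h1, ← Finset.mul_sum, ← Finset.prod_add]
  have h2 : ∀ a ∈ M, -p a + q a = -r a := by
    intro a _
    simp only [p, q, r, ind, Set.mem_ofPred_eq]
    rcases lt_trichotomy (inner ℝ (z a) x) 0 with h | h | h
    · simp [h.ne, not_le.2 h, not_lt.2 h.le]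
    · simp [h]
    · simp [h, h.le, h.ne']
  rw [Finset.prod_congr rfl h2, Finset.prod_neg, hprod]
  have h3 : u * ind {y : E | ∀ a ∈ M, y ∈ {y : E | 0 < inner ℝ (z a) y}} x =
      ind (intrinsicInterior ℝ (PointedCone.hull ℝ (M : Set E) : Set E)) x := by
    rw [← ind_inter]
    refine ind_congr ?_
    rw [hull_eq_polyCone hz, mem_intrinsicInterior_polyCone (exists_pos_on_dual hz)]
    simp [FinSub.span]
  rw [← h3]
  ring

theorem dim_hull [DecidableEq E]
    (hz : ∀ a ∈ M, ∀ b ∈ M, inner ℝ b (z a) = if b = a then (1 : ℝ) else 0)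
    (hi : LinearIndepOn ℝ id (M : Set E)) :
    dim (PointedCone.hull ℝ (M : Set E) : Set E) = M.card := by
  rw [hull_eq_polyCone hz, dim_polyCone (exists_pos_on_dual hz)]
  exact finrank_span_finset_eq_card hi

end DualBasis

theorem toFun_negDilatation {V : FinSub E} (ξ : ConeGroup V) (x : E) :
    ValGroup.toFun _ (negDilatation V ξ) x = ValGroup.toFun _ ξ (-x) := by
  have : ((Pi.evalAddMonoidHom (fun _ : E => ℤ) x).comp
      (ValGroup.toFun (IsConeIn V))).comp (negDilatation V) =
      (Pi.evalAddMonoidHom (fun _ : E => ℤ) (-x)).comp (ValGroup.toFun (IsConeIn V)) := by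
    refine ValGroup.hom_ext fun P hP => ?_
    simp only [AddMonoidHom.comp_apply, Pi.evalAddMonoidHom_apply]
    rw [ValGroup.toFun_cls hP, cls_eq hP, negDilatation, ValGroup.lift_mk, ← cls_eq hP.neg,
      ValGroup.toFun_cls hP.neg]
    exact ind_congr Set.mem_neg
  exact DFunLike.congr_fun this ξ

/-- On a cone cut out by independent functionals, inclusion–exclusion writes the interior as an
alternating sum of cones with fewer inequalities. Their duals are, up to sign, the faces of the dual
cone, and the alternating sum of those faces is the interior of the dual by `sum_powerset_ind_hull`.
The reflection `Δ(-1)` appears because the expansion uses the reversed inequalities. -/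
theorem duality_coneInterior (V : FinSub E) (ξ : ConeGroup V) :
    duality V (coneInterior V ξ) =
      (-1 : ℤ) ^ V.dim • negDilatation V (coneInterior V (duality V ξ)) := by
  classical
  have : (duality V).comp (coneInterior V) = (-1 : ℤ) ^ V.dim •
      ((negDilatation V).comp ((coneInterior V).comp (duality V))) := by
    refine ConeGroup.hom_ext_polyCone fun L hL hi => ?_
    -- With `M = -L` the dual of the cone is the hull of `M`, and the interior is where every
    -- functional in `M` is negative.
    obtain ⟨M, hML⟩ : ∃ M : Finset E, M.image (fun a => -a) = L :=
      ⟨L.image fun a => -a, by rw [Finset.image_image]; simp⟩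
    have hM : ∀ a ∈ M, a ∈ V.1 := fun a ha => by
      have := hL (-a) (hML ▸ Finset.mem_image_of_mem _ ha)
      simpa using V.1.neg_mem this
    have hMi : LinearIndepOn ℝ id (M : Set E) := by
      rw [← hML, Finset.coe_image] at hi
      have h1 : LinearIndepOn ℝ (id ∘ fun a : E => -a) (M : Set E) :=
        hi.comp_of_image neg_injective.injOn
      have h2 := LinearIndependent.map' h1 (LinearEquiv.neg ℝ : E ≃ₗ[ℝ] E).toLinearMap
        (LinearEquiv.ker _)
      have h3 : ((LinearEquiv.neg ℝ : E ≃ₗ[ℝ] E).toLinearMap ∘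
          fun x : (M : Set E) => (id ∘ fun a : E => -a) x) = fun x : (M : Set E) => id (x : E) := by
        ext a
        simp
      rw [h3] at h2
      exact h2
    have hex : ∀ a, ∃ u : E, ∀ b ∈ M, inner ℝ b u = if b = a then (1 : ℝ) else 0 := fun a => by
      obtain ⟨u, -, h⟩ := exists_inner_eq_of_linearIndepOn hM hMi fun b => if b = a then 1 else 0
      exact ⟨u, h⟩
    choose z hz using hex
    have hz' : ∀ a ∈ M, ∀ b ∈ M, inner ℝ b (z a) = if b = a then (1 : ℝ) else 0 :=
      fun a _ b hb => hz a b hb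
    have hLpos : ∃ u ∈ V.1, ∀ a ∈ L, 0 < inner ℝ a u := by
      obtain ⟨u, hu, h⟩ := exists_inner_eq_of_linearIndepOn hL hi fun _ => 1
      exact ⟨u, hu, fun a ha => by rw [h a ha]; exact one_pos⟩
    have hC := isConvexCone_polyCone V L
    have hCV := polyCone_subset V L
    have hdualC : dualCone V (polyCone V L) = (PointedCone.hull ℝ (M : Set E) : Set E) := by
      rw [← hML, ← dualCone_hull, dualCone_dualCone (isConvexCone_hull M) (hull_subset hM)]
    have hdualS : ∀ S ∈ M.powerset, dualCone V (polyCone V S) =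
        (PointedCone.hull ℝ ((S.image fun a => -a : Finset E) : Set E) : Set E) := by
      intro S hS
      have : S = (S.image fun a => -a).image fun a => -a := by
        rw [Finset.image_image]; simp
      conv_lhs => rw [this]
      rw [← dualCone_hull, dualCone_dualCone (isConvexCone_hull _) (hull_subset ?_)]
      intro a ha
      obtain ⟨b, hb, rfl⟩ := Finset.mem_image.1 ha
      exact V.1.neg_mem (hM b (Finset.mem_powerset.1 hS hb))
    have hint : coneIntCls V (polyCone V L) =
        ∑ S ∈ M.powerset, (-1 : ℤ) ^ S.card • coneCls V (polyCone V S) := by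
      refine ValGroup.toFun_injective (isSetLattice_cone V) ?_
      rw [toFun_coneIntCls hC hCV, map_sum]
      ext x
      rw [Finset.sum_apply]
      have h1 : ∀ S ∈ M.powerset,
          ValGroup.toFun _ ((-1 : ℤ) ^ S.card • coneCls V (polyCone V S)) x =
          ind (V.1 : Set E) x * ((-1) ^ S.card * ∏ a ∈ S, ind {y : E | 0 ≤ inner ℝ a y} x) := by
        intro S _
        rw [map_zsmul, toFun_coneCls (isConeIn_polyCone _ _), Pi.smul_apply, ind_polyCone,
          smul_eq_mul]
        ring
      rw [Finset.sum_congr rfl h1, ← Finset.mul_sum, sum_powerset_eq_prod]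
      have h2 : ∏ a ∈ M, (1 - ind {y : E | 0 ≤ inner ℝ a y} x) =
          ind {y : E | ∀ a ∈ L, 0 < inner ℝ a y} x := by
        have : ∀ a ∈ M, 1 - ind {y : E | 0 ≤ inner ℝ a y} x =
            if inner ℝ a x < 0 then 1 else 0 := fun a _ => by
          by_cases h : inner ℝ a x < 0
          · simp [ind, h, not_le.2 h]
          · simp [ind, h, not_lt.1 h]
        rw [Finset.prod_congr rfl this, Finset.prod_ite_zero, ← hML]
        simp [ind, inner_neg_left]
      rw [h2, ← ind_inter]
      exact ind_congr (mem_intrinsicInterior_polyCone hLpos)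
    have hhull := isConvexCone_hull M
    have hhullV := hull_subset (V := V) hM
    refine ValGroup.toFun_injective (isSetLattice_cone V) ?_
    ext x
    simp only [AddMonoidHom.comp_apply, AddMonoidHom.smul_apply]
    rw [isConeInterior_coneInterior V _ hC hCV, isDuality_duality V _ hC hCV, hdualC,
      isConeInterior_coneInterior V _ hhull hhullV, hint, dim_polyCone hLpos, dim_hull hz' hMi]
    simp only [map_zsmul, map_sum, Pi.smul_apply, Finset.sum_apply, smul_eq_mul]
    rw [toFun_negDilatation, toFun_coneIntCls hhull hhullV, ← sum_powerset_ind_hull hz' (-x)]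
    congr 1
    refine Finset.sum_congr rfl fun S hS => ?_
    rw [isDuality_duality V _ (isConvexCone_polyCone V S) (polyCone_subset V S),
      toFun_coneCls ((isConvexCone_polyCone V S).dualCone.isConeIn (dualCone_subset V _)),
      hdualS S hS]
    congr 1
    exact ind_congr (mem_hull_image_neg S x)
  exact DFunLike.congr_fun this ξ

/-! ## Decomposition of a set into the interiors of cells -/

section Cells

variable {cell : Set E → Prop} {K : Finset (Set E)} {P : Set E} {V : FinSub E}

theorem IsCellStructure.subset (hK : IsCellStructure cell K P) {σ : Set E} (hσ : σ ∈ K) :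
    σ ⊆ P := by
  rw [hK.union]; exact Set.subset_biUnion_of_mem (u := id) hσ

/-- A point of a cell lies in the interior of a subcell. -/
theorem IsCellStructure.exists_mem_interior_subset (hK : IsCellStructure cell K P)
    (hpoly : ∀ σ ∈ K, ∃ L, σ = polyhedron V L) {τ : Set E} (hτ : τ ∈ K) {x : E} (hx : x ∈ τ) :
    ∃ σ ∈ K, σ ⊆ τ ∧ x ∈ intrinsicInterior ℝ σ := by
  classical
  -- A subcell through `x` of least dimension must have `x` in its relative interior: otherwise `x`
  -- lies on a proper face, and a cell of `K` inside this face has smaller dimension.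
  obtain ⟨σ, hσ, hmin⟩ := Finset.exists_min_image (K.filter fun σ => σ ⊆ τ ∧ x ∈ σ) dim
    ⟨τ, Finset.mem_filter.2 ⟨hτ, Set.Subset.rfl, hx⟩⟩
  rw [Finset.mem_filter] at hσ
  obtain ⟨hσK, hστ, hxσ⟩ := hσ
  refine ⟨σ, hσK, hστ, ?_⟩
  obtain ⟨L, hL⟩ := hpoly σ hσK
  by_contra hxi
  rw [hL, mem_intrinsicInterior_polyhedron, ← hL] at hxi
  push Not at hxi
  obtain ⟨p, hp, ⟨y, hy, hpy⟩, hpx⟩ := hxi hxσ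
  have hnn : ∀ y ∈ σ, 0 ≤ affFun p y := fun y hy => by
    rw [hL] at hy; exact hy.2 p hp
  have hpx0 : affFun p x = 0 := le_antisymm hpx (hnn x hxσ)
  -- The face where `affFun p` attains its minimum, which is `0` because it vanishes at `x`; the
  -- sign is changed since faces are defined by maxima.
  set F : Set E := {u | u ∈ σ ∧ ∀ v ∈ σ, (-innerₛₗ ℝ p.1) v ≤ (-innerₛₗ ℝ p.1) u} with hF
  have hmemF : ∀ u ∈ F, affFun p u = 0 := by
    rintro u ⟨hu, hmax⟩
    have h1 := hmax x hxσ
    have h2 := affFun_sub p u x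
    simp only [LinearMap.neg_apply, innerₛₗ_apply_apply] at h1
    rw [inner_sub_right, hpx0] at h2
    linarith [hnn u hu]
  have hxF : x ∈ F := ⟨hxσ, fun v hv => by
    have h2 := affFun_sub p v x
    rw [inner_sub_right, hpx0] at h2
    simp only [LinearMap.neg_apply, innerₛₗ_apply_apply]
    linarith [hnn v hv]⟩
  obtain ⟨M, hMK, hFM⟩ := hK.faces σ hσK F ⟨⟨x, hxF⟩, _, rfl⟩
  rw [hFM] at hxF
  obtain ⟨ρ, hρM, hxρ⟩ := Set.mem_iUnion₂.1 hxF
  have hρF : ρ ⊆ F := by rw [hFM]; exact Set.subset_biUnion_of_mem (u := id) hρM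
  have hρσ : ρ ⊆ σ := fun u hu => (hρF hu).1
  have h1 := hmin ρ (Finset.mem_filter.2 ⟨hMK hρM, hρσ.trans hστ, hxρ⟩)
  have hV : vectorSpan ℝ σ ≤ V.1 := by
    have : σ ⊆ V.1 := by rw [hL]; exact fun u hu => hu.1
    rw [← vectorSpan_submodule V.1]
    exact vectorSpan_mono ℝ this
  have : FiniteDimensional ℝ (vectorSpan ℝ σ) := Submodule.finiteDimensional_of_le hV
  refine absurd h1 (not_le.2 (Submodule.finrank_lt_finrank_of_lt
    (lt_of_le_of_ne (vectorSpan_mono ℝ hρσ) fun heq => ?_)))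
  have h2 : vectorSpan ℝ ρ ≤ LinearMap.ker (innerₛₗ ℝ p.1) := by
    rw [vectorSpan_def, Submodule.span_le]
    rintro _ ⟨u, hu, v, hv, rfl⟩
    have h3 := affFun_sub p u v
    rw [hmemF u (hρF hu), hmemF v (hρF hv), sub_zero] at h3
    simpa using h3.symm
  have h4 : y - x ∈ vectorSpan ℝ ρ := by
    rw [heq]; exact vsub_mem_vectorSpan ℝ hy hxσ
  have h5 : inner ℝ p.1 (y - x) = 0 := by simpa using h2 h4
  rw [← affFun_sub, hpx0, sub_zero] at h5
  exact hpy.ne' h5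

theorem IsCellStructure.subset_of_mem_interior (hK : IsCellStructure cell K P)
    (hpoly : ∀ σ ∈ K, ∃ L, σ = polyhedron V L) {σ τ : Set E} (hσ : σ ∈ K) (hτ : τ ∈ K) {x : E}
    (hx : x ∈ intrinsicInterior ℝ σ) (hxτ : x ∈ τ) : σ ⊆ τ := by
  obtain ⟨ρ, hρ, hρτ, hxρ⟩ := hK.exists_mem_interior_subset hpoly hτ hxτ
  rwa [hK.interiors σ hσ ρ hρ x hx hxρ]

/-- A function that is constant on the interiors of the cells and vanishes outside their union is
a linear combination of the indicator functions of the interiors. -/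
theorem IsCellStructure.eq_sum (hK : IsCellStructure cell K P)
    (hpoly : ∀ σ ∈ K, ∃ L, σ = polyhedron V L) {f : E → ℤ} {c : Set E → ℤ}
    (hf : ∀ σ ∈ K, ∀ x ∈ intrinsicInterior ℝ σ, f x = c σ) (hf0 : ∀ x ∉ P, f x = 0) :
    f = ∑ σ ∈ K, c σ • ind (intrinsicInterior ℝ σ) := by
  classical
  ext x
  rw [Finset.sum_apply]
  by_cases hx : x ∈ P
  · have hx' := hx
    rw [hK.union] at hx'
    obtain ⟨τ, hτ, hxτ⟩ := Set.mem_iUnion₂.1 hx'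
    obtain ⟨σ, hσ, -, hxσ⟩ := hK.exists_mem_interior_subset hpoly hτ hxτ
    rw [Finset.sum_eq_single_of_mem σ hσ, Pi.smul_apply, ind_of_mem hxσ, hf σ hσ x hxσ]
    · simp
    · intro ρ hρ hne
      rw [Pi.smul_apply, ind_of_notMem, smul_zero]
      exact fun h => hne (hK.interiors ρ hρ σ hσ x h hxσ)
  · rw [hf0 x hx, Finset.sum_eq_zero]
    intro ρ hρ
    rw [Pi.smul_apply, ind_of_notMem, smul_zero]
    exact fun h => hx (hK.subset hρ (intrinsicInterior_subset h))

theorem IsCellStructure.ind_eq_sum (hK : IsCellStructure cell K P)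
    (hpoly : ∀ σ ∈ K, ∃ L, σ = polyhedron V L) :
    ind P = ∑ σ ∈ K, ind (intrinsicInterior ℝ σ) := by
  rw [hK.eq_sum hpoly (f := ind P) (c := fun _ => 1)
    (fun σ hσ x hx => ind_of_mem (hK.subset hσ (intrinsicInterior_subset hx)))
    fun x hx => ind_of_notMem hx]
  simp

theorem IsConeCellStructure.polyhedra (hK : IsConeCellStructure K P) (hP : P ⊆ V.1) :
    ∀ σ ∈ K, ∃ L, σ = polyhedron V L := fun σ hσ =>
  (hK.cells σ hσ).exists_polyhedron ((IsCellStructure.subset hK hσ).trans hP)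

theorem IsPolyCellStructure.polyhedra (hK : IsPolyCellStructure K P) (hP : P ⊆ V.1) :
    ∀ σ ∈ K, ∃ L, σ = polyhedron V L := fun σ hσ =>
  (hK.cells σ hσ).exists_polyhedron ((IsCellStructure.subset hK hσ).trans hP)

theorem IsConeCellStructure.coneCls_eq_sum (hK : IsConeCellStructure K P) (hP : IsConeIn V P) :
    coneCls V P = ∑ σ ∈ K, coneIntCls V σ := by
  refine ValGroup.toFun_injective (isSetLattice_cone V) ?_
  rw [toFun_coneCls hP, map_sum, IsCellStructure.ind_eq_sum hK (hK.polyhedra hP.2)]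
  exact Finset.sum_congr rfl fun σ hσ => (toFun_coneIntCls (hK.cells σ hσ)
    ((IsCellStructure.subset hK hσ).trans hP.2)).symm

theorem IsConeCellStructure.eulerHom_eq_sum (hK : IsConeCellStructure K P) (hP : IsConeIn V P) :
    eulerHom V (coneCls V P) = ∑ σ ∈ K, (-1) ^ dim σ := by
  rw [hK.coneCls_eq_sum hP, map_sum]
  exact Finset.sum_congr rfl fun σ hσ => eulerHom_coneIntCls (hK.cells σ hσ)
    ((IsCellStructure.subset hK hσ).trans hP.2)

/-! ## Existence of cell structures -/

/-- The closed cell of `x` in the arrangement of the hyperplanes where the functions of `Λ`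
vanish. -/
def arrCell (V : FinSub E) (Λ : Finset (E × ℝ)) (x : E) : Set E :=
  {y | y ∈ V.1 ∧ ∀ p ∈ Λ, (0 ≤ affFun p x → 0 ≤ affFun p y) ∧ (affFun p x ≤ 0 → affFun p y ≤ 0)}

variable {Λ : Finset (E × ℝ)}

theorem affFun_neg (p : E × ℝ) (x : E) : affFun (-p) x = -affFun p x := by
  simp only [affFun, Prod.fst_neg, Prod.snd_neg, inner_neg_left]; ring

open Classical in
theorem arrCell_eq_polyhedron (V : FinSub E) (Λ : Finset (E × ℝ)) (x : E) :
    arrCell V Λ x = polyhedron V (Λ.filter (fun p => 0 ≤ affFun p x) ∪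
      (Λ.filter fun p => affFun p x ≤ 0).image fun p => -p) := by
  ext y
  simp only [arrCell, polyhedron, Set.mem_ofPred_eq, Finset.mem_union, Finset.mem_filter,
    or_imp, forall_and, Finset.forall_mem_image, affFun_neg, Left.nonneg_neg_iff, and_imp]

theorem mem_arrCell_self {x : E} (hx : x ∈ V.1) : x ∈ arrCell V Λ x :=
  ⟨hx, fun _ _ => ⟨id, id⟩⟩

theorem arrCell_subset_of_mem {x y : E} (hy : y ∈ arrCell V Λ x) :
    arrCell V Λ y ⊆ arrCell V Λ x := fun _ hu =>
  ⟨hu.1, fun p hp => ⟨fun h => (hu.2 p hp).1 ((hy.2 p hp).1 h),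
    fun h => (hu.2 p hp).2 ((hy.2 p hp).2 h)⟩⟩

theorem mem_interior_arrCell_self {x : E} (hx : x ∈ V.1) :
    x ∈ intrinsicInterior ℝ (arrCell V Λ x) := by
  classical
  have hself := mem_arrCell_self (Λ := Λ) hx
  rw [arrCell_eq_polyhedron, mem_intrinsicInterior_polyhedron, ← arrCell_eq_polyhedron]
  refine ⟨hself, fun q hq ⟨y, hy, hqy⟩ => ?_⟩
  rcases Finset.mem_union.1 hq with hq | hq
  · rw [Finset.mem_filter] at hq
    by_contra h
    exact absurd ((hy.2 q hq.1).2 (not_lt.1 h)) (not_le.2 hqy)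
  · obtain ⟨p, hp, rfl⟩ := Finset.mem_image.1 hq
    rw [Finset.mem_filter] at hp
    rw [affFun_neg] at hqy ⊢
    by_contra h
    have := (hy.2 p hp.1).1 (by linarith)
    linarith

/-- An inequality that is strict at `x` is strict throughout the relative interior of its cell, so
`x` satisfies every weak sign condition that holds at `y`. -/
theorem mem_arrCell_of_mem_interior {x y : E} (hx : x ∈ V.1)
    (hy : y ∈ intrinsicInterior ℝ (arrCell V Λ x)) : x ∈ arrCell V Λ y := by
  classical
  have hself := mem_arrCell_self (Λ := Λ) hx
  have hpos : ∀ q ∈ (Λ.filter (fun p => 0 ≤ affFun p x) ∪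
      (Λ.filter fun p => affFun p x ≤ 0).image fun p => -p), 0 < affFun q x → 0 < affFun q y := by
    rw [arrCell_eq_polyhedron, mem_intrinsicInterior_polyhedron, ← arrCell_eq_polyhedron] at hy
    exact fun q hq h => hy.2 q hq ⟨x, hself, h⟩
  refine ⟨hx, fun p hp => ⟨fun h => ?_, fun h => ?_⟩⟩
  · by_contra hneg
    have := hpos (-p) (Finset.mem_union_right _ (Finset.mem_image_of_mem _
      (Finset.mem_filter.2 ⟨hp, (not_le.1 hneg).le⟩))) (by rw [affFun_neg]; linarith)
    rw [affFun_neg] at this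
    linarith
  · by_contra hneg
    have := hpos p (Finset.mem_union_left _ (Finset.mem_filter.2 ⟨hp, (not_le.1 hneg).le⟩))
      (by linarith)
    linarith

theorem arrCell_eq_of_mem_interior {x y : E} (hx : x ∈ V.1)
    (hy : y ∈ intrinsicInterior ℝ (arrCell V Λ x)) : arrCell V Λ x = arrCell V Λ y :=
  Set.Subset.antisymm (arrCell_subset_of_mem (mem_arrCell_of_mem_interior hx hy))
    (arrCell_subset_of_mem (intrinsicInterior_subset hy))

theorem finite_arrCells (V : FinSub E) (Λ : Finset (E × ℝ)) (P : Set E) :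
    (arrCell V Λ '' P).Finite := by
  let g : (Λ → Prop × Prop) → Set E := fun s =>
    {y | y ∈ V.1 ∧ ∀ p : Λ, ((s p).1 → 0 ≤ affFun p.1 y) ∧ ((s p).2 → affFun p.1 y ≤ 0)}
  refine (Set.finite_range g).subset ?_
  rintro _ ⟨x, -, rfl⟩
  refine ⟨fun p => (0 ≤ affFun p.1 x, affFun p.1 x ≤ 0), ?_⟩
  ext y
  simp [g, arrCell]

/-- The cells are the arrangement cells of the points of `P`. A face is a union of cells because
each point `y` is in the relative interior of its own cell: a linear function whose maximum on this
cell is attained at `y` is constant on it, by prolonging segments beyond `y`. -/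
theorem exists_cellStructure (hP : P ⊆ V.1)
    (hcell : ∀ x ∈ P, cell (arrCell V Λ x) ∧ arrCell V Λ x ⊆ P) :
    ∃ K, IsCellStructure cell K P ∧ ∀ σ ∈ K, ∃ x ∈ P, σ = arrCell V Λ x := by
  classical
  have hfin := finite_arrCells V Λ P
  have hmem : ∀ σ, σ ∈ hfin.toFinset ↔ ∃ x ∈ P, arrCell V Λ x = σ := fun σ => by
    rw [Set.Finite.mem_toFinset]; rfl
  refine ⟨hfin.toFinset, ?_, fun σ hσ => ?_⟩
  · constructor
    · intro σ hσ
      obtain ⟨x, hx, rfl⟩ := (hmem σ).1 hσ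
      exact (hcell x hx).1
    · intro σ hσ F hF
      obtain ⟨x, hx, rfl⟩ := (hmem σ).1 hσ
      obtain ⟨-, l, rfl⟩ := hF
      refine ⟨hfin.toFinset.filter fun τ =>
        τ ⊆ {u | u ∈ arrCell V Λ x ∧ ∀ y ∈ arrCell V Λ x, l y ≤ l u},
        Finset.filter_subset _ _, ?_⟩
      refine Set.Subset.antisymm ?_ ?_
      · rintro y ⟨hy, hmax⟩
        refine Set.mem_iUnion₂.2 ⟨arrCell V Λ y, Finset.mem_filter.2
          ⟨(hmem _).2 ⟨y, (hcell x hx).2 hy, rfl⟩, fun u hu => ?_⟩, mem_arrCell_self hy.1⟩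
        have hsub := arrCell_subset_of_mem hy
        refine ⟨hsub hu, fun v hv => (hmax v hv).trans ?_⟩
        obtain ⟨ε, hε, h⟩ := exists_add_smul_mem_of_mem_intrinsicInterior
          (mem_interior_arrCell_self (Λ := Λ) hy.1) hu
        have := hmax _ (hsub h)
        rw [map_add, map_smul, map_sub, smul_eq_mul] at this
        by_contra hneg
        nlinarith [mul_pos hε (sub_pos.2 (not_le.1 hneg))]
      · exact Set.iUnion₂_subset fun τ hτ => (Finset.mem_filter.1 hτ).2
    · intro σ hσ τ hτ y hy hy'
      obtain ⟨x, hx, rfl⟩ := (hmem σ).1 hσ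
      obtain ⟨z, hz, rfl⟩ := (hmem τ).1 hτ
      rw [arrCell_eq_of_mem_interior (hP hx) hy, arrCell_eq_of_mem_interior (hP hz) hy']
    · refine Set.Subset.antisymm (fun x hx => ?_) (Set.iUnion₂_subset fun σ hσ => ?_)
      · exact Set.mem_iUnion₂.2 ⟨_, (hmem _).2 ⟨x, hx, rfl⟩, mem_arrCell_self (hP hx)⟩
      · obtain ⟨x, hx, rfl⟩ := (hmem σ).1 hσ
        exact (hcell x hx).2
  · obtain ⟨x, hx, h⟩ := (hmem σ).1 hσ
    exact ⟨x, hx, h.symm⟩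

theorem exists_coneCellStructure (hP : IsConeIn V P) : ∃ K, IsConeCellStructure K P ∧
    ∀ σ ∈ K, ∀ x ∈ σ, -x ∈ σ → x = 0 := by
  classical
  have hPV := hP.2
  obtain ⟨⟨C, hC, rfl⟩, -⟩ := hP
  choose! L hLV hL using fun c (hc : c ∈ C) => (hC c hc).exists_polyCone
    ((Set.subset_biUnion_of_mem (u := id) hc).trans hPV)
  -- Adding a spanning set of `V` to the functionals makes the cells line-free: if a cell contains
  -- `y` and `-y`, all these functionals vanish at `y`.
  obtain ⟨t, ht⟩ := (Submodule.fg_iff_finiteDimensional V.1).2 V.2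
  let Λ : Finset (E × ℝ) := (C.biUnion L ∪ t).image fun a => (a, 0)
  have hΛ : ∀ a ∈ C.biUnion L ∪ t, (a, (0 : ℝ)) ∈ Λ := fun a ha => Finset.mem_image_of_mem _ ha
  obtain ⟨K, hK, hKcell⟩ := exists_cellStructure (cell := IsConvexCone) (Λ := Λ) hPV (by
    intro x hx
    constructor
    · have : arrCell V Λ x = polyCone V
          ((C.biUnion L ∪ t).filter (fun a => 0 ≤ inner ℝ a x) ∪
          ((C.biUnion L ∪ t).filter fun a => inner ℝ a x ≤ 0).image fun a => -a) := by
        ext y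
        simp only [arrCell, polyCone, Λ, Set.mem_ofPred_eq, Finset.mem_union (s := Finset.filter _ _),
          Finset.mem_filter, or_imp, forall_and, Finset.forall_mem_image, affFun, add_zero,
          inner_neg_left, Left.nonneg_neg_iff, and_imp]
      rw [this]
      exact isConvexCone_polyCone _ _
    · obtain ⟨c, hc, hxc⟩ := Set.mem_iUnion₂.1 hx
      refine Set.Subset.trans ?_ (Set.subset_biUnion_of_mem (u := id) hc)
      intro y hy
      rw [hL c hc] at hxc
      show y ∈ c
      rw [hL c hc]
      refine ⟨hy.1, fun a ha => ?_⟩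
      have := (hy.2 (a, 0) (hΛ a (Finset.mem_union_left _ (Finset.mem_biUnion.2 ⟨c, hc, ha⟩)))).1
        (by simpa [affFun] using hxc.2 a ha)
      simpa [affFun] using this)
  refine ⟨K, hK, fun σ hσ y hy hy' => ?_⟩
  obtain ⟨x, hx, rfl⟩ := hKcell σ hσ
  have h0 : ∀ b ∈ t, inner ℝ b y = 0 := by
    intro b hb
    have h1 := hy.2 (b, 0) (hΛ b (Finset.mem_union_right _ hb))
    have h2 := hy'.2 (b, 0) (hΛ b (Finset.mem_union_right _ hb))
    simp only [affFun, add_zero, inner_neg_right, Left.nonneg_neg_iff, Left.neg_nonpos_iff]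
      at h1 h2
    rcases le_total 0 (inner ℝ b x) with h | h
    · exact le_antisymm (h2.1 h) (h1.1 h)
    · exact le_antisymm (h1.2 h) (h2.2 h)
  have h3 : V.1 ≤ LinearMap.ker (innerₛₗ ℝ y) := by
    rw [← ht, Submodule.span_le]
    intro b hb
    simpa [real_inner_comm] using h0 b hb
  have h4 : inner ℝ y y = 0 := by simpa using h3 hy.1
  exact inner_self_eq_zero.1 h4

theorem exists_polyCellStructure (hP : IsPolytopeIn V P) : ∃ K, IsPolyCellStructure K P := by
  classical
  have hPV := hP.2
  obtain ⟨⟨C, hC, rfl⟩, -⟩ := hP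
  have hCV : ∀ c ∈ C, c ⊆ V.1 := fun c hc =>
    (Set.subset_biUnion_of_mem (u := id) hc).trans hPV
  choose! L hL using fun c (hc : c ∈ C) => (hC c hc).exists_polyhedron (hCV c hc)
  obtain ⟨K, hK, -⟩ := exists_cellStructure (cell := IsConvexPolytope) (Λ := C.biUnion L) hPV (by
    intro x hx
    obtain ⟨c, hc, hxc⟩ := Set.mem_iUnion₂.1 hx
    have hsub : arrCell V (C.biUnion L) x ⊆ c := by
      intro y hy
      rw [hL c hc] at hxc ⊢
      exact ⟨hy.1, fun p hp => (hy.2 p (Finset.mem_biUnion.2 ⟨c, hc, hp⟩)).1 (hxc.2 p hp)⟩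
    refine ⟨?_, hsub.trans (Set.subset_biUnion_of_mem (u := id) hc)⟩
    have e : arrCell V (C.biUnion L) x = c ∩ arrCell V (C.biUnion L) x :=
      (Set.inter_eq_self_of_subset_right hsub).symm
    have hmem : x ∈ arrCell V (C.biUnion L) x := mem_arrCell_self (hPV hx)
    rw [arrCell_eq_polyhedron] at e hmem ⊢
    rw [e] at hmem ⊢
    rcases (hC c hc).inter_polyhedron V (hCV c hc) _ with h | h
    · rw [h] at hmem; exact hmem.elim
    · exact h)
  exact ⟨K, hK⟩

/-! ## The local Euler invariant -/

/-- The Euler number of `P` is the sum of `(-1)^dim σ` over the cells. The cell `{0}` contributes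
`1`, and every other cell contributes minus the sign of its intersection with the sphere, which has
one dimension less. -/
theorem isLocalEuler_eulerHom (V : FinSub E) : IsLocalEuler V (eulerHom V) := by
  classical
  intro P hP hne K hK hline
  rw [hK.eulerHom_eq_sum hP]
  have hcV : ∀ σ ∈ K, σ ⊆ V.1 := fun σ hσ => (IsCellStructure.subset hK hσ).trans hP.2
  -- The origin is in the relative interior of some cell, and a line-free cone with the origin in
  -- its relative interior is `{0}`.
  have h0K : ({0} : Set E) ∈ K := by
    obtain ⟨x, hx⟩ := hne
    rw [hK.union] at hx
    obtain ⟨τ, hτ, -⟩ := Set.mem_iUnion₂.1 hx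
    obtain ⟨σ, hσ, -, h0σ⟩ := IsCellStructure.exists_mem_interior_subset hK (hK.polyhedra hP.2) hτ
      (hK.cells τ hτ).zero_mem
    have : σ = {0} := by
      refine Set.Subset.antisymm (fun y hy => ?_)
        (Set.singleton_subset_iff.2 (hK.cells σ hσ).zero_mem)
      obtain ⟨ε, hε, h⟩ := exists_add_smul_mem_of_mem_intrinsicInterior h0σ hy
      refine hline σ hσ y hy ?_
      obtain ⟨s, rfl⟩ := hK.cells σ hσ
      rw [zero_add, zero_sub] at h
      exact (PointedCone.smul_mem_iff _ hε).1 h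
    rwa [this] at hσ
  -- The truncated subtraction is a true one, since only `{0}` has dimension zero.
  have hdim : ∀ σ ∈ K, σ ≠ {0} → (-1 : ℤ) ^ dim σ = -(-1) ^ (dim σ - 1) := by
    intro σ hσ hne
    have hpos : dim σ ≠ 0 := fun h => hne (by
      have hV : vectorSpan ℝ σ ≤ V.1 := by
        rw [← vectorSpan_submodule V.1]; exact vectorSpan_mono ℝ (hcV σ hσ)
      have : FiniteDimensional ℝ (vectorSpan ℝ σ) := Submodule.finiteDimensional_of_le hV
      have h1 : vectorSpan ℝ σ = ⊥ := Submodule.finrank_eq_zero.1 h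
      refine Set.Subset.antisymm (fun y hy => ?_)
        (Set.singleton_subset_iff.2 (hK.cells σ hσ).zero_mem)
      have h2 := vsub_mem_vectorSpan ℝ hy (hK.cells σ hσ).zero_mem
      rw [h1] at h2
      simpa using h2)
    obtain ⟨n, hn⟩ := Nat.exists_eq_succ_of_ne_zero hpos
    rw [hn, Nat.succ_sub_one, pow_succ]; ring
  rw [← Finset.add_sum_erase K _ h0K, linkEuler, sub_eq_add_neg, ← Finset.sum_neg_distrib]
  congr 1
  · rw [dim, vectorSpan_singleton, finrank_bot, pow_zero]
  · rw [← Finset.filter_ne' K ({0} : Set E)]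
    exact Finset.sum_congr rfl fun σ hσ =>
      hdim σ (Finset.mem_filter.1 hσ).1 (Finset.mem_filter.1 hσ).2

theorem IsLocalEuler.unique {e e' : ConeGroup V →+ ℤ} (h : IsLocalEuler V e)
    (h' : IsLocalEuler V e') : e = e' :=
  ConeGroup.hom_ext fun P hP hV => by
    obtain ⟨K, hK, hline⟩ := exists_coneCellStructure (hP.isConeIn hV)
    rw [h P (hP.isConeIn hV) hP.nonempty K hK hline, h' P (hP.isConeIn hV) hP.nonempty K hK hline]

theorem isLocalEuler_localEuler (V : FinSub E) : IsLocalEuler V (localEuler V) :=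
  Classical.epsilon_spec ⟨_, isLocalEuler_eulerHom V⟩

theorem localEuler_eq (V : FinSub E) : localEuler V = eulerHom V :=
  (isLocalEuler_localEuler V).unique (isLocalEuler_eulerHom V)

end Cells

/-! ## Orthogonal sums of sets -/

section Orthogonal

variable {V W : FinSub E}

theorem add_eq_add_iff_of_isOrtho (h : V.1 ⟂ W.1) {v v' w w' : E} (hv : v ∈ V.1) (hv' : v' ∈ V.1)
    (hw : w ∈ W.1) (hw' : w' ∈ W.1) : v + w = v' + w' ↔ v = v' ∧ w = w' := by
  refine ⟨fun e => ?_, fun ⟨h1, h2⟩ => by rw [h1, h2]⟩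
  have e1 : v - v' = w' - w := by rw [sub_eq_sub_iff_add_eq_add, e, add_comm]
  have h0 : v - v' ∈ V.1 ⊓ W.1 := ⟨sub_mem hv hv', e1 ▸ sub_mem hw' hw⟩
  rw [h.disjoint.eq_bot, Submodule.mem_bot] at h0
  refine ⟨sub_eq_zero.1 h0, ?_⟩
  rw [h0] at e1
  exact (sub_eq_zero.1 e1.symm).symm

theorem add_mem_add_iff_of_isOrtho (h : V.1 ⟂ W.1) {P Q : Set E} (hP : P ⊆ V.1) (hQ : Q ⊆ W.1)
    {v w : E} (hv : v ∈ V.1) (hw : w ∈ W.1) : v + w ∈ P + Q ↔ v ∈ P ∧ w ∈ Q := by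
  constructor
  · rintro ⟨p, hp, q, hq, e⟩
    obtain ⟨rfl, rfl⟩ := (add_eq_add_iff_of_isOrtho h (hP hp) hv (hQ hq) hw).1 e
    exact ⟨hp, hq⟩
  · rintro ⟨hp, hq⟩
    exact Set.add_mem_add hp hq

theorem FinSub.coe_prod (V W : FinSub E) : ((V.prod W).1 : Set E) = (V.1 : Set E) + W.1 :=
  Submodule.coe_sup _ _

theorem add_subset_prod {P Q : Set E} (hP : P ⊆ V.1) (hQ : Q ⊆ W.1) : P + Q ⊆ (V.prod W).1 := by
  rw [FinSub.coe_prod]; exact Set.add_subset_add hP hQ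

theorem inter_add_of_isOrtho (h : V.1 ⟂ W.1) {P P' Q : Set E} (hP : P ⊆ V.1) (hP' : P' ⊆ V.1)
    (hQ : Q ⊆ W.1) : (P ∩ P') + Q = (P + Q) ∩ (P' + Q) := by
  refine Set.Subset.antisymm Set.inter_add_subset ?_
  rintro _ ⟨⟨p, hp, q, hq, rfl⟩, hx⟩
  exact Set.add_mem_add ⟨hp, ((add_mem_add_iff_of_isOrtho h hP' hQ (hP hp) (hQ hq)).1 hx).1⟩ hq

theorem add_inter_of_isOrtho (h : V.1 ⟂ W.1) {P Q Q' : Set E} (hP : P ⊆ V.1) (hQ : Q ⊆ W.1)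
    (hQ' : Q' ⊆ W.1) : P + (Q ∩ Q') = (P + Q) ∩ (P + Q') := by
  simp only [add_comm P]
  exact inter_add_of_isOrtho h.symm hQ hQ' hP

theorem ind_add_of_isOrtho (h : V.1 ⟂ W.1) {P Q : Set E} (hP : P ⊆ V.1) (hQ : Q ⊆ W.1)
    {v w : E} (hv : v ∈ V.1) (hw : w ∈ W.1) : ind (P + Q) (v + w) = ind P v * ind Q w := by
  by_cases h1 : v ∈ P <;> by_cases h2 : w ∈ Q <;>
    simp [ind, add_mem_add_iff_of_isOrtho h hP hQ hv hw, h1, h2]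

theorem FinSub.dim_prod (h : V.1 ⟂ W.1) : (V.prod W).dim = V.dim + W.dim := by
  have := Submodule.finrank_sup_add_finrank_inf_eq V.1 W.1
  rw [h.disjoint.eq_bot, finrank_bot, add_zero] at this
  exact this

theorem vectorSpan_add {P Q : Set E} (hP : P.Nonempty) (hQ : Q.Nonempty) :
    vectorSpan ℝ (P + Q) = vectorSpan ℝ P ⊔ vectorSpan ℝ Q := by
  refine le_antisymm ?_ (sup_le ?_ ?_)
  · rw [vectorSpan, Submodule.span_le]
    rintro _ ⟨_, ⟨p, hp, q, hq, rfl⟩, _, ⟨p', hp', q', hq', rfl⟩, rfl⟩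
    change p + q - (p' + q') ∈ _
    rw [add_sub_add_comm]
    exact add_mem (Submodule.mem_sup_left (vsub_mem_vectorSpan ℝ hp hp'))
      (Submodule.mem_sup_right (vsub_mem_vectorSpan ℝ hq hq'))
  · obtain ⟨q, hq⟩ := hQ
    rw [vectorSpan, Submodule.span_le]
    rintro _ ⟨p, hp, p', hp', rfl⟩
    have := vsub_mem_vectorSpan ℝ (Set.add_mem_add hp hq) (Set.add_mem_add hp' hq)
    simpa using this
  · obtain ⟨p, hp⟩ := hP
    rw [vectorSpan, Submodule.span_le]
    rintro _ ⟨q, hq, q', hq', rfl⟩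
    have := vsub_mem_vectorSpan ℝ (Set.add_mem_add hp hq) (Set.add_mem_add hp hq')
    simpa using this

theorem vectorSpan_le_of_subset {P : Set E} (hP : P ⊆ V.1) : vectorSpan ℝ P ≤ V.1 := by
  rw [← vectorSpan_submodule V.1]; exact vectorSpan_mono ℝ hP

theorem dim_add_of_isOrtho (h : V.1 ⟂ W.1) {P Q : Set E} (hP : P ⊆ V.1) (hQ : Q ⊆ W.1)
    (hP0 : P.Nonempty) (hQ0 : Q.Nonempty) : dim (P + Q) = dim P + dim Q := by
  have hPV := vectorSpan_le_of_subset hP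
  have hQW := vectorSpan_le_of_subset hQ
  have := Submodule.finiteDimensional_of_le hPV
  have := Submodule.finiteDimensional_of_le hQW
  have hs := Submodule.finrank_sup_add_finrank_inf_eq (vectorSpan ℝ P) (vectorSpan ℝ Q)
  rw [(h.disjoint.mono hPV hQW).eq_bot, finrank_bot, add_zero] at hs
  rw [dim, vectorSpan_add hP0 hQ0, hs, dim, dim]

/-- A point from which one may prolong segments a little stays so for shorter prolongations. -/
theorem add_smul_sub_mem_of_le {P : Set E} (hP : Convex ℝ P) {v p : E} (hv : v ∈ P) {ε δ : ℝ}
    (hδ : 0 ≤ δ) (hδε : δ ≤ ε) (h : v + ε • (v - p) ∈ P) : v + δ • (v - p) ∈ P := by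
  rcases hδ.eq_or_lt with rfl | hδ
  · simpa using hv
  have hε := hδ.trans_le hδε
  have := hP.add_smul_sub_mem hv h (t := δ / ε) ⟨by positivity, (div_le_one hε).2 hδε⟩
  rwa [add_sub_cancel_left, smul_smul, div_mul_cancel₀ _ hε.ne'] at this

/-- By the prolongation criterion applied to each component; two admissible lengths are replaced by
their minimum, which convexity allows. -/
theorem intrinsicInterior_add_of_isOrtho (h : V.1 ⟂ W.1) {P Q : Set E}
    {L M N : Finset (E × ℝ)} (hP : P = polyhedron V L) (hQ : Q = polyhedron W M)
    (hPQ : P + Q = polyhedron (V.prod W) N) :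
    intrinsicInterior ℝ (P + Q) = intrinsicInterior ℝ P + intrinsicInterior ℝ Q := by
  have hPV : P ⊆ V.1 := by rw [hP]; exact fun x hx => hx.1
  have hQW : Q ⊆ W.1 := by rw [hQ]; exact fun x hx => hx.1
  have hPc : Convex ℝ P := hP ▸ convex_polyhedron V L
  have hQc : Convex ℝ Q := hQ ▸ convex_polyhedron W M
  have key : ∀ {v w p q : E} {ε : ℝ}, v ∈ P → w ∈ Q → p ∈ P → q ∈ Q →
      (v + w + ε • (v + w - (p + q)) ∈ P + Q ↔ v + ε • (v - p) ∈ P ∧ w + ε • (w - q) ∈ Q) := by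
    intro v w p q ε hv hw hp hq
    rw [show v + w + ε • (v + w - (p + q)) = (v + ε • (v - p)) + (w + ε • (w - q)) by module]
    exact add_mem_add_iff_of_isOrtho h hPV hQW
      (add_mem (hPV hv) (Submodule.smul_mem _ _ (sub_mem (hPV hv) (hPV hp))))
      (add_mem (hQW hw) (Submodule.smul_mem _ _ (sub_mem (hQW hw) (hQW hq))))
  ext x
  rw [mem_intrinsicInterior_iff_forall hPQ, Set.mem_add]
  constructor
  · rintro ⟨⟨v, hv, w, hw, rfl⟩, hx⟩
    refine ⟨v, (mem_intrinsicInterior_iff_forall hP).2 ⟨hv, fun p hp => ?_⟩, w,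
      (mem_intrinsicInterior_iff_forall hQ).2 ⟨hw, fun q hq => ?_⟩, rfl⟩
    · obtain ⟨ε, hε, h1⟩ := hx _ (Set.add_mem_add hp hw)
      exact ⟨ε, hε, ((key hv hw hp hw).1 h1).1⟩
    · obtain ⟨ε, hε, h1⟩ := hx _ (Set.add_mem_add hv hq)
      exact ⟨ε, hε, ((key hv hw hv hq).1 h1).2⟩
  · rintro ⟨v, hv, w, hw, rfl⟩
    obtain ⟨hv, hv'⟩ := (mem_intrinsicInterior_iff_forall hP).1 hv
    obtain ⟨hw, hw'⟩ := (mem_intrinsicInterior_iff_forall hQ).1 hw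
    refine ⟨Set.add_mem_add hv hw, ?_⟩
    rintro _ ⟨p, hp, q, hq, rfl⟩
    obtain ⟨ε, hε, h1⟩ := hv' p hp
    obtain ⟨δ, hδ, h2⟩ := hw' q hq
    exact ⟨min ε δ, lt_min hε hδ, (key hv hw hp hq).2
      ⟨add_smul_sub_mem_of_le hPc hv (lt_min hε hδ).le (min_le_left _ _) h1,
        add_smul_sub_mem_of_le hQc hw (lt_min hε hδ).le (min_le_right _ _) h2⟩⟩

theorem IsConvexCone.add {P Q : Set E} (hP : IsConvexCone P) (hQ : IsConvexCone Q) :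
    IsConvexCone (P + Q) := by
  classical
  obtain ⟨s, rfl⟩ := hP
  obtain ⟨t, rfl⟩ := hQ
  refine ⟨s ∪ t, ?_⟩
  rw [Finset.coe_union]
  ext x
  have : PointedCone.hull ℝ ((s : Set E) ∪ t) = PointedCone.hull ℝ (s : Set E) ⊔ PointedCone.hull ℝ t :=
    Submodule.span_union _ _
  simp only [this, Set.mem_add, SetLike.mem_coe, Submodule.mem_sup]

theorem IsConvexPolytope.add {P Q : Set E} (hP : IsConvexPolytope P) (hQ : IsConvexPolytope Q) :
    IsConvexPolytope (P + Q) := by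
  classical
  obtain ⟨s, hs, rfl⟩ := hP
  obtain ⟨t, ht, rfl⟩ := hQ
  exact ⟨s + t, hs.add ht, by rw [Finset.coe_add, convexHull_add]⟩

theorem IsUnionOf.add {E : Type*} [Add E] {piece : Set E → Prop}
    (h : ∀ c d, piece c → piece d → piece (c + d)) {P Q : Set E} (hP : IsUnionOf piece P)
    (hQ : IsUnionOf piece Q) : IsUnionOf piece (P + Q) := by
  obtain ⟨C, hC, rfl⟩ := hP
  obtain ⟨D, hD, rfl⟩ := hQ
  have : (⋃ c ∈ C, c) + (⋃ d ∈ D, d) = ⋃ c ∈ C, ⋃ d ∈ D, c + d := by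
    ext x
    simp only [Set.mem_add, Set.mem_iUnion]
    constructor
    · rintro ⟨p, ⟨c, hc, hp⟩, q, ⟨d, hd, hq⟩, rfl⟩
      exact ⟨c, hc, d, hd, p, hp, q, hq, rfl⟩
    · rintro ⟨c, hc, d, hd, p, hp, q, hq, rfl⟩
      exact ⟨p, ⟨c, hc, hp⟩, q, ⟨d, hd, hq⟩, rfl⟩
  rw [this]
  exact IsUnionOf.biUnion _ _ fun c hc => IsUnionOf.biUnion _ _ fun d hd =>
    IsUnionOf.of_piece (h c d (hC c hc) (hD d hd))

theorem IsConeIn.add {P Q : Set E} (hP : IsConeIn V P) (hQ : IsConeIn W Q) :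
    IsConeIn (V.prod W) (P + Q) :=
  ⟨IsUnionOf.add (fun _ _ => IsConvexCone.add) hP.1 hQ.1, add_subset_prod hP.2 hQ.2⟩

theorem IsPolytopeIn.add {P Q : Set E} (hP : IsPolytopeIn V P) (hQ : IsPolytopeIn W Q) :
    IsPolytopeIn (V.prod W) (P + Q) :=
  ⟨IsUnionOf.add (fun _ _ => IsConvexPolytope.add) hP.1 hQ.1, add_subset_prod hP.2 hQ.2⟩

/-! ## Cross products -/

theorem toFun_eq_zero_of_notMem {A : Set E → Prop} (hA : ∀ P, A P → P ⊆ V.1) (ξ : ValGroup A) {x : E}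
    (hx : x ∉ V.1) : ValGroup.toFun A ξ x = 0 := by
  have : (Pi.evalAddMonoidHom (fun _ : E => ℤ) x).comp (ValGroup.toFun A) = 0 :=
    ValGroup.hom_ext fun P hP => by
      simpa [ValGroup.toFun_cls hP] using ind_of_notMem fun h => hx (hA P hP h)
  exact DFunLike.congr_fun this ξ

/-- Sums of sets always distribute over unions; orthogonality is what makes them distribute over
intersections. -/
theorem exists_cross {A B C : Set E → Prop} (h : V.1 ⟂ W.1) (hA : ∀ P, A P → P ⊆ V.1)
    (hB : ∀ P, B P → P ⊆ W.1) (hC : ∀ P Q, A P → B Q → C (P + Q)) :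
    ∃ X : ValGroup A →+ ValGroup B →+ ValGroup C, ∀ P Q, A P → B Q →
      X (cls A P) (cls B Q) = cls C (P + Q) := by
  have hv := ValGroup.isValuation_mk C
  let X₁ (P : {S // A S}) : ValGroup B →+ ValGroup C :=
    ValGroup.lift (fun Q => ValGroup.mk ⟨P.1 + Q.1, hC _ _ P.2 Q.2⟩)
      { empty := fun Q hQ => hv.empty _ (by simp [hQ])
        union := fun Q Q' R S hR hS => hv.union _ _ _ _ (by simp [hR, Set.add_union])
          (by simp only [hS]
              exact add_inter_of_isOrtho h (hA _ P.2) (hB _ Q.2) (hB _ Q'.2)) }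
  have hX₁ : ∀ (P : {S // A S}) (Q : {S // B S}), X₁ P (cls B Q.1) = ValGroup.mk ⟨P.1 + Q.1, hC _ _ P.2 Q.2⟩ := fun P Q => by
    rw [cls_eq Q.2, ValGroup.lift_mk]
  let X : ValGroup A →+ ValGroup B →+ ValGroup C := ValGroup.lift X₁
    { empty := fun P hP => ValGroup.hom_ext fun Q hQ => by
        rw [hX₁ P ⟨Q, hQ⟩, AddMonoidHom.zero_apply]
        exact hv.empty _ (by simp [hP])
      union := fun P P' R S hR hS => ValGroup.hom_ext fun Q hQ => by
        rw [AddMonoidHom.sub_apply, AddMonoidHom.add_apply, hX₁ P ⟨Q, hQ⟩, hX₁ P' ⟨Q, hQ⟩,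
          hX₁ R ⟨Q, hQ⟩, hX₁ S ⟨Q, hQ⟩]
        exact hv.union _ _ _ _ (by simp [hR, Set.union_add])
          (by simp only [hS]
              exact inter_add_of_isOrtho h (hA _ P.2) (hA _ P'.2) (hB _ hQ)) }
  refine ⟨X, fun P Q hP hQ => ?_⟩
  rw [cls_eq hP, ValGroup.lift_mk, hX₁ _ ⟨Q, hQ⟩, cls_eq (hC _ _ hP hQ)]

/-- Bilinear maps on valuation groups agree if they agree on generators. -/
theorem ValGroup.hom_ext₂ {E : Type*} {A B : Set E → Prop} {M : Type*} [AddCommGroup M]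
    {f g : ValGroup A →+ ValGroup B →+ M}
    (h : ∀ P Q, A P → B Q → f (cls A P) (cls B Q) = g (cls A P) (cls B Q)) (ξ : ValGroup A)
    (η : ValGroup B) : f ξ η = g ξ η := by
  have : f = g := ValGroup.hom_ext fun P hP => ValGroup.hom_ext fun Q hQ => h P Q hP hQ
  rw [this]

/-- The product in a ring of two homomorphisms, as a bilinear map. -/
def mulHom₂ {A B R : Type*} [AddCommGroup A] [AddCommGroup B] [NonUnitalNonAssocRing R]
    (f : A →+ R) (g : B →+ R) : A →+ B →+ R :=
  (AddMonoidHom.mul.comp f).compr₂ (AddMonoidHom.id R) |>.compl₂ g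

@[simp] theorem mulHom₂_apply {A B R : Type*} [AddCommGroup A] [AddCommGroup B]
    [NonUnitalNonAssocRing R] (f : A →+ R) (g : B →+ R) (a : A) (b : B) :
    mulHom₂ f g a b = f a * g b := rfl

theorem toFun_cross {A B C : Set E → Prop} (h : V.1 ⟂ W.1) (hA : ∀ P, A P → P ⊆ V.1)
    (hB : ∀ P, B P → P ⊆ W.1) (hC : ∀ P Q, A P → B Q → C (P + Q))
    {X : ValGroup A →+ ValGroup B →+ ValGroup C}
    (hX : ∀ P Q, A P → B Q → X (cls A P) (cls B Q) = cls C (P + Q)) (ξ : ValGroup A)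
    (η : ValGroup B) {v w : E} (hv : v ∈ V.1) (hw : w ∈ W.1) :
    ValGroup.toFun C (X ξ η) (v + w) = ValGroup.toFun A ξ v * ValGroup.toFun B η w := by
  let ev (x : E) := Pi.evalAddMonoidHom (fun _ : E => ℤ) x
  refine ValGroup.hom_ext₂ (f := X.compr₂ ((ev (v + w)).comp (ValGroup.toFun C)))
    (g := mulHom₂ ((ev v).comp (ValGroup.toFun A)) ((ev w).comp (ValGroup.toFun B)))
    (fun P Q hP hQ => ?_) ξ η
  simp only [AddMonoidHom.compr₂_apply, AddMonoidHom.comp_apply, mulHom₂_apply, hX P Q hP hQ,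
    ValGroup.toFun_cls hP, ValGroup.toFun_cls hQ, ValGroup.toFun_cls (hC P Q hP hQ)]
  exact ind_add_of_isOrtho h (hA P hP) (hB Q hQ) hv hw

theorem exists_coneCross (h : V.1 ⟂ W.1) :
    ∃ X : ConeGroup V →+ ConeGroup W →+ ConeGroup (V.prod W), ∀ P Q, IsConeIn V P → IsConeIn W Q →
      X (coneCls V P) (coneCls W Q) = coneCls (V.prod W) (P + Q) :=
  exists_cross h (fun _ h => h.2) (fun _ h => h.2) fun _ _ => IsConeIn.add

theorem exists_polyCross (h : V.1 ⟂ W.1) :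
    ∃ X : PolyGroup V →+ PolyGroup W →+ PolyGroup (V.prod W), ∀ P Q, IsPolytopeIn V P →
      IsPolytopeIn W Q → X (polyCls V P) (polyCls W Q) = polyCls (V.prod W) (P + Q) :=
  exists_cross h (fun _ h => h.2) (fun _ h => h.2) fun _ _ => IsPolytopeIn.add

/-- The cross product `Σ(V) × Σ(W) → Σ(V × W)`. -/
def coneCross (h : V.1 ⟂ W.1) : ConeGroup V →+ ConeGroup W →+ ConeGroup (V.prod W) :=
  (exists_coneCross h).choose

theorem coneCross_cls (h : V.1 ⟂ W.1) {P Q : Set E} (hP : IsConeIn V P) (hQ : IsConeIn W Q) :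
    coneCross h (coneCls V P) (coneCls W Q) = coneCls (V.prod W) (P + Q) :=
  (exists_coneCross h).choose_spec P Q hP hQ

/-- The cross product `𝒫(V) × 𝒫(W) → 𝒫(V × W)`. -/
def polyCross (h : V.1 ⟂ W.1) : PolyGroup V →+ PolyGroup W →+ PolyGroup (V.prod W) :=
  (exists_polyCross h).choose

theorem polyCross_cls (h : V.1 ⟂ W.1) {P Q : Set E} (hP : IsPolytopeIn V P)
    (hQ : IsPolytopeIn W Q) :
    polyCross h (polyCls V P) (polyCls W Q) = polyCls (V.prod W) (P + Q) :=
  (exists_polyCross h).choose_spec P Q hP hQ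

theorem toFun_coneCross (h : V.1 ⟂ W.1) (ξ : ConeGroup V) (η : ConeGroup W) {v w : E}
    (hv : v ∈ V.1) (hw : w ∈ W.1) : ValGroup.toFun (IsConeIn (V.prod W)) (coneCross h ξ η) (v + w) =
      ValGroup.toFun (IsConeIn V) ξ v * ValGroup.toFun (IsConeIn W) η w :=
  toFun_cross h (fun _ h => h.2) (fun _ h => h.2) (fun _ _ => IsConeIn.add)
    (fun _ _ => coneCross_cls h) ξ η hv hw

theorem toFun_polyCross (h : V.1 ⟂ W.1) (ξ : PolyGroup V) (η : PolyGroup W) {v w : E}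
    (hv : v ∈ V.1) (hw : w ∈ W.1) :
    ValGroup.toFun (IsPolytopeIn (V.prod W)) (polyCross h ξ η) (v + w) =
      ValGroup.toFun (IsPolytopeIn V) ξ v * ValGroup.toFun (IsPolytopeIn W) η w :=
  toFun_cross h (fun _ h => h.2) (fun _ h => h.2) (fun _ _ => IsPolytopeIn.add)
    (fun _ _ => polyCross_cls h) ξ η hv hw

theorem coneCross_intCls (h : V.1 ⟂ W.1) {P Q : Set E} (hP : IsConvexCone P) (hPV : P ⊆ V.1)
    (hQ : IsConvexCone Q) (hQW : Q ⊆ W.1) :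
    coneCross h (coneIntCls V P) (coneIntCls W Q) = coneIntCls (V.prod W) (P + Q) := by
  have hPQ := add_subset_prod hPV hQW
  obtain ⟨L, hL⟩ := hP.exists_polyhedron hPV
  obtain ⟨M, hM⟩ := hQ.exists_polyhedron hQW
  obtain ⟨N, hN⟩ := (hP.add hQ).exists_polyhedron hPQ
  refine ValGroup.toFun_injective (isSetLattice_cone _) (funext fun x => ?_)
  by_cases hx : x ∈ (V.prod W).1
  · obtain ⟨v, hv, w, hw, rfl⟩ := Submodule.mem_sup.1 hx
    rw [toFun_coneCross h _ _ hv hw, toFun_coneIntCls hP hPV, toFun_coneIntCls hQ hQW,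
      toFun_coneIntCls (hP.add hQ) hPQ, intrinsicInterior_add_of_isOrtho h hL hM hN,
      ind_add_of_isOrtho h (intrinsicInterior_subset.trans hPV)
        (intrinsicInterior_subset.trans hQW) hv hw]
  · rw [toFun_eq_zero_of_notMem (fun _ h => h.2) _ hx, toFun_eq_zero_of_notMem (fun _ h => h.2) _ hx]

theorem polyCross_intCls (h : V.1 ⟂ W.1) {P Q : Set E} (hP : IsConvexPolytope P) (hPV : P ⊆ V.1)
    (hQ : IsConvexPolytope Q) (hQW : Q ⊆ W.1) :
    polyCross h (polyIntCls V P) (polyIntCls W Q) = polyIntCls (V.prod W) (P + Q) := by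
  have hPQ := add_subset_prod hPV hQW
  obtain ⟨L, hL⟩ := hP.exists_polyhedron hPV
  obtain ⟨M, hM⟩ := hQ.exists_polyhedron hQW
  obtain ⟨N, hN⟩ := (hP.add hQ).exists_polyhedron hPQ
  refine ValGroup.toFun_injective (isSetLattice_polytope _) (funext fun x => ?_)
  by_cases hx : x ∈ (V.prod W).1
  · obtain ⟨v, hv, w, hw, rfl⟩ := Submodule.mem_sup.1 hx
    rw [toFun_polyCross h _ _ hv hw, toFun_polyIntCls hP hPV, toFun_polyIntCls hQ hQW,
      toFun_polyIntCls (hP.add hQ) hPQ, intrinsicInterior_add_of_isOrtho h hL hM hN,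
      ind_add_of_isOrtho h (intrinsicInterior_subset.trans hPV)
        (intrinsicInterior_subset.trans hQW) hv hw]
  · rw [toFun_eq_zero_of_notMem (fun _ h => h.2) _ hx, toFun_eq_zero_of_notMem (fun _ h => h.2) _ hx]

/-- Bilinear maps on cone groups agree if they agree on convex cones. -/
theorem ConeGroup.hom_ext₂ {M : Type*} [AddCommGroup M] {f g : ConeGroup V →+ ConeGroup W →+ M}
    (h : ∀ P Q, IsConvexCone P → P ⊆ V.1 → IsConvexCone Q → Q ⊆ W.1 →
      f (coneCls V P) (coneCls W Q) = g (coneCls V P) (coneCls W Q)) (ξ : ConeGroup V)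
    (η : ConeGroup W) : f ξ η = g ξ η := by
  have : f = g := ConeGroup.hom_ext fun P hP hV => ConeGroup.hom_ext fun Q hQ hW => h P Q hP hV hQ hW
  rw [this]

/-- Bilinear maps on polytope groups agree if they agree on convex polytopes. -/
theorem PolyGroup.hom_ext₂ {M : Type*} [AddCommGroup M] {f g : PolyGroup V →+ PolyGroup W →+ M}
    (h : ∀ P Q, IsConvexPolytope P → P ⊆ V.1 → IsConvexPolytope Q → Q ⊆ W.1 →
      f (polyCls V P) (polyCls W Q) = g (polyCls V P) (polyCls W Q)) (ξ : PolyGroup V)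
    (η : PolyGroup W) : f ξ η = g ξ η := by
  have : f = g := PolyGroup.hom_ext fun P hP hV => PolyGroup.hom_ext fun Q hQ hW => h P Q hP hV hQ hW
  rw [this]

theorem coneInterior_coneCross (h : V.1 ⟂ W.1) (ξ : ConeGroup V) (η : ConeGroup W) :
    coneInterior (V.prod W) (coneCross h ξ η) =
      coneCross h (coneInterior V ξ) (coneInterior W η) := by
  refine ConeGroup.hom_ext₂ (f := (coneCross h).compr₂ (coneInterior (V.prod W)))
    (g := ((coneCross h).comp (coneInterior V)).compl₂ (coneInterior W))
    (fun P Q hP hV hQ hW => ?_) ξ η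
  simp only [AddMonoidHom.compr₂_apply, AddMonoidHom.compl₂_apply, AddMonoidHom.comp_apply]
  rw [coneCross_cls h (hP.isConeIn hV) (hQ.isConeIn hW),
    isConeInterior_coneInterior _ _ (hP.add hQ) (add_subset_prod hV hW),
    isConeInterior_coneInterior _ _ hP hV, isConeInterior_coneInterior _ _ hQ hW, map_zsmul,
    map_zsmul, AddMonoidHom.smul_apply, coneCross_intCls h hP hV hQ hW, smul_smul,
    dim_add_of_isOrtho h hV hW hP.nonempty hQ.nonempty, pow_add, mul_comm]

theorem polyInterior_polyCross (h : V.1 ⟂ W.1) (ξ : PolyGroup V) (η : PolyGroup W) :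
    polyInterior (V.prod W) (polyCross h ξ η) =
      polyCross h (polyInterior V ξ) (polyInterior W η) := by
  refine PolyGroup.hom_ext₂ (f := (polyCross h).compr₂ (polyInterior (V.prod W)))
    (g := ((polyCross h).comp (polyInterior V)).compl₂ (polyInterior W))
    (fun P Q hP hV hQ hW => ?_) ξ η
  simp only [AddMonoidHom.compr₂_apply, AddMonoidHom.compl₂_apply, AddMonoidHom.comp_apply]
  rw [polyCross_cls h (hP.isPolytopeIn hV) (hQ.isPolytopeIn hW),
    isPolyInterior_polyInterior _ _ (hP.add hQ) (add_subset_prod hV hW),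
    isPolyInterior_polyInterior _ _ hP hV, isPolyInterior_polyInterior _ _ hQ hW, map_zsmul,
    map_zsmul, AddMonoidHom.smul_apply, polyCross_intCls h hP hV hQ hW, smul_smul,
    dim_add_of_isOrtho h hV hW hP.nonempty hQ.nonempty, pow_add, mul_comm]

theorem negDilatation_coneCls {P : Set E} (hP : IsConeIn V P) :
    negDilatation V (coneCls V P) = coneCls V (-P) := by
  rw [coneCls, coneCls, cls_eq hP, cls_eq hP.neg, negDilatation, ValGroup.lift_mk]

theorem negDilatation_coneCross (h : V.1 ⟂ W.1) (ξ : ConeGroup V) (η : ConeGroup W) :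
    negDilatation (V.prod W) (coneCross h ξ η) =
      coneCross h (negDilatation V ξ) (negDilatation W η) := by
  refine ValGroup.hom_ext₂ (f := (coneCross h).compr₂ (negDilatation (V.prod W)))
    (g := ((coneCross h).comp (negDilatation V)).compl₂ (negDilatation W))
    (fun P Q hP hQ => ?_) ξ η
  simp only [AddMonoidHom.compr₂_apply, AddMonoidHom.compl₂_apply, AddMonoidHom.comp_apply]
  change negDilatation _ (coneCross h (coneCls V P) (coneCls W Q)) =
    coneCross h (negDilatation V (coneCls V P)) (negDilatation W (coneCls W Q))
  rw [coneCross_cls h hP hQ, negDilatation_coneCls hP, negDilatation_coneCls hQ,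
    coneCross_cls h hP.neg hQ.neg, negDilatation_coneCls (hP.add hQ), neg_add]

theorem coneEuler_add_of_isOrtho (h : V.1 ⟂ W.1) {P Q : Set E} (hP : IsConvexCone P)
    (hV : P ⊆ V.1) (hQ : IsConvexCone Q) (hW : Q ⊆ W.1) :
    coneEuler (P + Q) = coneEuler P * coneEuler Q := by
  have hs : IsSymm (P + Q) ↔ IsSymm P ∧ IsSymm Q := by
    constructor
    · refine fun hs => ⟨fun x hx => ?_, fun y hy => ?_⟩
      · have := hs (x + 0) (Set.add_mem_add hx hQ.zero_mem)
        rw [neg_add] at this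
        exact ((add_mem_add_iff_of_isOrtho h hV hW (neg_mem (hV hx))
          (neg_mem (zero_mem W.1))).1 this).1
      · have := hs (0 + y) (Set.add_mem_add hP.zero_mem hy)
        rw [neg_add] at this
        exact ((add_mem_add_iff_of_isOrtho h hV hW (neg_mem (zero_mem V.1))
          (neg_mem (hW hy))).1 this).2
    · rintro ⟨h1, h2⟩ _ ⟨x, hx, y, hy, rfl⟩
      exact ⟨-x, h1 x hx, -y, h2 y hy, (neg_add x y).symm⟩
  unfold coneEuler
  rw [dim_add_of_isOrtho h hV hW hP.nonempty hQ.nonempty, pow_add]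
  by_cases h1 : IsSymm P <;> by_cases h2 : IsSymm Q <;> simp [hs, h1, h2]

theorem eulerHom_coneCross (h : V.1 ⟂ W.1) (ξ : ConeGroup V) (η : ConeGroup W) :
    eulerHom (V.prod W) (coneCross h ξ η) = eulerHom V ξ * eulerHom W η := by
  refine ConeGroup.hom_ext₂ (f := (coneCross h).compr₂ (eulerHom (V.prod W)))
    (g := mulHom₂ (eulerHom V) (eulerHom W)) (fun P Q hP hV hQ hW => ?_) ξ η
  simp only [AddMonoidHom.compr₂_apply, mulHom₂_apply]
  rw [coneCross_cls h (hP.isConeIn hV) (hQ.isConeIn hW),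
    eulerHom_coneCls (hP.add hQ) (add_subset_prod hV hW), eulerHom_coneCls hP hV,
    eulerHom_coneCls hQ hW, coneEuler_add_of_isOrtho h hP hV hQ hW]

end Orthogonal

section Invariants

/-! ## Objects, morphisms and polytope invariants -/

variable {k : Type*} [CommRing k]

/-- The multiplicative functions of finite-dimensional subspaces. -/
structure IsObject (O : FinSub E → k) : Prop where
  mul : ∀ V W : FinSub E, V.1 ⟂ W.1 → O (V.prod W) = O V * O W
  one : O FinSub.zero = 1

theorem isConvexCone_zero : IsConvexCone ({0} : Set E) := ⟨∅, by simp [PointedCone.hull]⟩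

theorem isConvexPolytope_singleton (x : E) : IsConvexPolytope ({x} : Set E) := ⟨{x}, by simp, by simp⟩

theorem isConvexCone_submodule (V : FinSub E) : IsConvexCone (V.1 : Set E) := by
  obtain ⟨s, hs⟩ := exists_hull_eq_submodule V.1
  exact ⟨s, Set.ext fun x => (hs x).symm⟩

variable {V W : FinSub E}

theorem singleton_zero_subset : ({0} : Set E) ⊆ V.1 := Set.singleton_subset_iff.2 (zero_mem V.1)

theorem isConeIn_zero : IsConeIn V {0} := isConvexCone_zero.isConeIn singleton_zero_subset

theorem isPolytopeIn_zero : IsPolytopeIn V {0} :=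
  (isConvexPolytope_singleton 0).isPolytopeIn singleton_zero_subset

theorem isConeIn_submodule : IsConeIn V (V.1 : Set E) :=
  (isConvexCone_submodule V).isConeIn subset_rfl

theorem isObject_scalarObj (a : k) : IsObject (E := E) (scalarObj a) where
  mul V W h := by rw [scalarObj, FinSub.dim_prod h, pow_add]; rfl
  one := by rw [scalarObj, FinSub.dim, FinSub.zero, finrank_bot, pow_zero]

theorem IsObject.mul' {O O' : FinSub E → k} (hO : IsObject O) (hO' : IsObject O') :
    IsObject (fun V => O V * O' V) where
  mul V W h := by rw [hO.mul V W h, hO'.mul V W h]; ring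
  one := by rw [hO.one, hO'.one, mul_one]

theorem IsObject.negObj {O : FinSub E → k} (hO : IsObject O) : IsObject (negObj O) :=
  (isObject_scalarObj (-1)).mul' hO

theorem IsMorphism.isObject_target {F : ConeFamily E k} (hF : IsMorphism F) :
    IsObject (target F) where
  mul V W h := by
    have := hF.mul V W h {0} {0} isConeIn_zero isConeIn_zero
    rwa [Set.singleton_add_singleton, add_zero] at this
  one := hF.one

theorem IsMorphism.isObject_source {F : ConeFamily E k} (hF : IsMorphism F) :
    IsObject (source F) where
  mul V W h := by
    have := hF.mul V W h V.1 W.1 isConeIn_submodule isConeIn_submodule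
    rwa [← FinSub.coe_prod] at this
  one := hF.one

theorem IsPolytopeInvariant.isObject_location {G : PolyFamily E k} (hG : IsPolytopeInvariant G) :
    IsObject (location G) where
  mul V W h := by
    have := hG.mul V W h {0} {0} isPolytopeIn_zero isPolytopeIn_zero
    rwa [Set.singleton_add_singleton, add_zero] at this
  one := hG.one

theorem IsMorphism.coneCross {F : ConeFamily E k} (hF : IsMorphism F) (h : V.1 ⟂ W.1)
    (ξ : ConeGroup V) (η : ConeGroup W) : F (V.prod W) (coneCross h ξ η) = F V ξ * F W η := by
  refine ValGroup.hom_ext₂ (f := (Scissors.coneCross h).compr₂ (F (V.prod W)))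
    (g := mulHom₂ (F V) (F W)) (fun P Q hP hQ => ?_) ξ η
  simp only [AddMonoidHom.compr₂_apply, mulHom₂_apply]
  exact (congrArg _ (coneCross_cls h hP hQ)).trans (hF.mul V W h P Q hP hQ)

theorem IsPolytopeInvariant.polyCross {G : PolyFamily E k} (hG : IsPolytopeInvariant G)
    (h : V.1 ⟂ W.1) (ξ : PolyGroup V) (η : PolyGroup W) :
    G (V.prod W) (polyCross h ξ η) = G V ξ * G W η := by
  refine ValGroup.hom_ext₂ (f := (Scissors.polyCross h).compr₂ (G (V.prod W)))
    (g := mulHom₂ (G V) (G W)) (fun P Q hP hQ => ?_) ξ η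
  simp only [AddMonoidHom.compr₂_apply, mulHom₂_apply]
  exact (congrArg _ (polyCross_cls h hP hQ)).trans (hG.mul V W h P Q hP hQ)

theorem dim_singleton (x : E) : dim ({x} : Set E) = 0 := by
  rw [dim, vectorSpan_singleton, finrank_bot]

theorem coneIntCls_zero : coneIntCls V {0} = coneCls V {0} := by
  refine ValGroup.toFun_injective (isSetLattice_cone _) ?_
  rw [toFun_coneIntCls isConvexCone_zero singleton_zero_subset, toFun_coneCls isConeIn_zero,
    intrinsicInterior_singleton]

theorem polyIntCls_zero : polyIntCls V {0} = polyCls V {0} := by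
  refine ValGroup.toFun_injective (isSetLattice_polytope _) ?_
  rw [toFun_polyIntCls (isConvexPolytope_singleton 0) singleton_zero_subset,
    toFun_polyCls isPolytopeIn_zero, intrinsicInterior_singleton]

theorem coneInterior_zero : coneInterior V (coneCls V {0}) = coneCls V {0} := by
  rw [isConeInterior_coneInterior V _ isConvexCone_zero singleton_zero_subset, dim_singleton,
    pow_zero, one_smul, coneIntCls_zero]

theorem polyInterior_zero : polyInterior V (polyCls V {0}) = polyCls V {0} := by
  rw [isPolyInterior_polyInterior V _ (isConvexPolytope_singleton 0) singleton_zero_subset,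
    dim_singleton, pow_zero, one_smul, polyIntCls_zero]

theorem IsMorphism.scaleCone {F : ConeFamily E k} (hF : IsMorphism F) {O : FinSub E → k}
    (hO : IsObject O) : IsMorphism (scaleCone O F) where
  mul V W h P Q hP hQ := by
    change O _ * F _ _ = O _ * F _ _ * (O _ * F _ _)
    rw [hF.mul V W h P Q hP hQ, hO.mul V W h]; ring
  one := by
    change O _ * F _ _ = 1
    rw [hF.one, hO.one, mul_one]

theorem IsMorphism.compI {F : ConeFamily E k} (hF : IsMorphism F) : IsMorphism (coneCompI F) where
  mul V W h P Q hP hQ := by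
    change F _ (coneInterior _ _) = F _ (coneInterior _ _) * F _ (coneInterior _ _)
    rw [← coneCross_cls h hP hQ, coneInterior_coneCross, hF.coneCross]
  one := by
    change F _ (coneInterior _ _) = 1
    rw [coneInterior_zero, hF.one]

theorem IsMorphism.compNeg {F : ConeFamily E k} (hF : IsMorphism F) :
    IsMorphism (coneCompNeg F) where
  mul V W h P Q hP hQ := by
    change F _ (negDilatation _ _) = F _ (negDilatation _ _) * F _ (negDilatation _ _)
    rw [← coneCross_cls h hP hQ, negDilatation_coneCross, hF.coneCross]
  one := by
    change F _ (negDilatation _ _) = 1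
    rw [negDilatation_coneCls isConeIn_zero, Set.neg_singleton, neg_zero, hF.one]

theorem eulerMorphism_apply (V : FinSub E) (ξ : ConeGroup V) :
    eulerMorphism E k V ξ = ((eulerHom V ξ : ℤ) : k) := by
  rw [eulerMorphism, localEuler_eq]; rfl

theorem eulerHom_submodule : eulerHom V (coneCls V (V.1 : Set E)) = (-1) ^ V.dim := by
  rw [eulerHom_coneCls (isConvexCone_submodule V) subset_rfl, coneEuler_submodule, FinSub.dim]

theorem eulerHom_zero : eulerHom V (coneCls V {0}) = 1 := by
  have h := coneEuler_submodule (⊥ : Submodule ℝ E)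
  rw [finrank_bot, pow_zero, Submodule.bot_coe] at h
  rw [eulerHom_coneCls isConvexCone_zero singleton_zero_subset, h]

variable (E k) in
theorem isMorphism_eulerMorphism : IsMorphism (eulerMorphism E k) where
  mul V W h P Q hP hQ := by
    rw [eulerMorphism_apply, eulerMorphism_apply, eulerMorphism_apply, ← coneCross_cls h hP hQ,
      eulerHom_coneCross, Int.cast_mul]
  one := by rw [eulerMorphism_apply, eulerHom_zero, Int.cast_one]

/-- Since `e(V) = (-1)^dim V`, passing to the source introduces a sign. With
`target_scale_eulerMorphism` this supplies the compatibility conditions of all the star products. -/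
theorem source_scale_eulerMorphism (O : FinSub E → k) :
    source (scaleCone O (eulerMorphism E k)) = negObj O := by
  funext V
  change O V * eulerMorphism E k V _ = scalarObj (-1) V * O V
  rw [eulerMorphism_apply, eulerHom_submodule, scalarObj]
  push_cast
  ring

theorem target_scale_eulerMorphism (O : FinSub E → k) :
    target (scaleCone O (eulerMorphism E k)) = O := by
  funext V
  change O V * eulerMorphism E k V _ = O V
  rw [eulerMorphism_apply, eulerHom_zero, Int.cast_one, mul_one]

theorem negObj_negObj (O : FinSub E → k) : negObj (negObj O) = O := by
  funext V
  simp only [negObj, scalarObj, ← mul_assoc, ← mul_pow]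
  simp

/-! ## Translations -/

theorem IsConvexPolytope.vadd {P : Set E} (hP : IsConvexPolytope P) (v : E) :
    IsConvexPolytope (v +ᵥ P) := by
  rw [← Set.singleton_vadd]
  exact (isConvexPolytope_singleton v).add hP

theorem IsPolytopeIn.vadd {P : Set E} (hP : IsPolytopeIn V P) {v : E} (hv : v ∈ V.1) :
    IsPolytopeIn V (v +ᵥ P) := by
  refine ⟨?_, ?_⟩
  · rw [← Set.singleton_vadd]
    exact IsUnionOf.add (fun _ _ => IsConvexPolytope.add)
      (IsUnionOf.of_piece (isConvexPolytope_singleton v)) hP.1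
  · rintro _ ⟨x, hx, rfl⟩
    exact add_mem hv (hP.2 hx)

theorem intrinsicFrontier_vadd (v : E) (P : Set E) :
    intrinsicFrontier ℝ (v +ᵥ P) = v +ᵥ intrinsicFrontier ℝ P :=
  AffineIsometry.intrinsicFrontier_image (AffineIsometryEquiv.constVAdd ℝ E v).toAffineIsometry P

theorem dim_vadd (v : E) (P : Set E) : dim (v +ᵥ P) = dim P := by
  rw [dim, dim, vectorSpan_vadd]

/-- The action of a translation on the polytope group. -/
def polyTranslation (v : E) (hv : v ∈ V.1) : PolyGroup V →+ PolyGroup V :=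
  ValGroup.lift (fun P => ValGroup.mk ⟨v +ᵥ P.1, P.2.vadd hv⟩)
    { empty := fun P hP => (ValGroup.isValuation_mk _).empty _ (by simp [hP])
      union := fun P Q R S hR hS => (ValGroup.isValuation_mk _).union _ _ _ _
        (by simp [hR, Set.vadd_set_union]) (by simp [hS, Set.vadd_set_inter]) }

theorem polyTranslation_polyCls {v : E} (hv : v ∈ V.1) {P : Set E} (hP : IsPolytopeIn V P) :
    polyTranslation v hv (polyCls V P) = polyCls V (v +ᵥ P) := by
  rw [polyCls, polyCls, cls_eq hP, cls_eq (hP.vadd hv), polyTranslation, ValGroup.lift_mk]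

theorem IsPolytopeInvariant.polyIntCls_vadd {G : PolyFamily E k} (hG : IsPolytopeInvariant G)
    {P : Set E} (hP : IsConvexPolytope P) (hV : P ⊆ V.1) {v : E} (hv : v ∈ V.1) :
    G V (polyIntCls V (v +ᵥ P)) = G V (polyIntCls V P) := by
  simp only [polyIntCls, map_sub, intrinsicFrontier_vadd,
    hG.translation V _ (hP.isPolytopeIn hV) v hv,
    hG.translation V _ (hP.isPolytopeIn_frontier hV) v hv]

theorem IsPolytopeInvariant.scalePoly {G : PolyFamily E k} (hG : IsPolytopeInvariant G)
    {O : FinSub E → k} (hO : IsObject O) : IsPolytopeInvariant (scalePoly O G) where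
  translation V P hP v hv := by
    change O _ * G _ _ = O _ * G _ _
    rw [hG.translation V P hP v hv]
  mul V W h P Q hP hQ := by
    change O _ * G _ _ = O _ * G _ _ * (O _ * G _ _)
    rw [hG.mul V W h P Q hP hQ, hO.mul V W h]; ring
  one := by
    change O _ * G _ _ = 1
    rw [hG.one, hO.one, mul_one]

theorem IsPolytopeInvariant.compI {G : PolyFamily E k} (hG : IsPolytopeInvariant G) :
    IsPolytopeInvariant (polyCompI G) where
  translation V P hP v hv := by
    have : ((G V).comp (polyInterior V)).comp (polyTranslation v hv) =
        (G V).comp (polyInterior V) := PolyGroup.hom_ext fun Q hQ hQV => by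
      simp only [AddMonoidHom.comp_apply]
      rw [polyTranslation_polyCls hv (hQ.isPolytopeIn hQV),
        isPolyInterior_polyInterior V _ (hQ.vadd v) ((hQ.isPolytopeIn hQV).vadd hv).2,
        isPolyInterior_polyInterior V _ hQ hQV, map_zsmul, map_zsmul, dim_vadd,
        hG.polyIntCls_vadd hQ hQV hv]
    have h := DFunLike.congr_fun this (polyCls V P)
    simp only [AddMonoidHom.comp_apply, polyTranslation_polyCls hv hP] at h
    exact h
  mul V W h P Q hP hQ := by
    change G _ (polyInterior _ _) = G _ (polyInterior _ _) * G _ (polyInterior _ _)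
    rw [← polyCross_cls h hP hQ, polyInterior_polyCross, hG.polyCross]
  one := by
    change G _ (polyInterior _ _) = 1
    rw [polyInterior_zero, hG.one]

end Invariants

/-! ## Tangent cones along the cells of a cell structure -/

section TangentCells

variable {cell : Set E → Prop} {K : Finset (Set E)} {P σ : Set E} {V : FinSub E}

theorem add_mem_tangent {τ : Set E} (hτ : Convex ℝ τ) {x w u : E} (hx : x ∈ τ)
    (hw : w ∈ tangent τ x) (hu : u ∈ tangent τ x) : w + u ∈ tangent τ x := by
  obtain ⟨ε, hε, hw⟩ := (mem_tangent_iff_of_convex hτ hx).1 hw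
  obtain ⟨δ, hδ, hu⟩ := (mem_tangent_iff_of_convex hτ hx).1 hu
  have hs : 0 < ε + δ := add_pos hε hδ
  -- The length making the new point a convex combination of `x + ε • w` and `x + δ • u` in which
  -- `w` and `u` have equal coefficients.
  refine (mem_tangent_iff_of_convex hτ hx).2 ⟨ε * δ / (ε + δ), by positivity, ?_⟩
  have := hτ hw hu (a := δ / (ε + δ)) (b := ε / (ε + δ)) (by positivity) (by positivity)
    (by field_simp; ring)
  convert this using 1
  match_scalars <;> field_simp
  ring

/-- Directions into `τ` at a point `x` are directions into `τ` at any `y` such that `τ` contains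
a prolongation of the segment from `x` to `y`. -/
theorem tangent_subset_tangent {τ : Set E} (hτ : Convex ℝ τ) {x y : E} (hx : x ∈ τ) (hy : y ∈ τ)
    {δ : ℝ} (hδ : 0 < δ) (h : y + δ • (y - x) ∈ τ) : tangent τ x ⊆ tangent τ y := by
  intro w hw
  obtain ⟨ε, hε, hw⟩ := (mem_tangent_iff_of_convex hτ hx).1 hw
  -- The point `y` is the convex combination of `y + δ • (y - x)` and `x` with weights `1 / (1 + δ)`
  -- and `δ / (1 + δ)`; moving `x` by `ε • w` moves `y` by this multiple of `w`.
  refine (mem_tangent_iff_of_convex hτ hy).2 ⟨ε * δ / (1 + δ), by positivity, ?_⟩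
  have := hτ h hw (a := 1 / (1 + δ)) (b := δ / (1 + δ)) (by positivity) (by positivity)
    (by field_simp)
  convert this using 1
  match_scalars <;> field_simp
  ring

theorem mem_tangent_iff_of_isCellStructure (hK : IsCellStructure cell K P)
    (hpoly : ∀ σ ∈ K, ∃ L, σ = polyhedron V L) {x w : E} :
    w ∈ tangent P x ↔ ∃ τ ∈ K, x ∈ τ ∧ w ∈ tangent τ x := by
  have h := (rayDetermined_biUnion K fun c hc => by
    obtain ⟨L, rfl⟩ := hpoly c hc
    exact rayDetermined_of_convex (convex_polyhedron V L)).2 x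
  rw [hK.union, h]
  simp only [Set.mem_iUnion, exists_prop]
  refine exists_congr fun τ => and_congr_right fun hτ => ⟨fun hw => ⟨?_, hw⟩, And.right⟩
  by_contra hx
  obtain ⟨L, rfl⟩ := hpoly τ hτ
  rw [tangent_eq_empty (isClosed_polyhedron V L) hx] at hw
  exact hw

theorem tangent_eq_empty_of_isCellStructure (hK : IsCellStructure cell K P)
    (hpoly : ∀ σ ∈ K, ∃ L, σ = polyhedron V L) {x : E} (hx : x ∉ P) : tangent P x = ∅ := by
  refine Set.eq_empty_of_forall_notMem fun w hw => ?_
  obtain ⟨τ, hτ, hxτ, -⟩ := (mem_tangent_iff_of_isCellStructure hK hpoly).1 hw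
  exact hx (hK.subset hτ hxτ)

/-- A cell that contains one interior point of `σ` contains all of `σ`, hence also the prolongations
of segments in `σ`, and its tangent cones at the two points agree. This is why the normal cone does
not depend on the chosen point. -/
theorem tangent_eq_of_mem_interior (hK : IsCellStructure cell K P)
    (hpoly : ∀ σ ∈ K, ∃ L, σ = polyhedron V L) (hσ : σ ∈ K) {x y : E}
    (hx : x ∈ intrinsicInterior ℝ σ) (hy : y ∈ intrinsicInterior ℝ σ) :
    tangent P x = tangent P y := by
  have key : ∀ {x y : E}, x ∈ intrinsicInterior ℝ σ → y ∈ intrinsicInterior ℝ σ →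
      tangent P x ⊆ tangent P y := by
    intro x y hx hy w hw
    rw [mem_tangent_iff_of_isCellStructure hK hpoly] at hw ⊢
    obtain ⟨τ, hτ, hxτ, hw⟩ := hw
    have hsub := hK.subset_of_mem_interior hpoly hσ hτ hx hxτ
    have hyτ := hsub (intrinsicInterior_subset hy)
    obtain ⟨δ, hδ, h⟩ := exists_add_smul_mem_of_mem_intrinsicInterior hy
      (intrinsicInterior_subset hx)
    obtain ⟨L, rfl⟩ := hpoly τ hτ
    exact ⟨_, hτ, hyτ, tangent_subset_tangent (convex_polyhedron V L) hxτ hyτ hδ (hsub h) hw⟩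
  exact Set.Subset.antisymm (key hx hy) (key hy hx)

theorem mem_normalCone_iff (hK : IsCellStructure cell K P)
    (hpoly : ∀ σ ∈ K, ∃ L, σ = polyhedron V L) (hσ : σ ∈ K) {x w : E}
    (hx : x ∈ intrinsicInterior ℝ σ) :
    w ∈ normalCone σ P ↔ w ∈ (vectorSpan ℝ σ)ᗮ ∧ w ∈ tangent P x := by
  refine and_congr_right fun _ => ⟨?_, fun h => ⟨x, hx, h⟩⟩
  rintro ⟨v, hv, h⟩
  rw [tangent_eq_of_mem_interior hK hpoly hσ hx hv]
  exact h

theorem add_mem_tangent_of_mem_vectorSpan (hK : IsCellStructure cell K P)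
    (hpoly : ∀ σ ∈ K, ∃ L, σ = polyhedron V L) (hσ : σ ∈ K) {x w u : E}
    (hx : x ∈ intrinsicInterior ℝ σ) (hw : w ∈ tangent P x) (hu : u ∈ vectorSpan ℝ σ) :
    u + w ∈ tangent P x := by
  rw [mem_tangent_iff_of_isCellStructure hK hpoly] at hw ⊢
  obtain ⟨τ, hτ, hxτ, hw⟩ := hw
  have hsub := hK.subset_of_mem_interior hpoly hσ hτ hx hxτ
  obtain ⟨M, hM⟩ := hpoly σ hσ
  have hu' : u ∈ tangent σ x := by
    subst hM
    rw [tangent_eq_vectorSpan hx]; exact hu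
  obtain ⟨L, rfl⟩ := hpoly τ hτ
  exact ⟨_, hτ, hxτ, add_mem_tangent (convex_polyhedron V L) hxτ (tangent_mono hsub x hu') hw⟩

theorem FinSub.along_eq (hσ : σ ⊆ V.1) : (V.along σ).1 = vectorSpan ℝ σ :=
  inf_eq_right.2 (vectorSpan_le_of_subset hσ)

theorem FinSub.along_isOrtho_perp (V : FinSub E) (σ : Set E) : (V.along σ).1 ⟂ (V.perp σ).1 :=
  (Submodule.isOrtho_orthogonal_right (vectorSpan ℝ σ)).mono inf_le_right inf_le_right

theorem FinSub.along_prod_perp (hσ : σ ⊆ V.1) : (V.along σ).prod (V.perp σ) = V := by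
  have h := vectorSpan_le_of_subset hσ
  have : FiniteDimensional ℝ (vectorSpan ℝ σ) := Submodule.finiteDimensional_of_le h
  refine Subtype.ext ?_
  change (V.along σ).1 ⊔ V.1 ⊓ (vectorSpan ℝ σ)ᗮ = V.1
  rw [FinSub.along_eq hσ, inf_comm]
  exact Submodule.sup_orthogonal_inf_of_hasOrthogonalProjection h

theorem FinSub.dim_along (hσ : σ ⊆ V.1) : (V.along σ).dim = Scissors.dim σ := by
  rw [FinSub.dim, FinSub.along_eq hσ, Scissors.dim]

theorem FinSub.dim_eq_add (hσ : σ ⊆ V.1) : V.dim = Scissors.dim σ + (V.perp σ).dim := by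
  conv_lhs => rw [← FinSub.along_prod_perp hσ]
  rw [FinSub.dim_prod (V.along_isOrtho_perp σ), FinSub.dim_along hσ]

theorem isConeIn_tangent (hK : IsCellStructure cell K P)
    (hpoly : ∀ σ ∈ K, ∃ L, σ = polyhedron V L) (x : E) : IsConeIn V (tangent P x) := by
  rw [hK.union]
  exact (hasTangentCones_of_pieces hpoly).2 x

theorem IsCellStructure.subset_submodule (hK : IsCellStructure cell K P)
    (hpoly : ∀ σ ∈ K, ∃ L, σ = polyhedron V L) : P ⊆ V.1 := by
  rw [hK.union]
  refine Set.iUnion₂_subset fun σ hσ => ?_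
  obtain ⟨L, rfl⟩ := hpoly σ hσ
  exact fun x hx => hx.1

/-- The tangent cone is stable under adding vectors parallel to `σ`, so the component of a tangent
vector along `σ` can be removed. This product structure connects tangent cones with the normal cones
of the star product. -/
theorem tangent_eq_add_normalCone (hK : IsCellStructure cell K P)
    (hpoly : ∀ σ ∈ K, ∃ L, σ = polyhedron V L) (hσ : σ ∈ K) {x : E}
    (hx : x ∈ intrinsicInterior ℝ σ) :
    tangent P x = ((V.along σ).1 : Set E) + normalCone σ P := by
  have hσV := (hK.subset hσ).trans (hK.subset_submodule hpoly)
  have hprod := FinSub.along_prod_perp hσV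
  have hle := FinSub.along_eq hσV
  ext w
  constructor
  · intro hw
    have hwV : w ∈ ((V.along σ).prod (V.perp σ)).1 := by
      rw [hprod]; exact (isConeIn_tangent hK hpoly x).2 hw
    obtain ⟨u, hu, n, hn, rfl⟩ := Submodule.mem_sup.1 hwV
    refine Set.add_mem_add hu ((mem_normalCone_iff hK hpoly hσ hx).2 ⟨hn.2, ?_⟩)
    have := add_mem_tangent_of_mem_vectorSpan hK hpoly hσ hx hw (neg_mem (hle ▸ hu))
    rwa [neg_add_cancel_left] at this
  · rintro ⟨u, hu, n, hn, rfl⟩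
    exact add_mem_tangent_of_mem_vectorSpan hK hpoly hσ hx
      ((mem_normalCone_iff hK hpoly hσ hx).1 hn).2 (hle ▸ hu)

theorem interior_nonempty_of_cell (hpoly : ∀ σ ∈ K, ∃ L, σ = polyhedron V L) (hσ : σ ∈ K)
    (hne : σ.Nonempty) : ∃ x, x ∈ intrinsicInterior ℝ σ := by
  obtain ⟨L, rfl⟩ := hpoly σ hσ
  exact intrinsicInterior_polyhedron_nonempty hne

theorem isConeIn_normalCone (hK : IsCellStructure cell K P)
    (hpoly : ∀ σ ∈ K, ∃ L, σ = polyhedron V L) (hσ : σ ∈ K) (hne : σ.Nonempty) :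
    IsConeIn (V.perp σ) (normalCone σ P) := by
  obtain ⟨x, hx⟩ := interior_nonempty_of_cell hpoly hσ hne
  have hT := isConeIn_tangent hK hpoly x
  have : normalCone σ P = tangent P x ∩ (V.perp σ).1 := by
    ext w
    rw [mem_normalCone_iff hK hpoly hσ hx]
    exact ⟨fun h => ⟨h.2, hT.2 h.2, h.1⟩, fun h => ⟨h.2.2, h.1⟩⟩
  rw [this]
  exact ⟨((isSetLattice_cone V).inter _ _ hT ⟨isConeIn_submodule.1, inf_le_left⟩).1,
    Set.inter_subset_right⟩

end TangentCells

/-! ## The star product formula -/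

section Star

variable {k : Type*} [CommRing k] {K : Finset (Set E)} {P σ : Set E} {V A B : FinSub E}

theorem IsMorphism.mul_of_prod_eq {F : ConeFamily E k} (hF : IsMorphism F) (h : A.1 ⟂ B.1)
    (e : A.prod B = V) {P Q : Set E} (hP : IsConeIn A P) (hQ : IsConeIn B Q) :
    F V (coneCls V (P + Q)) = F A (coneCls A P) * F B (coneCls B Q) := by
  subst e
  exact hF.mul A B h P Q hP hQ

/-- Multiplicativity applied to `σ = σ + {0}`. The decomposition of `V` is an equation of subspaces,
not a definitional one, so it enters as the hypothesis `e` and is substituted. -/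
theorem IsMorphism.coneIntCls_of_prod_eq {F : ConeFamily E k} (hF : IsMorphism F) (h : A.1 ⟂ B.1)
    (e : A.prod B = V) (hσ : IsConvexCone σ) (hA : σ ⊆ A.1) :
    F V (coneIntCls V σ) = F A (coneIntCls A σ) * target F B := by
  subst e
  have := hF.coneCross h (coneIntCls A σ) (coneIntCls B {0})
  rwa [coneCross_intCls h hσ hA isConvexCone_zero singleton_zero_subset, Set.add_singleton,
    coneIntCls_zero (V := B), show ((fun x : E => x + 0) '' σ) = σ by simp] at this

theorem IsPolytopeInvariant.polyIntCls_of_prod_eq {G : PolyFamily E k} (hG : IsPolytopeInvariant G)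
    (h : A.1 ⟂ B.1) (e : A.prod B = V) (hσ : IsConvexPolytope σ) (hA : σ ⊆ A.1) :
    G V (polyIntCls V σ) = G A (polyIntCls A σ) * location G B := by
  subst e
  have := hG.polyCross h (polyIntCls A σ) (polyIntCls B {0})
  rwa [polyCross_intCls h hσ hA (isConvexPolytope_singleton 0) singleton_zero_subset,
    Set.add_singleton, polyIntCls_zero (V := B),
    show ((fun x : E => x + 0) '' σ) = σ by simp] at this

theorem eulerHom_of_prod_eq (h : A.1 ⟂ B.1) (e : A.prod B = V) {Q : Set E} (hQ : IsConeIn B Q) :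
    eulerHom V (coneCls V ((A.1 : Set E) + Q)) = (-1) ^ A.dim * eulerHom B (coneCls B Q) := by
  subst e
  rw [← coneCross_cls h isConeIn_submodule hQ, eulerHom_coneCross, eulerHom_submodule]

theorem eulerHom_tangent_eq {cell : Set E → Prop} (hK : IsCellStructure cell K P)
    (hpoly : ∀ σ ∈ K, ∃ L, σ = polyhedron V L) (hσ : σ ∈ K) {x : E}
    (hx : x ∈ intrinsicInterior ℝ σ) :
    eulerHom V (coneCls V (tangent P x)) =
      (-1) ^ dim σ * eulerHom (V.perp σ) (coneCls (V.perp σ) (normalCone σ P)) := by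
  have hσV := (hK.subset hσ).trans (hK.subset_submodule hpoly)
  rw [tangent_eq_add_normalCone hK hpoly hσ hx, eulerHom_of_prod_eq (V.along_isOrtho_perp σ)
    (FinSub.along_prod_perp hσV)
    (isConeIn_normalCone hK hpoly hσ ⟨x, intrinsicInterior_subset hx⟩), FinSub.dim_along hσV]

/-- As a function, `I(P)` is the Euler number of the tangent cone. It is constant on the interior of
each cell, with the value computed by `eulerHom_tangent_eq`, and vanishes off `P`. -/
theorem coneInterior_eq_sum (hK : IsConeCellStructure K P) (hP : IsConeIn V P) :
    coneInterior V (coneCls V P) = ∑ σ ∈ K,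
      ((-1) ^ dim σ * eulerHom (V.perp σ) (coneCls (V.perp σ) (normalCone σ P))) •
        coneIntCls V σ := by
  have hpoly := IsConeCellStructure.polyhedra hK hP.2
  have hf : ∀ x, ValGroup.toFun _ (coneInterior V (coneCls V P)) x =
      eulerHom V (coneCls V (tangent P x)) := fun x => by
    rw [toFun_coneInterior]; exact congrArg _ (tangentHom_cls _ x hP)
  refine ValGroup.toFun_injective (isSetLattice_cone V) ?_
  rw [IsCellStructure.eq_sum hK hpoly
    (fun σ hσ x hx => (hf x).trans (eulerHom_tangent_eq hK hpoly hσ hx)) fun x hx => ?_, map_sum]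
  · refine Finset.sum_congr rfl fun σ hσ => ?_
    rw [map_zsmul, toFun_coneIntCls (hK.cells σ hσ) ((IsCellStructure.subset hK hσ).trans hP.2)]
  · rw [hf, tangent_eq_empty_of_isCellStructure hK hpoly hx, coneCls,
      cls_empty (isSetLattice_cone V).empty, map_zero]

theorem polyInterior_eq_sum (hK : IsPolyCellStructure K P) (hP : IsPolytopeIn V P) :
    polyInterior V (polyCls V P) = ∑ σ ∈ K,
      ((-1) ^ dim σ * eulerHom (V.perp σ) (coneCls (V.perp σ) (normalCone σ P))) •
        polyIntCls V σ := by
  have hpoly := IsPolyCellStructure.polyhedra hK hP.2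
  have hf : ∀ x, ValGroup.toFun _ (polyInterior V (polyCls V P)) x =
      eulerHom V (coneCls V (tangent P x)) := fun x => by
    rw [toFun_polyInterior]; exact congrArg _ (tangentHom_cls _ x hP)
  refine ValGroup.toFun_injective (isSetLattice_polytope V) ?_
  rw [IsCellStructure.eq_sum hK hpoly
    (fun σ hσ x hx => (hf x).trans (eulerHom_tangent_eq hK hpoly hσ hx)) fun x hx => ?_, map_sum]
  · refine Finset.sum_congr rfl fun σ hσ => ?_
    rw [map_zsmul, toFun_polyIntCls (hK.cells σ hσ) ((IsCellStructure.subset hK hσ).trans hP.2)]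
  · rw [hf, tangent_eq_empty_of_isCellStructure hK hpoly hx, coneCls,
      cls_empty (isSetLattice_cone V).empty, map_zero]

theorem subset_along_of_cone (hσ : IsConvexCone σ) (hσV : σ ⊆ V.1) : σ ⊆ (V.along σ).1 := by
  rw [FinSub.along_eq hσV]
  intro x hx
  simpa using vsub_mem_vectorSpan ℝ hx hσ.zero_mem

theorem IsMorphism.coneInterior_eq_sum {F : ConeFamily E k} (hF : IsMorphism F)
    (hK : IsConeCellStructure K P) (hP : IsConeIn V P) :
    F V (coneInterior V (coneCls V P)) = ∑ σ ∈ K,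
      (target F (V.perp σ) *
        (eulerHom (V.perp σ) (coneCls (V.perp σ) (normalCone σ P)) : ℤ)) *
        ((-1) ^ dim σ * F (V.along σ) (coneIntCls (V.along σ) σ)) := by
  rw [Scissors.coneInterior_eq_sum hK hP, map_sum]
  refine Finset.sum_congr rfl fun σ hσ => ?_
  have hσV := (IsCellStructure.subset hK hσ).trans hP.2
  rw [map_zsmul, hF.coneIntCls_of_prod_eq (V.along_isOrtho_perp σ) (FinSub.along_prod_perp hσV)
    (hK.cells σ hσ) (subset_along_of_cone (hK.cells σ hσ) hσV), zsmul_eq_mul]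
  push_cast
  ring

/-- Translation invariance moves `σ` into the subspace parallel to it; multiplicativity then leaves
the value of a point in `σ^⊥`. -/
theorem IsPolytopeInvariant.polyIntCls_toOrigin {G : PolyFamily E k} (hG : IsPolytopeInvariant G)
    (hσ : IsConvexPolytope σ) (hσV : σ ⊆ V.1) :
    G V (polyIntCls V σ) =
      G (V.along σ) (polyIntCls (V.along σ) (toOrigin σ)) * location G (V.perp σ) := by
  have hne := hσ.nonempty
  have ho : toOrigin σ = -hne.some +ᵥ σ := by
    rw [toOrigin, dif_pos hne]
    exact Set.image_congr' fun x => by rw [vadd_eq_add, sub_eq_neg_add]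
  have hv : -hne.some ∈ V.1 := neg_mem (hσV hne.some_mem)
  rw [← hG.polyIntCls_vadd hσ hσV hv, ← ho]
  refine hG.polyIntCls_of_prod_eq (V.along_isOrtho_perp σ) (FinSub.along_prod_perp hσV) ?_ ?_
  · rw [ho]; exact hσ.vadd _
  · rw [toOrigin, dif_pos hne, FinSub.along_eq hσV]
    rintro _ ⟨x, hx, rfl⟩
    exact vsub_mem_vectorSpan ℝ hx hne.some_mem

theorem IsPolytopeInvariant.polyInterior_eq_sum {G : PolyFamily E k} (hG : IsPolytopeInvariant G)
    (hK : IsPolyCellStructure K P) (hP : IsPolytopeIn V P) :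
    G V (polyInterior V (polyCls V P)) = ∑ σ ∈ K,
      (location G (V.perp σ) *
        (eulerHom (V.perp σ) (coneCls (V.perp σ) (normalCone σ P)) : ℤ)) *
        ((-1) ^ dim σ * G (V.along σ) (polyIntCls (V.along σ) (toOrigin σ))) := by
  rw [Scissors.polyInterior_eq_sum hK hP, map_sum]
  refine Finset.sum_congr rfl fun σ hσ => ?_
  rw [map_zsmul, hG.polyIntCls_toOrigin (hK.cells σ hσ)
    ((IsCellStructure.subset hK hσ).trans hP.2), zsmul_eq_mul]
  push_cast
  ring

/-- At `w` the left side is the Euler number of `P` shifted by `exists_shift`. The shifted class is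
constant on the interior of each cell, with value `1` exactly when `w` is in the tangent cone along
that cell, and the interior of `σ` has Euler number `(-1)^dim σ`. -/
theorem negDilatation_coneInterior_eq_sum (hK : IsConeCellStructure K P) (hP : IsConeIn V P) :
    negDilatation V (coneInterior V (coneCls V P)) = ∑ σ ∈ K,
      (-1 : ℤ) ^ dim σ • coneCls V (((V.along σ).1 : Set E) + normalCone σ P) := by
  have hpoly := IsConeCellStructure.polyhedra hK hP.2
  have hT : ∀ σ ∈ K, IsConeIn V (((V.along σ).1 : Set E) + normalCone σ P) := fun σ hσ => by
    obtain ⟨x, hx⟩ := interior_nonempty_of_cell hpoly hσ (hK.cells σ hσ).nonempty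
    rw [← tangent_eq_add_normalCone hK hpoly hσ hx]
    exact isConeIn_tangent hK hpoly x
  refine ValGroup.toFun_injective (isSetLattice_cone V) (funext fun w => ?_)
  by_cases hw : w ∈ V.1
  · obtain ⟨S, hS, hSe⟩ := exists_shift hw
    have hf : ∀ y, ValGroup.toFun _ (S (coneCls V P)) y = ind (tangent P y) w := fun y => by
      rw [hS, toFun_coneTangent y hP]
    have hSP : S (coneCls V P) = ∑ σ ∈ K,
        ind (((V.along σ).1 : Set E) + normalCone σ P) w • coneIntCls V σ := by
      refine ValGroup.toFun_injective (isSetLattice_cone V) ?_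
      rw [IsCellStructure.eq_sum hK hpoly (fun σ hσ x hx => (hf x).trans
        (by rw [tangent_eq_add_normalCone hK hpoly hσ hx])) fun x hx => ?_, map_sum]
      · refine Finset.sum_congr rfl fun σ hσ => ?_
        rw [map_zsmul, toFun_coneIntCls (hK.cells σ hσ)
          ((IsCellStructure.subset hK hσ).trans hP.2)]
      · rw [hf]
        exact ind_of_notMem fun h => by
          rwa [tangent_eq_empty_of_isCellStructure hK hpoly hx] at h
    rw [toFun_negDilatation, ← hSe, hSP, map_sum, map_sum, Finset.sum_apply]
    refine Finset.sum_congr rfl fun σ hσ => ?_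
    rw [map_zsmul, map_zsmul, eulerHom_coneIntCls (hK.cells σ hσ)
      ((IsCellStructure.subset hK hσ).trans hP.2), toFun_coneCls (hT σ hσ), Pi.smul_apply,
      smul_eq_mul, smul_eq_mul, mul_comm]
  · rw [toFun_eq_zero_of_notMem (fun _ h => h.2) _ hw, toFun_eq_zero_of_notMem (fun _ h => h.2) _ hw]

/-! ### The star-product identities for morphisms and polytope invariants. -/

theorem isStar_neg_target {F : ConeFamily E k} (hF : IsMorphism F) :
    IsStar (scaleCone (negObj (target F)) (eulerMorphism E k)) F
      (scaleCone (scalarObj (-1)) (coneCompI F)) where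
  left := (isMorphism_eulerMorphism E k).scaleCone hF.isObject_target.negObj
  right := hF
  result := hF.compI.scaleCone (isObject_scalarObj (-1))
  compat := by rw [source_scale_eulerMorphism, negObj_negObj]
  exists_cells V P hP := (exists_coneCellStructure hP).imp fun _ h => h.1
  formula V P hP K hK := by
    change scalarObj (-1) V * F V (coneInterior V (coneCls V P)) = _
    rw [hF.coneInterior_eq_sum hK hP, Finset.mul_sum]
    refine Finset.sum_congr rfl fun σ hσ => ?_
    have hσV := (IsCellStructure.subset hK hσ).trans hP.2
    change _ = scalarObj (-1) _ * target F _ * eulerMorphism E k _ _ * _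
    -- The sign `(-1)^dim V` splits along `V_σ` and `σ^⊥`; its first factor cancels the sign in the
    -- expansion of `I`, and the second is the sign in `-t(F)`.
    have h1 : ((-1 : k) ^ dim σ) * (-1) ^ dim σ = 1 := by rw [← mul_pow]; simp
    rw [eulerMorphism_apply, scalarObj, scalarObj, FinSub.dim_eq_add hσV, pow_add]
    linear_combination ((-1) ^ (V.perp σ).dim * target F (V.perp σ) *
      ((eulerHom (V.perp σ) (coneCls (V.perp σ) (normalCone σ P)) : ℤ) : k) *
      F (V.along σ) (coneIntCls (V.along σ) σ)) * h1

theorem isStar_target {F : ConeFamily E k} (hF : IsMorphism F) :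
    IsStar (scaleCone (target F) (eulerMorphism E k)) (scaleCone (scalarObj (-1)) F)
      (coneCompI F) where
  left := (isMorphism_eulerMorphism E k).scaleCone hF.isObject_target
  right := hF.scaleCone (isObject_scalarObj (-1))
  result := hF.compI
  compat := by rw [source_scale_eulerMorphism]; rfl
  exists_cells V P hP := (exists_coneCellStructure hP).imp fun _ h => h.1
  formula V P hP K hK := by
    change F V (coneInterior V (coneCls V P)) = _
    rw [hF.coneInterior_eq_sum hK hP]
    refine Finset.sum_congr rfl fun σ hσ => ?_
    have hσV := (IsCellStructure.subset hK hσ).trans hP.2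
    change _ = target F _ * eulerMorphism E k _ _ * (scalarObj (-1) _ * _)
    rw [eulerMorphism_apply, scalarObj, FinSub.dim_along hσV]

theorem isStar_source {F : ConeFamily E k} (hF : IsMorphism F) :
    IsStar F (scaleCone (source F) (eulerMorphism E k)) (coneCompI (coneCompNeg F)) where
  left := hF
  right := (isMorphism_eulerMorphism E k).scaleCone hF.isObject_source
  result := hF.compNeg.compI
  compat := by rw [target_scale_eulerMorphism]
  exists_cells V P hP := (exists_coneCellStructure hP).imp fun _ h => h.1
  formula V P hP K hK := by
    change F V (negDilatation V (coneInterior V (coneCls V P))) = _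
    rw [negDilatation_coneInterior_eq_sum hK hP, map_sum]
    refine Finset.sum_congr rfl fun σ hσ => ?_
    have hσV := (IsCellStructure.subset hK hσ).trans hP.2
    have hpoly := IsConeCellStructure.polyhedra hK hP.2
    change _ = _ * (source F _ * eulerMorphism E k _ _)
    -- Multiplicativity splits the value of `F` on `V_σ + ν(σ, P)`; the factor from `V_σ` is `s(F)`,
    -- and the sign is the Euler number of the interior of `σ`.
    rw [eulerMorphism_apply, eulerHom_coneIntCls (hK.cells σ hσ)
      (subset_along_of_cone (hK.cells σ hσ) hσV), map_zsmul,
      hF.mul_of_prod_eq (V.along_isOrtho_perp σ) (FinSub.along_prod_perp hσV) isConeIn_submodule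
        (isConeIn_normalCone hK hpoly hσ (hK.cells σ hσ).nonempty), zsmul_eq_mul, source]
    push_cast
    ring

theorem isPolyStar_neg_location {G : PolyFamily E k} (hG : IsPolytopeInvariant G) :
    IsPolyStar (scaleCone (negObj (location G)) (eulerMorphism E k)) G
      (scalePoly (scalarObj (-1)) (polyCompI G)) where
  left := (isMorphism_eulerMorphism E k).scaleCone hG.isObject_location.negObj
  right := hG
  result := hG.compI.scalePoly (isObject_scalarObj (-1))
  compat := by rw [source_scale_eulerMorphism, negObj_negObj]
  exists_cells V P hP := exists_polyCellStructure hP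
  formula V P hP K hK := by
    change scalarObj (-1) V * G V (polyInterior V (polyCls V P)) = _
    rw [hG.polyInterior_eq_sum hK hP, Finset.mul_sum]
    refine Finset.sum_congr rfl fun σ hσ => ?_
    have hσV := (IsCellStructure.subset hK hσ).trans hP.2
    change _ = scalarObj (-1) _ * location G _ * eulerMorphism E k _ _ * _
    have h1 : ((-1 : k) ^ dim σ) * (-1) ^ dim σ = 1 := by rw [← mul_pow]; simp
    rw [eulerMorphism_apply, scalarObj, scalarObj, FinSub.dim_eq_add hσV, pow_add]
    linear_combination ((-1) ^ (V.perp σ).dim * location G (V.perp σ) *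
      ((eulerHom (V.perp σ) (coneCls (V.perp σ) (normalCone σ P)) : ℤ) : k) *
      G (V.along σ) (polyIntCls (V.along σ) (toOrigin σ))) * h1

theorem isPolyStar_location {G : PolyFamily E k} (hG : IsPolytopeInvariant G) :
    IsPolyStar (scaleCone (location G) (eulerMorphism E k)) (scalePoly (scalarObj (-1)) G)
      (polyCompI G) where
  left := (isMorphism_eulerMorphism E k).scaleCone hG.isObject_location
  right := hG.scalePoly (isObject_scalarObj (-1))
  result := hG.compI
  compat := by rw [source_scale_eulerMorphism]; rfl
  exists_cells V P hP := exists_polyCellStructure hP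
  formula V P hP K hK := by
    change G V (polyInterior V (polyCls V P)) = _
    rw [hG.polyInterior_eq_sum hK hP]
    refine Finset.sum_congr rfl fun σ hσ => ?_
    have hσV := (IsCellStructure.subset hK hσ).trans hP.2
    change _ = location G _ * eulerMorphism E k _ _ * (scalarObj (-1) _ * _)
    rw [eulerMorphism_apply, scalarObj, FinSub.dim_along hσV]

end Star

end Scissors

end

/-! ### Assembly of the theorem. -/

theorem mainTheorem11 {E : Type*} [NormedAddCommGroup E] [InnerProductSpace ℝ E]
    (hE : Module.rank ℝ E = Cardinal.aleph0) {k : Type*} [CommRing k] :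
    -- the operators `I`, `D` and the invariant `e` exist and are determined by their definitions
    (∀ V : Scissors.FinSub E,
      ((∃! I, Scissors.IsPolyInterior V I) ∧ Scissors.IsPolyInterior V (Scissors.polyInterior V)) ∧
      ((∃! I, Scissors.IsConeInterior V I) ∧ Scissors.IsConeInterior V (Scissors.coneInterior V)) ∧
      ((∃! D, Scissors.IsDuality V D) ∧ Scissors.IsDuality V (Scissors.duality V)) ∧
      ((∃! e, Scissors.IsLocalEuler V e) ∧ Scissors.IsLocalEuler V (Scissors.localEuler V))) ∧
    -- `D ∘ I = (-1)^d Δ(-1) ∘ I ∘ D`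
    (∀ (V : Scissors.FinSub E) (ξ : Scissors.ConeGroup V),
      Scissors.duality V (Scissors.coneInterior V ξ) =
        (-1 : ℤ) ^ V.dim •
          Scissors.negDilatation V (Scissors.coneInterior V (Scissors.duality V ξ))) ∧
    -- `(-p(G) • e) ⋆ G = - • GI` and `(p(G) • e) ⋆ (- • G) = GI`
    (∀ G : Scissors.PolyFamily E k, Scissors.IsPolytopeInvariant G →
      Scissors.IsPolyStar
        (Scissors.scaleCone (Scissors.negObj (Scissors.location G)) (Scissors.eulerMorphism E k))
        G
        (Scissors.scalePoly (Scissors.scalarObj (-1)) (Scissors.polyCompI G)) ∧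
      Scissors.IsPolyStar
        (Scissors.scaleCone (Scissors.location G) (Scissors.eulerMorphism E k))
        (Scissors.scalePoly (Scissors.scalarObj (-1)) G)
        (Scissors.polyCompI G)) ∧
    -- `(-t(F) • e) ⋆ F = - • FI`, `(t(F) • e) ⋆ (- • F) = FI` and `F ⋆ (s(F) • e) = FΔ(-1)I`
    (∀ F : Scissors.ConeFamily E k, Scissors.IsMorphism F →
      Scissors.IsStar
        (Scissors.scaleCone (Scissors.negObj (Scissors.target F)) (Scissors.eulerMorphism E k))
        F
        (Scissors.scaleCone (Scissors.scalarObj (-1)) (Scissors.coneCompI F)) ∧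
      Scissors.IsStar
        (Scissors.scaleCone (Scissors.target F) (Scissors.eulerMorphism E k))
        (Scissors.scaleCone (Scissors.scalarObj (-1)) F)
        (Scissors.coneCompI F) ∧
      Scissors.IsStar
        F
        (Scissors.scaleCone (Scissors.source F) (Scissors.eulerMorphism E k))
        (Scissors.coneCompI (Scissors.coneCompNeg F))) := by
  refine ⟨fun V => ⟨⟨⟨_, Scissors.isPolyInterior_polyInterior V, fun J hJ =>
      hJ.unique (Scissors.isPolyInterior_polyInterior V)⟩, Scissors.isPolyInterior_polyInterior V⟩,
    ⟨⟨_, Scissors.isConeInterior_coneInterior V, fun J hJ =>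
      hJ.unique (Scissors.isConeInterior_coneInterior V)⟩, Scissors.isConeInterior_coneInterior V⟩,
    ⟨⟨_, Scissors.isDuality_duality V, fun J hJ =>
      hJ.unique (Scissors.isDuality_duality V)⟩, Scissors.isDuality_duality V⟩,
    ⟨⟨_, Scissors.isLocalEuler_localEuler V, fun J hJ =>
      hJ.unique (Scissors.isLocalEuler_localEuler V)⟩, Scissors.isLocalEuler_localEuler V⟩⟩,
    fun V ξ => Scissors.duality_coneInterior V ξ,
    fun G hG => ⟨Scissors.isPolyStar_neg_location hG, Scissors.isPolyStar_location hG⟩,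
    fun F hF => ⟨Scissors.isStar_neg_target hF, Scissors.isStar_target hF,
      Scissors.isStar_source hF⟩⟩
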